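/- **Setting.** Let $\mathbb K\in\{\mathbb R,\mathbb C,\mathbb H\}$, let $\mathcal H$ be an infinite-dimensional Hilbert space over $\mathbb K$, and let $\mathfrak k=\mathfrak u_2(\mathcal H)$ be the real Lie algebra of $\mathbb K$-linear skew-adjoint Hilbert–Schmidt operators on $\mathcal H$, a Hilbert–Lie algebra with $\langle x,y\rangle=\operatorname{tr}_{\mathbb R}(xy^*)$. Automorphisms of $\mathfrak k$ are real Lie algebra automorphisms, and $\pi_U(x)=UxU^{-1}$ for a unitary operator $U$ on $\mathcal H$. For an automorphism $\varphi$ of finite order $N_\varphi$ put $\mathfrak k^\varphi=\{x\in\mathfrak k:\varphi(x)=x\}$, $\mathfrak t^\varphi=\mathfrak t\cap\mathfrak k^\varphi$ and $$\mathcal L_\varphi(\mathfrak k)=\{\xi\in C^\infty(\mathbb R,\mathfrak k):\xi(t+2\pi)=\varphi^{-1}(\xi(t))\ \forall t\},\qquad \langle\xi,\eta\rangle=\tfrac1{2\pi}\int_0^{2\pi}\langle\xi(t),\eta(t)\rangle\,dt .$$ Let $\mathfrak t_0\subseteq\mathfrak k^\varphi$ be a maximal abelian subalgebra, let $i\mathfrak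 t_0^*$ be the set of real-linear functionals $\mathfrak t_0\to i\mathbb R$, extended complex linearly, and for $\alpha\in i\mathfrak t_0^*$ let $\mathfrak k_{\mathbb C}^\alpha=\{x\in\mathfrak k_{\mathbb C}:[h,x]=\alpha(h)x\ \forall h\in\mathfrak t_0\}$. The nonzero $\alpha$ with $\mathfrak k_{\mathbb C}^\alpha\neq 0$ are the nonzero weights; for these (and for $\alpha=0$) $\alpha^\sharp\in i\mathfrak t_0$ is defined by $\langle h,\alpha^\sharp\rangle=\alpha(h)$ for $h\in\mathfrak t_0$, and $(\alpha,\beta)=\langle\alpha^\sharp,\beta^\sharp\rangle$. For $n\in\mathbb Z$ let $\Delta_n^\varphi$ be the set of nonzero weights $\alpha$ for which there is $0\ne x\in\mathfrak k_{\mathbb C}^\alpha$ with $\varphi^{-1}(x)=e^{2\pi i n/N_\varphi}x$. For $\nu\in i\mathfrak t_0^*$, if there is exactly one bounded operator $\overline D_\nu$ on $\mathfrak k$ with $\overline D_\nu x=i\nu(\alpha^\sharp)x$ for all $\alpha\in i\mathfrak t_0^*$ with $\mathfrak k_{\mathbb C}^\alpha\ne0$ and all $x\in\mathfrak k_{\mathbb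 C}^\alpha$, put $D_\nu\xi=\xi'+\overline D_\nu\circ\xi$. The $\nu$-slanted $\varphi$-twisted affinisation is $$\widehat{\mathcal L}^\nu_\varphi(\mathfrak k)=\mathbb R\oplus\mathcal L_\varphi(\mathfrak k)\oplus\mathbb R,\quad [(z_1,\xi_1,t_1),(z_2,\xi_2,t_2)]=(\langle D_\nu\xi_1,\xi_2\rangle,\,[\xi_1,\xi_2]+t_1D_\nu\xi_2-t_2D_\nu\xi_1,\,0),$$ which contains $\mathfrak t_0^e=\mathbb R\oplus\mathfrak t_0\oplus\mathbb R$ ($\mathfrak t_0$ as constant loops). For a real Lie algebra $\mathfrak g$ with an abelian subalgebra $\mathfrak s$ and complex conjugation $\sigma$ on $\mathfrak g_{\mathbb C}$, put $x^*=-\sigma(x)$. A root $\alpha\neq0$ (a functional on $\mathfrak s_{\mathbb C}$ with nonzero root space $\mathfrak g_{\mathbb C}^\alpha$) is *compact* if $\mathfrak g_{\mathbb C}^\alpha=\mathbb Cx_\alpha$ is one-dimensional, $[x_\alpha,x_\alpha^*]\in\mathfrak s_{\mathbb C}$ and $\alpha([x_\alpha,x_\alpha^*])>0$. Its coroot $\check\alpha$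 is the element of $\mathfrak s_{\mathbb C}\cap[\mathfrak g_{\mathbb C}^\alpha,\mathfrak g_{\mathbb C}^{-\alpha}]$ with $\alpha(\check\alpha)=2$, and the Weyl group $\mathcal W(\mathfrak g,\mathfrak s)\subseteq GL(\mathfrak s)$ is generated by the reflections $x\mapsto x-\alpha(x)\check\alpha$ for compact roots $\alpha$. **Hypotheses.** Let $\varphi,\psi$ be automorphisms of $\mathfrak k$ of finite orders $N_\varphi,N_\psi$, and $(U_t)_{t\in\mathbb R}$ a smooth one-parameter group of unitary operators on $\mathcal H$ such that the automorphisms $\phi_t=\pi_{U_t}$ commute with $\psi$ and $\phi_1\psi=\varphi$. Let $\mathfrak t$ be a maximal abelian subalgebra of $\mathfrak k$ such that $\mathfrak t^\varphi=\mathfrak t^\psi=:\mathfrak t_0$, such that $\mathfrak t_0$ is maximal abelian in both $\mathfrak k^\varphi$ and $\mathfrak k^\psi$, and such that $\mathfrak t_0\subseteq\mathfrak t^{\phi_t}$ for all $t$. Let $\mu,\nu\in i\mathfrak t_0^*$, where the numbers $\nu(\alpha^\sharp)$, $\alpha$ a nonzero $\mathfrak t_0$-weight, are bounded. Assume that the skew-adjoint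 operator $\Lambda_\mu=i\mu^\sharp$ is bounded; that is, $\Lambda_\mu$ is a bounded $\mathbb K$-linear skew-adjoint operator in the strong operator closure of $\mathfrak t_0$ with $\langle\Lambda_\mu,h\rangle=i\mu(h)$ for all $h\in i\mathfrak t_0$ of finite rank. Assume finally that $\frac{d}{dt}U_{t/2\pi}=-\Lambda_\mu U_{t/2\pi}=-U_{t/2\pi}\Lambda_\mu$ (in the strong sense). **Conclusion.** The operators $\overline D_\nu$ and $\overline D_{\mu+\nu}$ exist and are unique; they are skew-symmetric derivations of $\mathfrak k$ commuting with $\varphi$ and $\psi$ respectively, and $\varphi,\psi$ are isometric, so that both affinisations below are Lie algebras. Moreover: 1. The map $\widehat\Phi(z_1,\xi,z_2)=(z_1,\,t\mapsto\phi_{t/2\pi}(\xi(t)),\,z_2)$ is an isomorphism of Lie algebras $\widehat{\mathcal L}^\nu_\varphi(\mathfrak k)\to\widehat{\mathcal L}^{\mu+\nu}_\psi(\mathfrak k)$ which fixes $\mathfrak t_0^e$ pointwise. 2. The pairs in $R_\varphi=\{(\alpha,n):n\in\mathbb Z,\ \alpha\in\Delta^\varphi_n\}$ correspond bijectively to the compact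 roots of $\widehat{\mathcal L}^\nu_\varphi(\mathfrak k)$ with respect to $\mathfrak t_0^e$ through $(\alpha,n)(z,h,t)=\alpha(h)+it\big(\tfrac n{N_\varphi}+\nu(\alpha^\sharp)\big)$, and likewise $R_\psi$ for $\widehat{\mathcal L}^{\mu+\nu}_\psi(\mathfrak k)$ (with $N_\psi$ and $\mu+\nu$). The map $$\pi(\alpha,n)=\Big(\alpha,\ N_\psi\big(\tfrac n{N_\varphi}-\mu(\alpha^\sharp)\big)\Big)$$ is a bijection $R_\varphi\to R_\psi$. It extends to a $\mathbb Q$-linear isomorphism $\operatorname{span}_{\mathbb Q}R_\varphi\to\operatorname{span}_{\mathbb Q}R_\psi$ mapping $R_\varphi$ onto $R_\psi$ and preserving the form $((\alpha,m),(\beta,n))=(\alpha,\beta)$ (an isomorphism of locally affine root systems), and $\widehat\Phi$ maps the root space of $(\alpha,n)\in R_\varphi$ onto the root space of $\pi(\alpha,n)$. 3. The Weyl groups $\mathcal W(\widehat{\mathcal L}^\nu_\varphi(\mathfrak k),\mathfrak t_0^e)$ and $\mathcal W(\widehat{\mathcal L}^{\mu+\nu}_\psi(\mathfrak k),\mathfrak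 t_0^e)$ in $GL(\mathfrak t_0^e)$ coincide. -/

import Mathlib

open scoped TensorProduct InnerProductSpace ContDiff Quaternion

namespace TwistedLoop

/-! ### Roots, coroots and Weyl groups of real Lie algebras -/

section Roots

variable {T g : Type*} [AddCommGroup T] [Module ℝ T] [LieRing g] [LieAlgebra ℝ g]

/-- The operation `x ↦ x^* = -σ(x)` on the complexification `ℂ ⊗ g`, where `σ` is the complex
conjugation fixing the real form `g` pointwise. -/
noncomputable def starC : ℂ ⊗[ℝ] g →ₗ[ℝ] ℂ ⊗[ℝ] g :=
  -(TensorProduct.map Complex.conjAe.toLinearMap LinearMap.id)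

/-- Let `j : T → g` be an embedding of an abelian subalgebra `T` of `g`.  A complex linear
functional on `T_ℂ` is the same as a real linear map `α : T → ℂ`; the corresponding root space is
`{x ∈ g_ℂ | [h, x] = α(h) x for all h ∈ T}`. -/
noncomputable def rootSpace (j : T →ₗ[ℝ] g) (α : T →ₗ[ℝ] ℂ) : Submodule ℂ (ℂ ⊗[ℝ] g) where
  carrier := {x | ∀ h : T, ⁅(1 : ℂ) ⊗ₜ[ℝ] j h, x⁆ = α h • x}
  add_mem' := by
    intro x y hx hy h
    have e := lie_add (L := ℂ ⊗[ℝ] g) (M := ℂ ⊗[ℝ] g) ((1 : ℂ) ⊗ₜ[ℝ] j h) x y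
    exact e.trans ((congrArg₂ _ (hx h) (hy h)).trans (smul_add _ _ _).symm)
  zero_mem' := by
    intro h
    have e := lie_zero (L := ℂ ⊗[ℝ] g) (M := ℂ ⊗[ℝ] g) ((1 : ℂ) ⊗ₜ[ℝ] j h)
    exact e.trans (smul_zero _).symm
  smul_mem' := by
    intro c x hx h
    have e := lie_smul (L := ℂ ⊗[ℝ] g) (M := ℂ ⊗[ℝ] g) c ((1 : ℂ) ⊗ₜ[ℝ] j h) x
    exact e.trans ((congrArg _ (hx h)).trans (smul_comm _ _ _))

/-- The complex linear extension `T_ℂ → ℂ` of a functional `α : T → ℂ`. -/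
noncomputable def extendC (α : T →ₗ[ℝ] ℂ) : ℂ ⊗[ℝ] T →ₗ[ℂ] ℂ := α.liftBaseChange ℂ

/-- `α` is a root if it is nonzero and its root space is nonzero.  It is a compact root if moreover
the root space is spanned by one element `x` and `α([x, x^*])` is a positive real number. -/
def IsCompactRoot (j : T →ₗ[ℝ] g) (α : T →ₗ[ℝ] ℂ) : Prop :=
  α ≠ 0 ∧ ∃ x : ℂ ⊗[ℝ] g, x ≠ 0 ∧ rootSpace j α = Submodule.span ℂ {x} ∧
    ∃ (h : ℂ ⊗[ℝ] T) (r : ℝ), j.baseChange ℂ h = ⁅x, starC x⁆ ∧ extendC α h = (r : ℂ) ∧ 0 < r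

/-- `h ∈ T_ℂ` is the coroot of the compact root `α`: it lies in `[g_ℂ^α, g_ℂ^{-α}]` and satisfies
`α(h) = 2`. -/
def IsCoroot (j : T →ₗ[ℝ] g) (α : T →ₗ[ℝ] ℂ) (h : ℂ ⊗[ℝ] T) : Prop :=
  j.baseChange ℂ h ∈ Submodule.span ℂ
    {z | ∃ x ∈ rootSpace j α, ∃ y ∈ rootSpace j (-α), z = ⁅x, y⁆} ∧ extendC α h = 2

/-- The Weyl group: the subgroup of `GL(T)` generated by the reflections
`r_α(x) = x - α(x) α^∨`, where `α` runs through the compact roots. -/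
def weylGroup (j : T →ₗ[ℝ] g) : Subgroup (T ≃ₗ[ℝ] T) :=
  Subgroup.closure {r | ∃ (α : T →ₗ[ℝ] ℂ) (h : ℂ ⊗[ℝ] T), IsCompactRoot j α ∧ IsCoroot j α h ∧
    ∀ x : T, (1 : ℂ) ⊗ₜ[ℝ] r x = (1 : ℂ) ⊗ₜ[ℝ] x - α x • h}

/-- `t` is a maximal abelian subalgebra of the subalgebra `s`. -/
def IsMaxAbelianIn (t s : LieSubalgebra ℝ g) : Prop :=
  Maximal (fun t' : LieSubalgebra ℝ g => t' ≤ s ∧ ∀ x ∈ t', ∀ y ∈ t', ⁅x, y⁆ = 0) t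

/-- The subalgebra of fixed points of an automorphism. -/
def fixedPoints (φ : g ≃ₗ⁅ℝ⁆ g) : LieSubalgebra ℝ g where
  carrier := {x | φ x = x}
  add_mem' := by
    intro x y hx hy
    exact (map_add φ x y).trans (congrArg₂ _ hx hy)
  zero_mem' := map_zero φ
  smul_mem' := by
    intro c x hx
    exact (map_smul φ c x).trans (congrArg _ hx)
  lie_mem' := by
    intro x y hx hy
    exact (LieEquiv.map_lie φ x y).trans (congrArg₂ _ hx hy)

/-- `φ` has finite order in the group of automorphisms. -/
def FiniteOrder (φ : g ≃ₗ⁅ℝ⁆ g) : Prop := IsOfFinOrder φ.toLinearEquiv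

/-- The order of `φ` in the group of automorphisms. -/
noncomputable def autOrder (φ : g ≃ₗ⁅ℝ⁆ g) : ℕ := orderOf φ.toLinearEquiv

/-- An element `α` of `i t^*` is written as `α = i a`, with `a` a real linear functional on `t`. -/
noncomputable def imag (a : Module.Dual ℝ T) : T →ₗ[ℝ] ℂ :=
  Complex.I • (Complex.ofRealCLM.toLinearMap ∘ₗ a)

end Roots

/-! ### Hilbert--Lie algebras and their affinisations -/

/-- A Hilbert--Lie algebra: a real Lie algebra which is a real Hilbert space with invariant scalar
product, with continuous Lie bracket. -/
class HilbertLieAlgebra (k : Type*) extends NormedAddCommGroup k, InnerProductSpace ℝ k,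
    LieRing k, LieAlgebra ℝ k where
  complete : CompleteSpace k
  inner_lie : ∀ x y z : k, ⟪⁅x, y⁆, z⟫_ℝ = ⟪x, ⁅y, z⁆⟫_ℝ
  norm_lie_le : ∃ C : ℝ, ∀ x y : k, ‖⁅x, y⁆‖ ≤ C * ‖x‖ * ‖y‖

section Affine

variable {k : Type*} [HilbertLieAlgebra k]

/-- The Lie bracket as a continuous bilinear map. -/
noncomputable def lieCLM (k : Type*) [HilbertLieAlgebra k] : k →L[ℝ] k →L[ℝ] k :=
  LinearMap.mkContinuous₂
    (LinearMap.mk₂ ℝ (fun x y : k => ⁅x, y⁆) add_lie smul_lie lie_add lie_smul)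
    (HilbertLieAlgebra.norm_lie_le (k := k)).choose
    (HilbertLieAlgebra.norm_lie_le (k := k)).choose_spec

theorem lieCLM_apply (x y : k) : lieCLM k x y = ⁅x, y⁆ := rfl

theorem contDiff_lie {ξ η : ℝ → k} (hξ : ContDiff ℝ ∞ ξ) (hη : ContDiff ℝ ∞ η) :
    ContDiff ℝ ∞ fun t => ⁅ξ t, η t⁆ := by
  have h := ((lieCLM k).contDiff.comp hξ).clm_apply hη
  exact h

theorem hasDerivAt_lie {ξ η : ℝ → k} {ξ' η' : k} {t : ℝ} (hξ : HasDerivAt ξ ξ' t)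
    (hη : HasDerivAt η η' t) :
    HasDerivAt (fun t => ⁅ξ t, η t⁆) (⁅ξ', η t⁆ + ⁅ξ t, η'⁆) t := by
  have h := ((lieCLM k).hasFDerivAt.comp_hasDerivAt t hξ).clm_apply hη
  exact h

/-- The `φ`-twisted loop algebra
`{ξ ∈ C^∞(ℝ, k) | ξ(t + 2π) = φ⁻¹(ξ(t)) for all t}`. -/
def Loop (φ : k ≃ₗ⁅ℝ⁆ k) : Submodule ℝ (ℝ → k) where
  carrier := {ξ | ContDiff ℝ ∞ ξ ∧ ∀ t, ξ (t + 2 * Real.pi) = φ.symm (ξ t)}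
  add_mem' := by
    rintro ξ η ⟨h1, h2⟩ ⟨h3, h4⟩
    refine ⟨h1.add h3, fun t => ?_⟩
    simp only [Pi.add_apply, h2, h4, map_add]
  zero_mem' := ⟨contDiff_const, fun t => by simp⟩
  smul_mem' := by
    rintro c ξ ⟨h1, h2⟩
    refine ⟨h1.const_smul c, fun t => ?_⟩
    simp only [Pi.smul_apply, h2, map_smul]

namespace Loop

variable {φ : k ≃ₗ⁅ℝ⁆ k}

theorem smooth (ξ : Loop φ) : ContDiff ℝ ∞ (ξ : ℝ → k) := ξ.2.1

theorem differentiable (ξ : Loop φ) : Differentiable ℝ (ξ : ℝ → k) :=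
  (smooth ξ).differentiable (by simp)

/-- The pointwise Lie bracket of loops. -/
instance : Bracket (Loop φ) (Loop φ) where
  bracket ξ η := ⟨fun t => ⁅ξ.1 t, η.1 t⁆, contDiff_lie ξ.2.1 η.2.1, fun t => by
    simp only [ξ.2.2, η.2.2, LieEquiv.map_lie]⟩

theorem lie_apply (ξ η : Loop φ) (t : ℝ) : (⁅ξ, η⁆ : Loop φ).1 t = ⁅ξ.1 t, η.1 t⁆ := rfl

instance : LieRing (Loop φ) where
  add_lie _ _ _ := Subtype.ext (funext fun _ => add_lie _ _ _)
  lie_add _ _ _ := Subtype.ext (funext fun _ => lie_add _ _ _)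
  lie_self _ := Subtype.ext (funext fun _ => lie_self _)
  leibniz_lie _ _ _ := Subtype.ext (funext fun _ => leibniz_lie _ _ _)

instance : LieAlgebra ℝ (Loop φ) where
  lie_smul _ _ _ := Subtype.ext (funext fun _ => lie_smul _ _ _)

/-- The bilinear form `⟨ξ, η⟩ = (1 / 2π) ∫_0^{2π} ⟨ξ(t), η(t)⟩ dt` on the loop algebra. -/
noncomputable def form (ξ η : Loop φ) : ℝ :=
  (2 * Real.pi)⁻¹ * ∫ t in (0 : ℝ)..(2 * Real.pi), ⟪ξ.1 t, η.1 t⟫_ℝ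

theorem intervalIntegrable (ξ η : Loop φ) (a b : ℝ) :
    IntervalIntegrable (fun t => ⟪ξ.1 t, η.1 t⟫_ℝ) MeasureTheory.volume a b :=
  ((smooth ξ).continuous.inner (smooth η).continuous).intervalIntegrable a b

theorem form_add_left (ξ ξ' η : Loop φ) : form (ξ + ξ') η = form ξ η + form ξ' η := by
  unfold form
  rw [← mul_add, ← intervalIntegral.integral_add (intervalIntegrable _ _ _ _)
    (intervalIntegrable _ _ _ _)]
  simp [inner_add_left]

theorem form_smul_left (c : ℝ) (ξ η : Loop φ) : form (c • ξ) η = c * form ξ η := by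
  unfold form
  rw [mul_left_comm, ← intervalIntegral.integral_const_mul]
  simp [inner_smul_left]

theorem form_comm (ξ η : Loop φ) : form ξ η = form η ξ := by
  unfold form
  simp_rw [real_inner_comm]

theorem form_add_right (ξ η η' : Loop φ) : form ξ (η + η') = form ξ η + form ξ η' := by
  rw [form_comm, form_add_left, form_comm η, form_comm η']

theorem form_smul_right (c : ℝ) (ξ η : Loop φ) : form ξ (c • η) = c * form ξ η := by
  rw [form_comm, form_smul_left, form_comm]

theorem form_lie (ξ η ζ : Loop φ) : form ⁅ξ, η⁆ ζ = form ξ ⁅η, ζ⁆ := by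
  unfold form
  simp_rw [lie_apply, HilbertLieAlgebra.inner_lie]

end Loop

/-- `D` is a continuous skew-symmetric derivation of the Hilbert--Lie algebra `k` that commutes with
the isometric automorphism `φ`, so that `ξ ↦ ξ' + D ∘ ξ` is a skew-symmetric derivation of the
`φ`-twisted loop algebra. -/
structure IsTwistDerivation (φ : k ≃ₗ⁅ℝ⁆ k) (D : k →L[ℝ] k) : Prop where
  isometry : ∀ x, ‖φ x‖ = ‖x‖
  leibniz : ∀ x y, D ⁅x, y⁆ = ⁅D x, y⁆ + ⁅x, D y⁆
  skew : ∀ x y, ⟪D x, y⟫_ℝ = -⟪x, D y⟫_ℝ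
  comm : ∀ x, D (φ x) = φ (D x)

namespace IsTwistDerivation

variable {φ : k ≃ₗ⁅ℝ⁆ k} {D : k →L[ℝ] k}

theorem norm_symm (h : IsTwistDerivation φ D) (x : k) : ‖φ.symm x‖ = ‖x‖ := by
  rw [← h.isometry (φ.symm x), LieEquiv.apply_symm_apply]

/-- The inverse of `φ` as a linear isometry. -/
def symmIsometry (h : IsTwistDerivation φ D) : k →ₗᵢ[ℝ] k :=
  ⟨φ.symm.toLinearEquiv.toLinearMap, h.norm_symm⟩

theorem inner_symm (h : IsTwistDerivation φ D) (x y : k) :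
    ⟪φ.symm x, φ.symm y⟫_ℝ = ⟪x, y⟫_ℝ :=
  h.symmIsometry.inner_map_map x y

theorem comm_symm (h : IsTwistDerivation φ D) (x : k) : D (φ.symm x) = φ.symm (D x) := by
  have e := h.comm (φ.symm x)
  rw [LieEquiv.apply_symm_apply] at e
  rw [e, LieEquiv.symm_apply_apply]

theorem deriv_add_period (h : IsTwistDerivation φ D) (ξ : Loop φ) (t : ℝ) :
    deriv ξ.1 (t + 2 * Real.pi) = φ.symm (deriv ξ.1 t) := by
  have e : (fun s => ξ.1 (s + 2 * Real.pi)) = fun s => h.symmIsometry (ξ.1 s) :=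
    funext fun s => ξ.2.2 s
  rw [← deriv_comp_add_const, e]
  exact (h.symmIsometry.toContinuousLinearMap.hasFDerivAt.comp_hasDerivAt t
    (Loop.differentiable ξ t).hasDerivAt).deriv

/-- The derivation `ξ ↦ ξ' + D ∘ ξ` of the twisted loop algebra. -/
noncomputable def loopDer (h : IsTwistDerivation φ D) : Loop φ →ₗ[ℝ] Loop φ where
  toFun ξ := ⟨fun t => deriv ξ.1 t + D (ξ.1 t),
    (contDiff_infty_iff_deriv.1 (Loop.smooth ξ)).2.add (D.contDiff.comp (Loop.smooth ξ)),
    fun t => by simp only [h.deriv_add_period, ξ.2.2, h.comm_symm, map_add]⟩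
  map_add' ξ η := Subtype.ext (funext fun t => by
    change deriv (ξ.1 + η.1) t + D (ξ.1 t + η.1 t) = _
    rw [deriv_add (Loop.differentiable ξ t) (Loop.differentiable η t), map_add]
    exact add_add_add_comm _ _ _ _)
  map_smul' c ξ := Subtype.ext (funext fun t => by
    change deriv (c • ξ.1) t + D (c • ξ.1 t) = c • (deriv ξ.1 t + D (ξ.1 t))
    rw [deriv_const_smul_field, map_smul, smul_add])

theorem loopDer_apply (h : IsTwistDerivation φ D) (ξ : Loop φ) (t : ℝ) :
    (h.loopDer ξ).1 t = deriv ξ.1 t + D (ξ.1 t) := rfl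

theorem loopDer_lie (h : IsTwistDerivation φ D) (ξ η : Loop φ) :
    h.loopDer ⁅ξ, η⁆ = ⁅h.loopDer ξ, η⁆ + ⁅ξ, h.loopDer η⁆ := by
  refine Subtype.ext (funext fun t => ?_)
  change deriv (fun t => ⁅ξ.1 t, η.1 t⁆) t + D ⁅ξ.1 t, η.1 t⁆ =
    ⁅deriv ξ.1 t + D (ξ.1 t), η.1 t⁆ + ⁅ξ.1 t, deriv η.1 t + D (η.1 t)⁆
  rw [(hasDerivAt_lie (Loop.differentiable ξ t).hasDerivAt
    (Loop.differentiable η t).hasDerivAt).deriv, h.leibniz, add_lie, lie_add]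
  exact add_add_add_comm _ _ _ _

theorem loopDer_skew (h : IsTwistDerivation φ D) (ξ η : Loop φ) :
    Loop.form (h.loopDer ξ) η = -Loop.form ξ (h.loopDer η) := by
  rw [← add_eq_zero_iff_eq_neg]
  unfold Loop.form
  rw [← mul_add, ← intervalIntegral.integral_add (Loop.intervalIntegrable _ _ _ _)
    (Loop.intervalIntegrable _ _ _ _)]
  have e : ∀ t, HasDerivAt (fun t => ⟪ξ.1 t, η.1 t⟫_ℝ)
      (⟪(h.loopDer ξ).1 t, η.1 t⟫_ℝ + ⟪ξ.1 t, (h.loopDer η).1 t⟫_ℝ) t := by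
    intro t
    refine ((Loop.differentiable ξ t).hasDerivAt.inner ℝ
      (Loop.differentiable η t).hasDerivAt).congr_deriv ?_
    rw [loopDer_apply, loopDer_apply, inner_add_left, inner_add_right, h.skew]
    ring
  rw [intervalIntegral.integral_eq_sub_of_hasDerivAt (fun t _ => e t)
    ((Loop.intervalIntegrable _ _ _ _).add (Loop.intervalIntegrable _ _ _ _))]
  have p := h.inner_symm (ξ.1 0) (η.1 0)
  rw [← ξ.2.2, ← η.2.2, zero_add] at p
  rw [p]
  simp

end IsTwistDerivation

/-- The double extension `(ℝ ⊕_ω L_φ(k)) ⋊ ℝ` of the `φ`-twisted loop algebra by the derivation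
`δ ξ = ξ' + D ∘ ξ`, with `ω(ξ, η) = ⟨δ ξ, η⟩`.  Its elements are the triples `(z, ξ, t)`. -/
def Affinisation {φ : k ≃ₗ⁅ℝ⁆ k} {D : k →L[ℝ] k} (_h : IsTwistDerivation φ D) : Type _ :=
  ℝ × Loop φ × ℝ

namespace Affinisation

variable {φ : k ≃ₗ⁅ℝ⁆ k} {D : k →L[ℝ] k} {h : IsTwistDerivation φ D}

instance : AddCommGroup (Affinisation h) := inferInstanceAs (AddCommGroup (ℝ × Loop φ × ℝ))

instance : Module ℝ (Affinisation h) := inferInstanceAs (Module ℝ (ℝ × Loop φ × ℝ))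

/-- The element `(z, ξ, t)` of the double extension. -/
def mk (h : IsTwistDerivation φ D) (z : ℝ) (ξ : Loop φ) (t : ℝ) : Affinisation h := (z, ξ, t)

/-- `[(z₁, ξ₁, t₁), (z₂, ξ₂, t₂)] = (ω(ξ₁, ξ₂), [ξ₁, ξ₂] + t₁ δ ξ₂ - t₂ δ ξ₁, 0)`. -/
noncomputable instance : Bracket (Affinisation h) (Affinisation h) where
  bracket x y := mk h (Loop.form (h.loopDer x.2.1) y.2.1)
    (⁅x.2.1, y.2.1⁆ + x.2.2 • h.loopDer y.2.1 - y.2.2 • h.loopDer x.2.1) 0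

theorem lie_def (x y : Affinisation h) : ⁅x, y⁆ = mk h (Loop.form (h.loopDer x.2.1) y.2.1)
    (⁅x.2.1, y.2.1⁆ + x.2.2 • h.loopDer y.2.1 - y.2.2 • h.loopDer x.2.1) 0 := rfl

theorem ext' {x y : Affinisation h} (h1 : x.1 = y.1) (h2 : x.2.1 = y.2.1)
    (h3 : x.2.2 = y.2.2) : x = y :=
  Prod.ext h1 (Prod.ext h2 h3)

theorem form_loopDer_self (ξ : Loop φ) : Loop.form (h.loopDer ξ) ξ = 0 := by
  have e := h.loopDer_skew ξ ξ
  rw [Loop.form_comm ξ] at e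
  linarith

noncomputable instance : LieRing (Affinisation h) where
  add_lie x y z := by
    refine ext' ?_ ?_ ?_
    · change Loop.form (h.loopDer (x.2.1 + y.2.1)) z.2.1 = _ + _
      rw [map_add, Loop.form_add_left]
      rfl
    · change ⁅x.2.1 + y.2.1, z.2.1⁆ + (x.2.2 + y.2.2) • h.loopDer z.2.1
        - z.2.2 • h.loopDer (x.2.1 + y.2.1)
        = (⁅x.2.1, z.2.1⁆ + x.2.2 • h.loopDer z.2.1 - z.2.2 • h.loopDer x.2.1)
        + (⁅y.2.1, z.2.1⁆ + y.2.2 • h.loopDer z.2.1 - z.2.2 • h.loopDer y.2.1)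
      rw [map_add, add_lie, smul_add, add_smul]
      abel
    · exact (add_zero (0 : ℝ)).symm
  lie_add x y z := by
    refine ext' ?_ ?_ ?_
    · exact Loop.form_add_right _ _ _
    · change ⁅x.2.1, y.2.1 + z.2.1⁆ + x.2.2 • h.loopDer (y.2.1 + z.2.1)
        - (y.2.2 + z.2.2) • h.loopDer x.2.1
        = (⁅x.2.1, y.2.1⁆ + x.2.2 • h.loopDer y.2.1 - y.2.2 • h.loopDer x.2.1)
        + (⁅x.2.1, z.2.1⁆ + x.2.2 • h.loopDer z.2.1 - z.2.2 • h.loopDer x.2.1)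
      rw [map_add, lie_add, smul_add, add_smul]
      abel
    · exact (add_zero (0 : ℝ)).symm
  lie_self x := by
    refine ext' (form_loopDer_self _) ?_ rfl
    change ⁅x.2.1, x.2.1⁆ + x.2.2 • h.loopDer x.2.1 - x.2.2 • h.loopDer x.2.1 = 0
    rw [lie_self]
    abel
  leibniz_lie x y z := by
    obtain ⟨a, x, r⟩ := x
    obtain ⟨b, y, s⟩ := y
    obtain ⟨c, z, t⟩ := z
    refine ext' ?_ ?_ ?_
    · change Loop.form (h.loopDer x) (⁅y, z⁆ + s • h.loopDer z - t • h.loopDer y)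
        = Loop.form (h.loopDer (⁅x, y⁆ + r • h.loopDer y - s • h.loopDer x)) z
        + Loop.form (h.loopDer y) (⁅x, z⁆ + r • h.loopDer z - t • h.loopDer x)
      simp only [sub_eq_add_neg, ← neg_smul, map_add, map_smul, Loop.form_add_right,
        Loop.form_add_left, Loop.form_smul_left, Loop.form_smul_right, h.loopDer_lie,
        h.loopDer_skew (h.loopDer _), Loop.form_lie]
      have e : Loop.form x ⁅h.loopDer y, z⁆ = -Loop.form (h.loopDer y) ⁅x, z⁆ := by
        rw [← Loop.form_lie, ← Loop.form_lie, ← lie_skew, ← neg_one_smul ℝ, Loop.form_smul_left]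
        ring
      rw [e, Loop.form_comm (h.loopDer y) (h.loopDer x)]
      ring
    · change ⁅x, ⁅y, z⁆ + s • h.loopDer z - t • h.loopDer y⁆
          + r • h.loopDer (⁅y, z⁆ + s • h.loopDer z - t • h.loopDer y) - (0 : ℝ) • h.loopDer x
        = (⁅⁅x, y⁆ + r • h.loopDer y - s • h.loopDer x, z⁆ + (0 : ℝ) • h.loopDer z
          - t • h.loopDer (⁅x, y⁆ + r • h.loopDer y - s • h.loopDer x))
        + (⁅y, ⁅x, z⁆ + r • h.loopDer z - t • h.loopDer x⁆
          + s • h.loopDer (⁅x, z⁆ + r • h.loopDer z - t • h.loopDer x) - (0 : ℝ) • h.loopDer y)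
      simp only [map_add, map_sub, map_smul, h.loopDer_lie, lie_add, lie_sub, add_lie, sub_lie,
        lie_smul, smul_lie, smul_add, smul_sub, zero_smul, leibniz_lie x y z, smul_smul]
      rw [← lie_skew y (h.loopDer x), mul_comm s r, mul_comm t r, mul_comm t s]
      simp only [smul_neg]
      abel
    · exact (add_zero (0 : ℝ)).symm

noncomputable instance : LieAlgebra ℝ (Affinisation h) where
  lie_smul c x y := by
    refine ext' ?_ ?_ ?_
    · exact Loop.form_smul_right _ _ _
    · change ⁅x.2.1, c • y.2.1⁆ + x.2.2 • h.loopDer (c • y.2.1)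
        - (c • y.2.2) • h.loopDer x.2.1
        = c • (⁅x.2.1, y.2.1⁆ + x.2.2 • h.loopDer y.2.1 - y.2.2 • h.loopDer x.2.1)
      rw [map_smul, lie_smul, smul_sub, smul_add, smul_assoc, smul_comm c y.2.2, smul_comm c x.2.2]
    · exact (mul_zero c).symm

end Affinisation

end Affine

/-! ### The Hilbert--Lie algebra `u₂(H)` of a real, complex or quaternionic Hilbert space -/

/-- A Hilbert space over `K` (one of `ℝ`, `ℂ`, `ℍ`), viewed as a real Hilbert space: the scalars
`c ∈ K` act on `H` with adjoint the action of the conjugate of `c`. -/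
class IsHilbertOver (K H : Type*) [Ring K] [StarRing K] [NormedAddCommGroup H]
    [InnerProductSpace ℝ H] [Module K H] : Prop where
  inner_smul : ∀ (c : K) (v w : H), ⟪c • v, w⟫_ℝ = ⟪v, star c • w⟫_ℝ

section Operators

variable (K H : Type*) [Ring K] [Algebra ℝ K] [NormedAddCommGroup H]
  [InnerProductSpace ℝ H] [CompleteSpace H] [Module K H] [IsScalarTower ℝ K H]

/-- The index set of an orthonormal basis of the real Hilbert space `H`. -/
def basisIndex (H : Type*) [NormedAddCommGroup H] [InnerProductSpace ℝ H] [CompleteSpace H] :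
    Set H := (exists_hilbertBasis ℝ H).choose

/-- An orthonormal basis of the real Hilbert space `H`.  It serves to compute Hilbert--Schmidt norms
and traces, which do not depend on it. -/
noncomputable def hBasis (H : Type*) [NormedAddCommGroup H] [InnerProductSpace ℝ H]
    [CompleteSpace H] : HilbertBasis (basisIndex H) ℝ H :=
  (exists_hilbertBasis ℝ H).choose_spec.choose

/-- `x` is a Hilbert--Schmidt operator. -/
def IsHilbertSchmidt {H : Type*} [NormedAddCommGroup H] [InnerProductSpace ℝ H] [CompleteSpace H]
    (x : H →L[ℝ] H) : Prop := Summable fun i => ‖x (hBasis H i)‖ ^ 2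

/-- The real trace pairing `⟨x, y⟩ = tr_ℝ(x y^*) = tr_ℝ(y^* x)`. -/
noncomputable def trPair {H : Type*} [NormedAddCommGroup H] [InnerProductSpace ℝ H]
    [CompleteSpace H] (x y : H →L[ℝ] H) : ℝ := ∑' i, ⟪x (hBasis H i), y (hBasis H i)⟫_ℝ

/-- `u(H)`: the bounded `K`-linear skew-adjoint operators. -/
def IsSkew (K : Type*) {H : Type*} [Ring K] [NormedAddCommGroup H] [InnerProductSpace ℝ H]
    [Module K H] (x : H →L[ℝ] H) : Prop :=
  (∀ (c : K) (v : H), x (c • v) = c • x v) ∧ ∀ v w, ⟪x v, w⟫_ℝ = -⟪v, x w⟫_ℝ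

variable {H}

theorem hs_memLp {x : H →L[ℝ] H} (hx : IsHilbertSchmidt x) :
    Memℓp (fun i => x (hBasis H i)) 2 := by
  refine memℓp_gen ?_
  simpa [IsHilbertSchmidt] using hx

theorem hs_of_memLp {x : H →L[ℝ] H} (hx : Memℓp (fun i => x (hBasis H i)) 2) :
    IsHilbertSchmidt x := by
  have e := hx.summable (by simp)
  simpa [IsHilbertSchmidt] using e

theorem IsHilbertSchmidt.comp_left {x : H →L[ℝ] H} (hx : IsHilbertSchmidt x) (y : H →L[ℝ] H) :
    IsHilbertSchmidt (y * x) := by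
  refine Summable.of_nonneg_of_le (fun _ => by positivity) (fun i => ?_) (hx.mul_left (‖y‖ ^ 2))
  rw [← mul_pow]
  exact pow_le_pow_left₀ (norm_nonneg _) (y.le_opNorm _) 2

theorem ofReal_norm_sq_eq_tsum {ι : Type*} (b : HilbertBasis ι ℝ H) (v : H) :
    ENNReal.ofReal (‖v‖ ^ 2) = ∑' i, ENNReal.ofReal (⟪v, b i⟫_ℝ ^ 2) := by
  have e := b.hasSum_inner_mul_inner v v
  have e2 : (fun i => ⟪v, b i⟫_ℝ * ⟪b i, v⟫_ℝ) = fun i => ⟪v, b i⟫_ℝ ^ 2 := by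
    funext i
    rw [real_inner_comm v (b i), sq]
  rw [e2] at e
  rw [← ENNReal.ofReal_tsum_of_nonneg (fun _ => sq_nonneg _) e.summable, e.tsum_eq,
    real_inner_self_eq_norm_sq]

/-- The Hilbert--Schmidt norms of an operator and of its adjoint, computed in arbitrary orthonormal
bases, coincide. -/
theorem hs_adjoint {ι ι' : Type*} (b : HilbertBasis ι ℝ H) (b' : HilbertBasis ι' ℝ H)
    {x y : H →L[ℝ] H} (hx : ∀ v w, ⟪x v, w⟫_ℝ = ⟪v, y w⟫_ℝ) :
    ∑' i, ENNReal.ofReal (‖x (b i)‖ ^ 2) = ∑' i, ENNReal.ofReal (‖y (b' i)‖ ^ 2) := by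
  have e1 : ∀ i j, ⟪x (b i), b' j⟫_ℝ ^ 2 = ⟪y (b' j), b i⟫_ℝ ^ 2 := by
    intro i j
    rw [hx, real_inner_comm]
  calc ∑' i, ENNReal.ofReal (‖x (b i)‖ ^ 2)
      = ∑' i, ∑' j, ENNReal.ofReal (⟪x (b i), b' j⟫_ℝ ^ 2) :=
        tsum_congr fun i => ofReal_norm_sq_eq_tsum b' _
    _ = ∑' j, ∑' i, ENNReal.ofReal (⟪x (b i), b' j⟫_ℝ ^ 2) := ENNReal.tsum_comm
    _ = ∑' j, ∑' i, ENNReal.ofReal (⟪y (b' j), b i⟫_ℝ ^ 2) :=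
        tsum_congr fun j => tsum_congr fun i => by rw [e1]
    _ = _ := tsum_congr fun i => (ofReal_norm_sq_eq_tsum b _).symm

theorem skew_basis {ι ι' : Type*} (b : HilbertBasis ι ℝ H) (b' : HilbertBasis ι' ℝ H)
    {x : H →L[ℝ] H} (hx : ∀ v w, ⟪x v, w⟫_ℝ = -⟪v, x w⟫_ℝ)
    (hs : Summable fun i => ‖x (b i)‖ ^ 2) : Summable fun i => ‖x (b' i)‖ ^ 2 := by
  have e := hs_adjoint (x := x) (y := -x) b b' (fun v w => by simp [hx])
  simp only [_root_.neg_apply, norm_neg] at e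
  have f : ∑' i, ENNReal.ofReal (‖x (b' i)‖ ^ 2) ≠ ⊤ := by
    rw [← e, ← ENNReal.ofReal_tsum_of_nonneg (fun _ => by positivity) hs]
    exact ENNReal.ofReal_ne_top
  refine (ENNReal.summable_toReal f).congr fun i => ?_
  rw [ENNReal.toReal_ofReal (by positivity)]

theorem trPair_self_adjoint {x y : H →L[ℝ] H} (hx : ∀ v w, ⟪x v, w⟫_ℝ = ⟪v, y w⟫_ℝ)
    (hs : IsHilbertSchmidt x) (hs' : IsHilbertSchmidt y) : trPair x x = trPair y y := by
  have e := hs_adjoint (hBasis H) (hBasis H) hx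
  rw [← ENNReal.ofReal_tsum_of_nonneg (fun _ => by positivity) hs,
    ← ENNReal.ofReal_tsum_of_nonneg (fun _ => by positivity) hs',
    ENNReal.ofReal_eq_ofReal_iff (tsum_nonneg fun _ => by positivity)
      (tsum_nonneg fun _ => by positivity)] at e
  simpa only [trPair, real_inner_self_eq_norm_sq] using e

theorem summable_trPair {x y : H →L[ℝ] H} (hx : IsHilbertSchmidt x) (hy : IsHilbertSchmidt y) :
    Summable fun i => ⟪x (hBasis H i), y (hBasis H i)⟫_ℝ :=
  lp.summable_inner (𝕜 := ℝ) (⟨_, hs_memLp hx⟩ : lp (fun _ : basisIndex H => H) 2)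
    ⟨_, hs_memLp hy⟩

theorem IsHilbertSchmidt.add {x y : H →L[ℝ] H} (hx : IsHilbertSchmidt x)
    (hy : IsHilbertSchmidt y) : IsHilbertSchmidt (x + y) :=
  hs_of_memLp ((hs_memLp hx).add (hs_memLp hy))

theorem trPair_add_self {x y : H →L[ℝ] H} (hx : IsHilbertSchmidt x) (hy : IsHilbertSchmidt y) :
    trPair (x + y) (x + y) = trPair x x + 2 * trPair x y + trPair y y := by
  unfold trPair
  rw [← tsum_mul_left, ← (summable_trPair hx hx).tsum_add ((summable_trPair hx hy).mul_left 2),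
    ← ((summable_trPair hx hx).add ((summable_trPair hx hy).mul_left 2)).tsum_add
      (summable_trPair hy hy)]
  refine tsum_congr fun i => ?_
  exact real_inner_add_add_self _ _

theorem trPair_adjoint {x x' y y' : H →L[ℝ] H} (hx : ∀ v w, ⟪x v, w⟫_ℝ = ⟪v, x' w⟫_ℝ)
    (hy : ∀ v w, ⟪y v, w⟫_ℝ = ⟪v, y' w⟫_ℝ) (h1 : IsHilbertSchmidt x) (h2 : IsHilbertSchmidt x')
    (h3 : IsHilbertSchmidt y) (h4 : IsHilbertSchmidt y') : trPair x y = trPair x' y' := by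
  have e1 := trPair_self_adjoint hx h1 h2
  have e2 := trPair_self_adjoint hy h3 h4
  have e3 := trPair_self_adjoint (x := x + y) (y := x' + y')
    (fun v w => by
      rw [_root_.add_apply, _root_.add_apply, inner_add_left,
        inner_add_right, hx, hy]) (h1.add h3) (h2.add h4)
  rw [trPair_add_self h1 h3, trPair_add_self h2 h4] at e3
  linarith

theorem skew_norm_sq_le {x : H →L[ℝ] H} (hx : ∀ v w, ⟪x v, w⟫_ℝ = -⟪v, x w⟫_ℝ)
    (hs : IsHilbertSchmidt x) (v : H) :
    ‖x v‖ ^ 2 ≤ (∑' i, ‖x (hBasis H i)‖ ^ 2) * ‖v‖ ^ 2 := by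
  have e := (hBasis H).hasSum_inner_mul_inner (x v) (x v)
  rw [real_inner_self_eq_norm_sq] at e
  refine hasSum_le (fun i => ?_) e (hs.hasSum.mul_right (‖v‖ ^ 2))
  rw [real_inner_comm (x v) (hBasis H i), ← sq, hx, neg_sq, ← mul_pow, mul_comm]
  refine sq_le_sq' ?_ (real_inner_le_norm _ _)
  have := abs_le.1 (abs_real_inner_le_norm v (x (hBasis H i)))
  exact this.1

variable (H)

/-- The space of `K`-linear skew-adjoint Hilbert--Schmidt operators on `H`. -/
def u2 : Submodule ℝ (H →L[ℝ] H) where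
  carrier := {x | IsSkew K x ∧ IsHilbertSchmidt x}
  add_mem' := by
    rintro x y ⟨⟨h1, h2⟩, h3⟩ ⟨⟨h4, h5⟩, h6⟩
    refine ⟨⟨fun c v => ?_, fun v w => ?_⟩, hs_of_memLp ((hs_memLp h3).add (hs_memLp h6))⟩
    · simp [h1, h4]
    · simp only [_root_.add_apply, inner_add_left, inner_add_right, h2 v, h5 v]
      ring
  zero_mem' := ⟨⟨fun c v => by simp, fun v w => by simp⟩, by simp [IsHilbertSchmidt, summable_zero]⟩
  smul_mem' := by
    rintro r x ⟨⟨h1, h2⟩, h3⟩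
    refine ⟨⟨fun c v => ?_, fun v w => ?_⟩, hs_of_memLp ((hs_memLp h3).const_smul r)⟩
    · simp only [_root_.smul_apply, h1]
      exact smul_comm r c (x v)
    · simp only [_root_.smul_apply, inner_smul_left, inner_smul_right, h2 v]
      simp

/-- The Lie algebra `u₂(H)` of `K`-linear skew-adjoint Hilbert--Schmidt operators on `H`. -/
def U2 : Type _ := u2 K H

namespace U2

variable {K H}

/-- The operator underlying an element of `u₂(H)`. -/
def op (x : U2 K H) : H →L[ℝ] H := x.1

theorem op_injective {x y : U2 K H} (h : op x = op y) : x = y := Subtype.ext h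

theorem op_skew (x : U2 K H) : IsSkew K (op x) := x.2.1

theorem op_hs (x : U2 K H) : IsHilbertSchmidt (op x) := x.2.2

noncomputable instance : AddCommGroup (U2 K H) := inferInstanceAs (AddCommGroup (u2 K H))

noncomputable instance : Module ℝ (U2 K H) := inferInstanceAs (Module ℝ (u2 K H))

theorem op_add (x y : U2 K H) : op (x + y) = op x + op y := rfl

theorem op_smul (r : ℝ) (x : U2 K H) : op (r • x) = r • op x := rfl

theorem op_sub (x y : U2 K H) : op (x - y) = op x - op y := rfl

theorem op_zero : op (0 : U2 K H) = 0 := rfl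

theorem commutator_mem (x y : U2 K H) : op x * op y - op y * op x ∈ u2 K H := by
  obtain ⟨x, ⟨h1, h2⟩, h3⟩ := x
  obtain ⟨y, ⟨h4, h5⟩, h6⟩ := y
  change x * y - y * x ∈ u2 K H
  refine ⟨⟨fun c v => ?_, fun v w => ?_⟩, ?_⟩
  · simp [h1, h4, smul_sub]
  · simp only [_root_.sub_apply, mul_apply_eq_comp,
      inner_sub_left, inner_sub_right]
    rw [h2, h5, h5, h2]
    ring
  · exact hs_of_memLp ((hs_memLp (h6.comp_left x)).sub (hs_memLp (h3.comp_left y)))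

/-- The commutator bracket. -/
noncomputable instance : Bracket (U2 K H) (U2 K H) where
  bracket x y := ⟨op x * op y - op y * op x, commutator_mem x y⟩

theorem op_lie (x y : U2 K H) : op ⁅x, y⁆ = op x * op y - op y * op x := rfl

/-- The embedding of `u₂(H)` into `ℓ²`-families of vectors given by an orthonormal basis. -/
noncomputable def toLp : U2 K H →ₗ[ℝ] lp (fun _ : basisIndex H => H) 2 where
  toFun x := ⟨fun i => op x (hBasis H i), hs_memLp (op_hs x)⟩
  map_add' _ _ := rfl
  map_smul' _ _ := rfl

theorem toLp_apply (x : U2 K H) (i : basisIndex H) : toLp x i = op x (hBasis H i) := rfl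

theorem norm_toLp_sq (x : U2 K H) : ‖toLp x‖ ^ 2 = ∑' i, ‖op x (hBasis H i)‖ ^ 2 := by
  rw [← real_inner_self_eq_norm_sq, lp.inner_eq_tsum]
  exact tsum_congr fun i => real_inner_self_eq_norm_sq _

theorem norm_op_le (x : U2 K H) : ‖op x‖ ≤ ‖toLp x‖ := by
  refine ContinuousLinearMap.opNorm_le_bound _ (norm_nonneg _) fun v => ?_
  have e := skew_norm_sq_le (op_skew x).2 (op_hs x) v
  rw [← norm_toLp_sq, ← mul_pow] at e
  exact (sq_le_sq₀ (norm_nonneg _) (by positivity)).1 e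

theorem toLp_injective : Function.Injective (toLp : U2 K H →ₗ[ℝ] _) := by
  rw [injective_iff_map_eq_zero]
  intro x hx
  have e := norm_op_le x
  rw [hx, norm_zero] at e
  exact op_injective (norm_le_zero_iff.1 e)

/-- The scalar product `⟨x, y⟩ = tr_ℝ(x y^*)`. -/
noncomputable abbrev core : InnerProductSpace.Core ℝ (U2 K H) where
  inner x y := trPair (op x) (op y)
  conj_inner_symm x y := by
    change trPair _ _ = trPair _ _
    simp only [trPair, real_inner_comm]
  re_inner_nonneg x := by
    change 0 ≤ trPair _ _
    exact tsum_nonneg fun i => real_inner_self_nonneg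
  add_left x y z := by
    have e := inner_add_left (𝕜 := ℝ) (toLp x) (toLp y) (toLp z)
    rw [← map_add] at e
    simp only [lp.inner_eq_tsum] at e
    exact e
  smul_left x y r := by
    have e := inner_smul_left (𝕜 := ℝ) (toLp x) (toLp y) r
    rw [← map_smul] at e
    simp only [lp.inner_eq_tsum] at e
    exact e
  definite x hx := by
    apply toLp_injective
    rw [map_zero, ← inner_self_eq_zero (𝕜 := ℝ), lp.inner_eq_tsum]
    exact hx

theorem op_lie_apply (x y : U2 K H) (v : H) : op ⁅x, y⁆ v = op x (op y v) - op y (op x v) := rfl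

theorem op_ext {x y : U2 K H} (h : ∀ v, op x v = op y v) : x = y :=
  op_injective (ContinuousLinearMap.ext h)

theorem trPair_lie (x y z : U2 K H) :
    trPair (op ⁅x, y⁆) (op z) = trPair (op x) (op ⁅y, z⁆) := by
  have hx := op_skew x
  have hy := op_skew y
  have hz := op_skew z
  have key : trPair (op x * op y) (op z) = trPair (-op x) (op z * op y) := by
    have e1 : trPair (op y) (op x * op z) = trPair (-op y) (op z * op x) := by
      refine trPair_adjoint (fun v w => by simp [hy.2]) (fun v w => ?_) (op_hs y) (op_hs (-y))
        ((op_hs z).comp_left _) ((op_hs x).comp_left _)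
      simp only [mul_apply_eq_comp]
      rw [hx.2, hz.2, neg_neg]
    have e2 : trPair (op x * op y) (op z) = trPair (-op y) (op x * op z) := by
      refine tsum_congr fun i => ?_
      simp only [mul_apply_eq_comp, _root_.neg_apply, inner_neg_left]
      exact hx.2 _ _
    have e3 : trPair (-op x) (op z * op y) = trPair (op y) (op z * op x) := by
      refine tsum_congr fun i => ?_
      simp only [mul_apply_eq_comp, _root_.neg_apply, inner_neg_left]
      rw [real_inner_comm, hz.2, neg_neg]
    have e4 : ∀ a b : H →L[ℝ] H, trPair (-a) b = -trPair a b := by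
      intro a b
      simp only [trPair, _root_.neg_apply, inner_neg_left, tsum_neg]
    rw [e2, e3, e4, e1, e4, neg_neg]
  have l : trPair (op ⁅x, y⁆) (op z) = trPair (op x * op y) (op z) - trPair (op y * op x) (op z) := by
    unfold trPair
    rw [← (summable_trPair ((op_hs y).comp_left (op x)) (op_hs z)).tsum_sub
      (summable_trPair ((op_hs x).comp_left (op y)) (op_hs z))]
    refine tsum_congr fun i => ?_
    rw [← inner_sub_left]
    rfl
  have r : trPair (op x) (op ⁅y, z⁆) = trPair (op x) (op y * op z) - trPair (op x) (op z * op y) := by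
    unfold trPair
    rw [← (summable_trPair (op_hs x) ((op_hs z).comp_left (op y))).tsum_sub
      (summable_trPair (op_hs x) ((op_hs y).comp_left (op z)))]
    refine tsum_congr fun i => ?_
    rw [← inner_sub_right]
    rfl
  have m : trPair (op y * op x) (op z) = -trPair (op x) (op y * op z) := by
    unfold trPair
    rw [← tsum_neg]
    exact tsum_congr fun i => hy.2 _ _
  have n : trPair (-op x) (op z * op y) = -trPair (op x) (op z * op y) := by
    simp only [trPair, _root_.neg_apply, inner_neg_left, tsum_neg]
  rw [l, r, m, key, n]
  ring

theorem norm_comp_le (x y : U2 K H) (f : lp (fun _ : basisIndex H => H) 2)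
    (hf : ∀ i, f i = op x (op y (hBasis H i))) : ‖f‖ ≤ ‖toLp x‖ * ‖toLp y‖ := by
  have e1 : ‖f‖ ^ 2 = ∑' i, ⟪f i, f i⟫_ℝ := by
    rw [← real_inner_self_eq_norm_sq, lp.inner_eq_tsum]
  have e2 : ∀ i, ⟪f i, f i⟫_ℝ ≤ ‖toLp x‖ ^ 2 * ‖op y (hBasis H i)‖ ^ 2 := by
    intro i
    rw [real_inner_self_eq_norm_sq, hf, ← mul_pow]
    refine pow_le_pow_left₀ (norm_nonneg _) (((op x).le_opNorm _).trans ?_) 2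
    exact mul_le_mul_of_nonneg_right (norm_op_le x) (norm_nonneg _)
  have e3 : ‖f‖ ^ 2 ≤ (‖toLp x‖ * ‖toLp y‖) ^ 2 := by
    rw [e1, mul_pow, norm_toLp_sq y, ← tsum_mul_left]
    exact (lp.summable_inner (𝕜 := ℝ) f f).tsum_le_tsum e2 (Summable.mul_left _ (op_hs y))
  exact (sq_le_sq₀ (norm_nonneg _) (by positivity)).1 e3

theorem norm_toLp_lie_le (x y : U2 K H) : ‖toLp ⁅x, y⁆‖ ≤ 2 * ‖toLp x‖ * ‖toLp y‖ := by
  have e1 := norm_comp_le x y ⟨_, hs_memLp ((op_hs y).comp_left (op x))⟩ (fun i => rfl)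
  have e2 := norm_comp_le y x ⟨_, hs_memLp ((op_hs x).comp_left (op y))⟩ (fun i => rfl)
  have e : toLp ⁅x, y⁆ =
      (⟨_, hs_memLp ((op_hs y).comp_left (op x))⟩ : lp (fun _ : basisIndex H => H) 2)
      - ⟨_, hs_memLp ((op_hs x).comp_left (op y))⟩ := by
    refine lp.ext (funext fun i => ?_)
    rw [lp.coeFn_sub]
    rfl
  rw [e]
  refine (norm_sub_le _ _).trans ((add_le_add e1 e2).trans (le_of_eq ?_))
  ring

theorem exists_limit [StarRing K] [IsHilbertOver K H] (u : ℕ → U2 K H) (hu : CauchySeq fun n => toLp (u n)) :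
    ∃ x : U2 K H, Filter.Tendsto (fun n => toLp (u n)) Filter.atTop (nhds (toLp x)) := by
  obtain ⟨f, hf⟩ := cauchySeq_tendsto_of_complete hu
  have hc : CauchySeq fun n => op (u n) := by
    rw [Metric.cauchySeq_iff'] at hu ⊢
    intro ε hε
    obtain ⟨N, hN⟩ := hu ε hε
    refine ⟨N, fun n hn => lt_of_le_of_lt ?_ (hN n hn)⟩
    rw [dist_eq_norm, dist_eq_norm, ← map_sub, ← op_sub]
    exact norm_op_le _
  obtain ⟨y, hy⟩ := cauchySeq_tendsto_of_complete hc
  have hy' : ∀ v, Filter.Tendsto (fun n => op (u n) v) Filter.atTop (nhds (y v)) := fun v =>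
    ((ContinuousLinearMap.apply ℝ H v).continuous.tendsto y).comp hy
  have hcoord : ∀ i, f i = y (hBasis H i) := by
    intro i
    refine tendsto_nhds_unique ?_ (hy' (hBasis H i))
    exact ((lp.evalCLM ℝ (fun _ : basisIndex H => H) 2 i).continuous.tendsto f).comp hf
  have hK : IsSkew K y := by
    refine ⟨fun c v => ?_, fun v w => ?_⟩
    · refine ext_inner_right ℝ fun w => ?_
      rw [IsHilbertOver.inner_smul]
      have e1 := (hy' (c • v)).inner (𝕜 := ℝ) (tendsto_const_nhds (x := w))
      have e2 := (hy' v).inner (𝕜 := ℝ) (tendsto_const_nhds (x := star c • w))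
      refine tendsto_nhds_unique e1 (e2.congr fun n => ?_)
      rw [(op_skew (u n)).1, IsHilbertOver.inner_smul]
    · have e1 := (hy' v).inner (𝕜 := ℝ) (tendsto_const_nhds (x := w))
      have e2 := ((tendsto_const_nhds (x := v)).inner (𝕜 := ℝ) (hy' w)).neg
      refine tendsto_nhds_unique e1 (e2.congr fun n => ?_)
      exact ((op_skew (u n)).2 v w).symm
  have hhs : IsHilbertSchmidt y := by
    apply hs_of_memLp
    have e : (fun i => y (hBasis H i)) = fun i => f i := funext fun i => (hcoord i).symm
    rw [e]
    exact f.2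
  refine ⟨⟨y, hK, hhs⟩, ?_⟩
  have e : toLp (⟨y, hK, hhs⟩ : U2 K H) = f := by
    ext i
    exact (hcoord i).symm
  rw [e]
  exact hf

theorem norm_eq_toLp (x : U2 K H) : √(trPair (op x) (op x)) = ‖toLp x‖ := by
  have e : trPair (op x) (op x) = ‖toLp x‖ ^ 2 := by
    rw [norm_toLp_sq]
    exact tsum_congr fun i => real_inner_self_eq_norm_sq _
  rw [e, Real.sqrt_sq (norm_nonneg _)]

noncomputable instance : NormedAddCommGroup (U2 K H) := core.toNormedAddCommGroup

noncomputable instance : InnerProductSpace ℝ (U2 K H) := InnerProductSpace.ofCore core.toCore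

theorem inner_def (x y : U2 K H) : ⟪x, y⟫_ℝ = trPair (op x) (op y) := rfl

theorem norm_def (x : U2 K H) : ‖x‖ = ‖toLp x‖ := norm_eq_toLp x

theorem completeSpace [StarRing K] [IsHilbertOver K H] : CompleteSpace (U2 K H) := by
  have iso : Isometry (toLp : U2 K H → _) :=
    AddMonoidHomClass.isometry_of_norm (toLp : U2 K H →ₗ[ℝ] _) fun x => (norm_def x).symm
  refine Metric.complete_of_cauchySeq_tendsto fun u hu => ?_
  obtain ⟨x, hx⟩ := exists_limit u (iso.uniformContinuous.comp_cauchySeq hu)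
  exact ⟨x, iso.isEmbedding.tendsto_nhds_iff.2 hx⟩

/-- `u₂(H)` is a Hilbert--Lie algebra. -/
noncomputable instance [StarRing K] [IsHilbertOver K H] : HilbertLieAlgebra (U2 K H) where
  add_lie x y z := op_ext fun v => by
    simp only [op_lie_apply, op_add, _root_.add_apply, map_add]
    abel
  lie_add x y z := op_ext fun v => by
    simp only [op_lie_apply, op_add, _root_.add_apply, map_add]
    abel
  lie_self x := op_ext fun v => by
    simp [op_lie_apply, op_zero]
  leibniz_lie x y z := op_ext fun v => by
    simp only [op_lie_apply, op_add, _root_.add_apply, map_sub]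
    abel
  lie_smul r x y := op_ext fun v => by
    simp only [op_lie_apply, op_smul, _root_.smul_apply, map_smul, smul_sub]
  complete := completeSpace
  inner_lie := trPair_lie
  norm_lie_le := ⟨2, fun x y => by
    rw [norm_def, norm_def, norm_def]
    exact norm_toLp_lie_le x y⟩

end U2
end Operators

/-! ### Unitary operators and the automorphisms they induce -/

section Unitary

variable (K H : Type*) [Ring K] [Algebra ℝ K] [NormedAddCommGroup H]
  [InnerProductSpace ℝ H] [CompleteSpace H] [Module K H] [IsScalarTower ℝ K H]

/-- The unitary group `U(H)` of the Hilbert space `H` over `K`: the surjective `K`-linear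
isometries. -/
def unitaryGroup : Subgroup (H ≃ₗᵢ[ℝ] H) where
  carrier := {u | ∀ (c : K) (v : H), u (c • v) = c • u v}
  mul_mem' := by
    intro u w hu hw c v
    change u (w (c • v)) = c • u (w v)
    rw [hw c v, hu]
  one_mem' := fun _ _ => rfl
  inv_mem' := by
    intro u hu c v
    change u.symm (c • v) = c • u.symm v
    rw [LinearIsometryEquiv.symm_apply_eq, hu c, LinearIsometryEquiv.apply_symm_apply]

variable {K H}

theorem conj_mem (u : unitaryGroup K H) (x : U2 K H) :
    u.1.toContinuousLinearEquiv.toContinuousLinearMap * U2.op x *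
      u.1.symm.toContinuousLinearEquiv.toContinuousLinearMap ∈ u2 K H := by
  obtain ⟨h1, h2⟩ := U2.op_skew x
  have hs : ∀ (c : K) (v : H), u.1.symm (c • v) = c • u.1.symm v := u⁻¹.2
  refine ⟨⟨fun c v => ?_, fun v w => ?_⟩, ?_⟩
  · change u.1 (U2.op x (u.1.symm (c • v))) = c • u.1 (U2.op x (u.1.symm v))
    rw [hs, h1, u.2]
  · change ⟪u.1 (U2.op x (u.1.symm v)), w⟫_ℝ = -⟪v, u.1 (U2.op x (u.1.symm w))⟫_ℝ
    rw [← u.1.apply_symm_apply w, u.1.inner_map_map, h2, ← u.1.symm.inner_map_map v]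
    simp
  · have e := skew_basis (hBasis H) (HilbertBasis.ofRepr (u.1.trans (hBasis H).repr)) h2
      (U2.op_hs x)
    refine e.congr fun i => ?_
    change _ = ‖u.1 (U2.op x (u.1.symm (hBasis H i)))‖ ^ 2
    rw [LinearIsometryEquiv.norm_map]
    rfl

/-- The map `x ↦ u x u⁻¹` on `u₂(H)`. -/
noncomputable def conjFun (u : unitaryGroup K H) (x : U2 K H) : U2 K H :=
  ⟨_, conj_mem u x⟩

theorem conjFun_apply (u : unitaryGroup K H) (x : U2 K H) (v : H) :
    U2.op (conjFun u x) v = u.1 (U2.op x (u.1.symm v)) := rfl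

/-- The automorphism `π_u : x ↦ u x u⁻¹` of `u₂(H)` given by a unitary operator `u`. -/
noncomputable def conjAut [StarRing K] [IsHilbertOver K H] (u : unitaryGroup K H) :
    U2 K H ≃ₗ⁅ℝ⁆ U2 K H where
  toFun := conjFun u
  invFun := conjFun u⁻¹
  map_add' x y := U2.op_ext fun v => by
    simp only [conjFun_apply, U2.op_add, _root_.add_apply, map_add]
  map_smul' r x := U2.op_ext fun v => by
    simp only [conjFun_apply, U2.op_smul, _root_.smul_apply, map_smul,
      RingHom.id_apply]
  map_lie' := by
    intro x y
    refine U2.op_ext fun v => ?_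
    change U2.op (conjFun u ⁅x, y⁆) v = U2.op ⁅conjFun u x, conjFun u y⁆ v
    simp only [conjFun_apply, U2.op_lie_apply, map_sub, LinearIsometryEquiv.symm_apply_apply]
  left_inv x := U2.op_ext fun v => by
    rw [conjFun_apply, conjFun_apply]
    change u.1.symm (u.1 (U2.op x (u.1.symm (u.1 v)))) = _
    simp only [LinearIsometryEquiv.symm_apply_apply]
  right_inv x := U2.op_ext fun v => by
    rw [conjFun_apply, conjFun_apply]
    change u.1 (u.1.symm (U2.op x (u.1 (u.1.symm v)))) = _
    simp only [LinearIsometryEquiv.apply_symm_apply]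

theorem conjAut_apply [StarRing K] [IsHilbertOver K H] (u : unitaryGroup K H) (x : U2 K H)
    (v : H) : U2.op (conjAut u x) v = u.1 (U2.op x (u.1.symm v)) := rfl

end Unitary

/-! ### Weights with respect to `t₀`, slanting derivations and root data of affinisations -/

section Weights

variable {k : Type*} [HilbertLieAlgebra k] (t₀ : LieSubalgebra ℝ k)

/-- For `α = i a` in `i t₀^*`, the weight space `k_ℂ^α`. -/
noncomputable def weightSpace (a : Module.Dual ℝ t₀) : Submodule ℂ (ℂ ⊗[ℝ] k) :=
  rootSpace (t₀.incl : t₀ →ₗ[ℝ] k) (imag a)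

/-- The set of nonzero `t₀`-weights `α = i a` of `k_ℂ`. -/
def weights : Set (Module.Dual ℝ t₀) := {a | a ≠ 0 ∧ weightSpace t₀ a ≠ ⊥}

/-- The set `Δ_n` of nonzero weights `α = i a` of `t₀` on the eigenspace
`{x ∈ k_ℂ | φ⁻¹(x) = e^{2 π i n / N} x}`, where `N` is the order of `φ`. -/
def weightsAt (φ : k ≃ₗ⁅ℝ⁆ k) (n : ℤ) : Set (Module.Dual ℝ t₀) :=
  {a | a ≠ 0 ∧ ∃ x ∈ weightSpace t₀ a, x ≠ 0 ∧
    (φ.symm : k →ₗ[ℝ] k).baseChange ℂ x =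
      Complex.exp (2 * Real.pi * Complex.I * n / autOrder φ) • x}

open Classical in
/-- The element `v` of `t₀` with `⟨v, h⟩ = a(h)` for all `h ∈ t₀`, if there is one.  For `α = i a`
and `μ = i m` in `i t₀^*`, the element `α^♯ ∈ i t₀` with `⟨h, α^♯⟩ = α(h)` is `-i v`, so that
`μ(α^♯) = m(v)`, and `(α, β) = ⟨α^♯, β^♯⟩` is the scalar product of the elements of `t₀` representing
`a` and `b`. -/
noncomputable def sharp (a : Module.Dual ℝ t₀) : t₀ :=
  if h : ∃ v : t₀, ∀ x : t₀, ⟪(v : k), (x : k)⟫_ℝ = a x then h.choose else 0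

/-- `D` acts on each weight space `k_ℂ^α`, `α = i a`, as multiplication by `i ν(α^♯)`; here `ν` stands
for the element `i ν` of `i t₀^*`. -/
def IsSlanting (ν : Module.Dual ℝ t₀) (D : k →L[ℝ] k) : Prop :=
  ∀ (a : Module.Dual ℝ t₀), ∀ x ∈ weightSpace t₀ a,
    (D : k →ₗ[ℝ] k).baseChange ℂ x = (Complex.I * (ν (sharp t₀ a) : ℂ)) • x

open Classical in
/-- The operator on `k` that acts on each weight space `k_ℂ^α` as multiplication by `i ν(α^♯)` (and
`0` if there is no such bounded operator). -/
noncomputable def slantOp (ν : Module.Dual ℝ t₀) : k →L[ℝ] k :=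
  if h : ∃ D, IsSlanting t₀ ν D then h.choose else 0

/-- The constant loop at a fixed point of `φ`. -/
def constLoop {φ : k ≃ₗ⁅ℝ⁆ k} (ht : t₀ ≤ fixedPoints φ) (x : t₀) : Loop φ :=
  ⟨fun _ => (x : k), contDiff_const, fun _ => by
    have e : φ (x : k) = x := ht x.2
    change (x : k) = φ.symm (x : k)
    exact (LieEquiv.symm_apply_apply φ (x : k)).symm.trans (congrArg φ.symm e)⟩

/-- The embedding of `t₀^e = ℝ ⊕ t₀ ⊕ ℝ` into the affinisation. -/
def cartan {φ : k ≃ₗ⁅ℝ⁆ k} {D : k →L[ℝ] k} (h : IsTwistDerivation φ D)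
    (ht : t₀ ≤ fixedPoints φ) : (ℝ × t₀ × ℝ) →ₗ[ℝ] Affinisation h where
  toFun p := Affinisation.mk h p.1 (constLoop t₀ ht p.2.1) p.2.2
  map_add' _ _ := rfl
  map_smul' _ _ := rfl

/-- For `α = i a` and a real number `r`, the functional
`(α, r)(z, h, t) = α(h) + i t (r / N + ν(α^♯))` on `t₀^e`. -/
noncomputable def affineWeight (N : ℕ) (ν : Module.Dual ℝ t₀) (p : Module.Dual ℝ t₀ × ℝ) :
    (ℝ × t₀ × ℝ) →ₗ[ℝ] ℂ :=
  imag (p.1 ∘ₗ LinearMap.fst ℝ t₀ ℝ ∘ₗ LinearMap.snd ℝ ℝ (t₀ × ℝ) +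
    (p.2 / N + ν (sharp t₀ p.1)) • (LinearMap.snd ℝ t₀ ℝ ∘ₗ LinearMap.snd ℝ ℝ (t₀ × ℝ)))

/-- The set of pairs `(α, n)` with `n ∈ ℤ` and `α ∈ Δ_n`, where `α = i a` is represented by `a`. -/
def rootPairs (φ : k ≃ₗ⁅ℝ⁆ k) : Set (Module.Dual ℝ t₀ × ℝ) :=
  {p | ∃ n : ℤ, p.2 = n ∧ p.1 ∈ weightsAt t₀ φ n}

/-- The bilinear form `((α, m), (β, n)) = (α, β)`. -/
noncomputable def rootForm (p q : Module.Dual ℝ t₀ × ℝ) : ℝ :=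
  ⟪(sharp t₀ p.1 : k), (sharp t₀ q.1 : k)⟫_ℝ

/-- The map `(α, n) ↦ (α, N' (n / N - μ(α^♯)))`. -/
noncomputable def untwistRoot (μ : Module.Dual ℝ t₀) (N N' : ℕ) (p : Module.Dual ℝ t₀ × ℝ) :
    Module.Dual ℝ t₀ × ℝ :=
  (p.1, N' * (p.2 / N - μ (sharp t₀ p.1)))

/-- The map `π` is the restriction to `R` of an isomorphism of the root systems `(span_ℚ R, R)` and
`(span_ℚ R', R')`, both endowed with the form `(·, ·)`. -/
def IsRootSystemIso (R R' : Set (Module.Dual ℝ t₀ × ℝ))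
    (π : Module.Dual ℝ t₀ × ℝ → Module.Dual ℝ t₀ × ℝ) : Prop :=
  ∃ f : Submodule.span ℚ R ≃ₗ[ℚ] Submodule.span ℚ R',
    (∀ v : Submodule.span ℚ R, (v : Module.Dual ℝ t₀ × ℝ) ∈ R → (f v : Module.Dual ℝ t₀ × ℝ) = π v) ∧
    (∀ v : Submodule.span ℚ R, (v : Module.Dual ℝ t₀ × ℝ) ∈ R ↔ (f v : Module.Dual ℝ t₀ × ℝ) ∈ R') ∧
    ∀ v w, rootForm t₀ (f v) (f w) = rootForm t₀ v w

end Weights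

/-- `Λ` is the bounded operator `Λ_μ = i μ^♯ ∈ u(H)`, where `μ` stands for the element `i μ` of
`i t₀^*`: it lies in the closure of `t₀` in the strong operator topology and satisfies
`⟨Λ, h⟩ = tr_ℝ(Λ h^*) = μ(h)` for the finite rank operators `h ∈ t₀`.  (These span the dense subspace
of `t₀` on which the pairing with elements of the completion of `t₀` that contains `μ^♯` is defined.) -/
def IsSharpOp {K H : Type*} [Ring K] [Algebra ℝ K] [StarRing K] [NormedAddCommGroup H]
    [InnerProductSpace ℝ H] [CompleteSpace H] [Module K H] [IsScalarTower ℝ K H]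
    [IsHilbertOver K H] (t₀ : LieSubalgebra ℝ (U2 K H)) (μ : Module.Dual ℝ t₀)
    (L : H →L[ℝ] H) : Prop :=
  IsSkew K L ∧
  (∀ (s : Finset H) (ε : ℝ), 0 < ε → ∃ h ∈ t₀, ∀ v ∈ s, ‖L v - U2.op h v‖ < ε) ∧
  ∀ h : t₀, FiniteDimensional ℝ (LinearMap.range (U2.op (h : U2 K H) : H →ₗ[ℝ] H)) →
    trPair L (U2.op (h : U2 K H)) = μ h

end TwistedLoop

open TwistedLoop

/-! Put `W s = φ_{s/2π}`. This curve of isometric automorphisms satisfies `W' = -ad(Λ_μ) W` and `W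
(s + 2π) φ⁻¹ = ψ⁻¹ W s`. Applied pointwise it therefore turns `φ`-twisted loops into `ψ`-twisted
ones and carries `ξ' + D_ν ξ` to `ξ' + (ad Λ_μ + D_ν) ξ`. Everything hinges on the identity `D_{μ+ν}
= ad Λ_μ + D_ν`. Once it is known, the bracket, the derivation and the cocycle all correspond
(`IsUntwisting.affinisationEquiv`), and `t₀^e` is fixed because `W s` fixes `t₀`. An isomorphism
that is the identity on `t₀^e` preserves root spaces functional by functional, so compact roots,
coroots and Weyl groups agree. The map `π` only relabels: `(α, n)` and `π(α, n)` name the same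
functional in the two parametrisations (`affineWeight_untwistRoot`).

Four facts carry the argument.

Density of weight vectors (`hasDenseWeights`). Hilbert-Schmidt skew operators are compact, so the
finite-dimensional invariant `K`-subspaces of `H` span a dense subspace; compressions to them lie in
finite-dimensional `t₀`-invariant subspaces of `k`, where the commuting symmetric operators `ad h ad
h'` are diagonalised together. Bounded operators are then determined on weight vectors, which gives
uniqueness of the slanting operators and reduces their algebraic properties to weight vectors.
Existence is a bounded diagonal operator on a Hilbert sum.

The identity for `Λ_μ` (`isSlanting_adSkew`). A strong limit of elements of `t₀` acts on each weight
space by a scalar. The scalar is read off from the trace pairing of `Λ_μ` with `[x, y] = -‖x‖² α^♯`;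
this element has finite rank because nonzero weight spaces are finite-dimensional
(`IsWeightPair.hasFiniteRank`).

Isometry of finite-order automorphisms (`FiniteOrder.norm_map`). Such an automorphism `Φ` is
continuous by the closed graph theorem, `Φ^* Φ` commutes with the adjoint representation and is
therefore a real scalar `c` (`exists_eq_smul_of_map_lie`), and finite order forces `c = 1`.

Compact roots (`setOf_isCompactRoot`). The root equation is a linear differential equation whose
solutions are `e^{iτt} w` with `w` a weight vector and `φ⁻¹`-eigenvector; periodicity makes `τ` a
multiple of `1/N_φ`. For fixed nonzero weight and fixed eigenvalue such `w` form a line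
(`IsTwistedPair.eq_zero_of_inner_eq_zero`).

Complex vectors are handled as real pairs `(x, y)` standing for `x + i y`, since the Hilbert space
structure lives on the real form. -/

namespace TwistedLoop

set_option linter.unusedSectionVars false

/-! ### Real and imaginary parts in complexifications -/

section Complexification

variable {M N T g : Type*} [AddCommGroup M] [Module ℝ M] [AddCommGroup N] [Module ℝ N]
  [AddCommGroup T] [Module ℝ T] [LieRing g] [LieAlgebra ℝ g]

/-- The element `a + i b` of the complexification. -/
noncomputable def cmk (a b : M) : ℂ ⊗[ℝ] M := (1 : ℂ) ⊗ₜ[ℝ] a + Complex.I ⊗ₜ[ℝ] b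

/-- The real part of an element of the complexification. -/
noncomputable def reC : ℂ ⊗[ℝ] M →ₗ[ℝ] M :=
  (TensorProduct.lid ℝ M).toLinearMap ∘ₗ TensorProduct.map Complex.reLm LinearMap.id

/-- The imaginary part of an element of the complexification. -/
noncomputable def imC : ℂ ⊗[ℝ] M →ₗ[ℝ] M :=
  (TensorProduct.lid ℝ M).toLinearMap ∘ₗ TensorProduct.map Complex.imLm LinearMap.id

theorem reC_cmk (a b : M) : reC (cmk a b) = a := by
  simp [reC, cmk]

theorem imC_cmk (a b : M) : imC (cmk a b) = b := by
  simp [imC, cmk]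

theorem tmul_eq_cmk (z : ℂ) (a : M) : z ⊗ₜ[ℝ] a = cmk (z.re • a) (z.im • a) := by
  conv_lhs => rw [← Complex.re_add_im z]
  rw [TensorProduct.add_tmul, cmk, TensorProduct.tmul_smul, TensorProduct.tmul_smul,
    TensorProduct.smul_tmul', TensorProduct.smul_tmul']
  simp

theorem one_tmul_eq_cmk (a : M) : (1 : ℂ) ⊗ₜ[ℝ] a = cmk a 0 := by
  simp [cmk]

theorem cmk_add (a b c d : M) : cmk a b + cmk c d = cmk (a + c) (b + d) := by
  simp only [cmk, TensorProduct.tmul_add]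
  abel

theorem cmk_zero : cmk (0 : M) 0 = 0 := by simp [cmk]

theorem exists_eq_cmk (x : ℂ ⊗[ℝ] M) : ∃ a b, x = cmk a b := by
  induction x with
  | zero => exact ⟨0, 0, cmk_zero.symm⟩
  | tmul z a => exact ⟨_, _, tmul_eq_cmk z a⟩
  | add x y hx hy =>
    obtain ⟨a, b, rfl⟩ := hx
    obtain ⟨c, d, rfl⟩ := hy
    exact ⟨_, _, cmk_add a b c d⟩

theorem cmk_inj {a b c d : M} : cmk a b = cmk c d ↔ a = c ∧ b = d := by
  refine ⟨fun h => ⟨?_, ?_⟩, fun h => by rw [h.1, h.2]⟩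
  · simpa only [reC_cmk] using congrArg reC h
  · simpa only [imC_cmk] using congrArg imC h

theorem cmk_eq_zero {a b : M} : cmk a b = 0 ↔ a = 0 ∧ b = 0 := by
  rw [← cmk_zero, cmk_inj]

theorem smul_cmk (z : ℂ) (a b : M) :
    z • cmk a b = cmk (z.re • a - z.im • b) (z.re • b + z.im • a) := by
  rw [cmk, smul_add, TensorProduct.smul_tmul', TensorProduct.smul_tmul', tmul_eq_cmk,
    tmul_eq_cmk, cmk_add]
  simp [sub_eq_add_neg, add_comm]

theorem baseChange_cmk (f : M →ₗ[ℝ] N) (a b : M) :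
    f.baseChange ℂ (cmk a b) = cmk (f a) (f b) := by
  simp [cmk]

theorem lie_cmk (a b c d : g) :
    ⁅cmk a b, cmk c d⁆ = cmk (⁅a, c⁆ - ⁅b, d⁆) (⁅a, d⁆ + ⁅b, c⁆) := by
  have e : ∀ (x y z : ℂ ⊗[ℝ] g), ⁅x + y, z⁆ = ⁅x, z⁆ + ⁅y, z⁆ := fun x y z => add_lie x y z
  have e' : ∀ (x y z : ℂ ⊗[ℝ] g), ⁅x, y + z⁆ = ⁅x, y⁆ + ⁅x, z⁆ := fun x y z => lie_add x y z
  have e'' : ∀ (s t : ℂ) (x y : g), ⁅s ⊗ₜ[ℝ] x, t ⊗ₜ[ℝ] y⁆ = (s * t) ⊗ₜ[ℝ] ⁅x, y⁆ :=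
    fun _ _ _ _ => rfl
  simp only [cmk, e, e', e'', one_mul, mul_one, Complex.I_mul_I, TensorProduct.neg_tmul,
    TensorProduct.tmul_sub, TensorProduct.tmul_add]
  abel

theorem starC_cmk (a b : g) : starC (cmk a b) = cmk (-a) b := by
  rw [starC, LinearMap.neg_apply, cmk, map_add, TensorProduct.map_tmul, TensorProduct.map_tmul]
  simp [cmk, TensorProduct.tmul_neg, TensorProduct.neg_tmul]
  abel

theorem extendC_cmk (α : T →ₗ[ℝ] ℂ) (a b : T) :
    extendC α (cmk a b) = α a + Complex.I * α b := by
  simp [extendC, cmk]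

theorem imag_apply (a : Module.Dual ℝ T) (h : T) : imag a h = Complex.I * (a h : ℂ) := rfl

/-- Membership of `a + i b` in a root space, in terms of real and imaginary parts. -/
theorem cmk_mem_rootSpace (j : T →ₗ[ℝ] g) (α : T →ₗ[ℝ] ℂ) (x y : g) :
    cmk x y ∈ rootSpace j α ↔ ∀ h : T, ⁅j h, x⁆ = (α h).re • x - (α h).im • y ∧
      ⁅j h, y⁆ = (α h).re • y + (α h).im • x := by
  refine forall_congr' fun h => ?_
  rw [one_tmul_eq_cmk, lie_cmk, smul_cmk, cmk_inj]
  simp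

theorem cmk_mem_rootSpace_imag (j : T →ₗ[ℝ] g) (a : Module.Dual ℝ T) (x y : g) :
    cmk x y ∈ rootSpace j (imag a) ↔ ∀ h : T, ⁅j h, x⁆ = -(a h • y) ∧ ⁅j h, y⁆ = a h • x := by
  rw [cmk_mem_rootSpace]
  simp [imag_apply]

end Complexification

/-! ### Weight pairs in Hilbert--Lie algebras -/

section WeightPairs

variable {k : Type*} [HilbertLieAlgebra k] {t₀ : LieSubalgebra ℝ k}

instance instCompleteSpaceHilbertLie : CompleteSpace k := HilbertLieAlgebra.complete

theorem inner_lie_left (h x y : k) : ⟪⁅h, x⁆, y⟫_ℝ = -⟪x, ⁅h, y⁆⟫_ℝ := by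
  rw [← lie_skew, inner_neg_left, HilbertLieAlgebra.inner_lie]

/-- `x + i y` is an element of the weight space of `α = i a`. -/
def IsWeightPair (t₀ : LieSubalgebra ℝ k) (a : Module.Dual ℝ t₀) (x y : k) : Prop :=
  ∀ h : t₀, ⁅(h : k), x⁆ = -(a h • y) ∧ ⁅(h : k), y⁆ = a h • x

theorem cmk_mem_weightSpace {a : Module.Dual ℝ t₀} {x y : k} :
    cmk x y ∈ weightSpace t₀ a ↔ IsWeightPair t₀ a x y :=
  cmk_mem_rootSpace_imag (t₀.incl : t₀ →ₗ[ℝ] k) a x y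

theorem isSlanting_iff {ν : Module.Dual ℝ t₀} {D : k →L[ℝ] k} :
    IsSlanting t₀ ν D ↔ ∀ a x y, IsWeightPair t₀ a x y →
      D x = -(ν (sharp t₀ a) • y) ∧ D y = ν (sharp t₀ a) • x := by
  constructor
  · intro h a x y hxy
    have e := h a (cmk x y) (cmk_mem_weightSpace.2 hxy)
    rw [baseChange_cmk, smul_cmk, cmk_inj] at e
    simpa using e
  · intro h a z hz
    obtain ⟨x, y, rfl⟩ := exists_eq_cmk z
    have e := h a x y (cmk_mem_weightSpace.1 hz)
    rw [baseChange_cmk, smul_cmk, cmk_inj]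
    simpa using e

/-! ### Algebra and orthogonality of weight vectors. -/

namespace IsWeightPair

variable {a b : Module.Dual ℝ t₀} {x y x' y' : k}

/-- The new pair stands for `-i (x + i y)`. It is used to pass from statements on real parts to
statements on imaginary parts. -/
theorem mul_I (h : IsWeightPair t₀ a x y) : IsWeightPair t₀ a y (-x) := fun z =>
  ⟨by rw [(h z).2, smul_neg, neg_neg], by rw [lie_neg, (h z).1, neg_neg]⟩

theorem conj (h : IsWeightPair t₀ a x y) : IsWeightPair t₀ (-a) x (-y) := fun z =>
  ⟨by rw [(h z).1, LinearMap.neg_apply, neg_smul_neg],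
    by rw [lie_neg, (h z).2, LinearMap.neg_apply, neg_smul]⟩

theorem add (h : IsWeightPair t₀ a x y) (h' : IsWeightPair t₀ a x' y') :
    IsWeightPair t₀ a (x + x') (y + y') := fun z =>
  ⟨by rw [lie_add, (h z).1, (h' z).1, smul_add, neg_add],
    by rw [lie_add, (h z).2, (h' z).2, smul_add]⟩

theorem smul (c : ℝ) (h : IsWeightPair t₀ a x y) : IsWeightPair t₀ a (c • x) (c • y) := fun z =>
  ⟨by rw [lie_smul, (h z).1, smul_neg, smul_comm], by rw [lie_smul, (h z).2, smul_comm]⟩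

theorem lie (h : IsWeightPair t₀ a x y) (h' : IsWeightPair t₀ b x' y') :
    IsWeightPair t₀ (a + b) (⁅x, x'⁆ - ⁅y, y'⁆) (⁅x, y'⁆ + ⁅y, x'⁆) := fun z => by
  constructor
  · rw [lie_sub, leibniz_lie, leibniz_lie _ y, (h z).1, (h z).2, (h' z).1, (h' z).2]
    simp only [neg_lie, lie_neg, smul_lie, lie_smul, LinearMap.add_apply]
    module
  · rw [lie_add, leibniz_lie, leibniz_lie _ y, (h z).1, (h z).2, (h' z).1, (h' z).2]
    simp only [neg_lie, lie_neg, smul_lie, lie_smul, LinearMap.add_apply]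
    module

/-- Since `ad z` is skew-symmetric, vectors of distinct weights are orthogonal for the Hermitian
form. This is the imaginary part of that relation; the real part follows by applying it to `mul_I`.
-/
theorem inner_eq (h : IsWeightPair t₀ a x y) (h' : IsWeightPair t₀ b x' y') (hab : a ≠ b) :
    ⟪x, y'⟫_ℝ = ⟪y, x'⟫_ℝ := by
  obtain ⟨z, hz⟩ : ∃ z, a z ≠ b z := by
    by_contra! hc
    exact hab (LinearMap.ext hc)
  have e1 := inner_lie_left (z : k) x x'
  have e2 := inner_lie_left (z : k) y y'
  rw [(h z).1, (h' z).1] at e1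
  rw [(h z).2, (h' z).2] at e2
  simp only [inner_neg_left, inner_neg_right, real_inner_smul_left, real_inner_smul_right] at e1 e2
  have e3 : (a z - b z) * (⟪x, y'⟫_ℝ - ⟪y, x'⟫_ℝ) = 0 := by linarith
  rcases mul_eq_zero.1 e3 with e | e
  · exact absurd (sub_eq_zero.1 e) hz
  · exact sub_eq_zero.1 e

theorem map (h : IsWeightPair t₀ a x y) (θ : k ≃ₗ⁅ℝ⁆ k) (hθ : ∀ z : t₀, θ z = z) :
    IsWeightPair t₀ a (θ x) (θ y) := fun z => by
  constructor
  · conv_lhs => rw [← hθ z, ← LieEquiv.map_lie, (h z).1]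
    simp
  · conv_lhs => rw [← hθ z, ← LieEquiv.map_lie, (h z).2]
    simp

end IsWeightPair

variable (t₀) in
/-- The weight spaces of `t₀` span a dense subspace. -/
def HasDenseWeights : Prop :=
  ∀ z : k, (∀ a x y, IsWeightPair t₀ a x y → ⟪z, x⟫_ℝ = 0) → z = 0

/-- The adjoint of `f - g` takes values orthogonal to all real parts of weight vectors, hence
vanishes. Real parts suffice, as the imaginary part is the real part of `mul_I`. -/
theorem HasDenseWeights.clm_ext (hd : HasDenseWeights t₀) {f g : k →L[ℝ] k}
    (h : ∀ a x y, IsWeightPair t₀ a x y → f x = g x) : f = g := by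
  have e : ∀ z, (ContinuousLinearMap.adjoint (f - g)) z = 0 := by
    intro z
    refine hd _ fun a x y hxy => ?_
    rw [ContinuousLinearMap.adjoint_inner_left, _root_.sub_apply, h a x y hxy,
      sub_self, inner_zero_right]
  refine ContinuousLinearMap.ext fun w => ext_inner_left ℝ fun z => ?_
  have e' := ContinuousLinearMap.adjoint_inner_left (f - g) w z
  rw [e, inner_zero_left, _root_.sub_apply, inner_sub_right] at e'
  linarith

/-! ### Representing vectors of functionals -/

variable (t₀) in
/-- The functional `a` is represented by an element of `t₀`. -/
def IsRepresentable (a : Module.Dual ℝ t₀) : Prop :=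
  ∃ v : t₀, ∀ x : t₀, ⟪(v : k), (x : k)⟫_ℝ = a x

theorem sharp_inner {a : Module.Dual ℝ t₀} (h : IsRepresentable t₀ a) (x : t₀) :
    ⟪(sharp t₀ a : k), (x : k)⟫_ℝ = a x := by
  have h' : ∃ v : t₀, ∀ x : t₀, ⟪(v : k), (x : k)⟫_ℝ = a x := h
  rw [sharp, dif_pos h']
  exact h'.choose_spec x

theorem sharp_eq {a : Module.Dual ℝ t₀} {v : t₀} (h : ∀ x : t₀, ⟪(v : k), (x : k)⟫_ℝ = a x) :
    sharp t₀ a = v := by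
  have e := sharp_inner ⟨v, h⟩ (sharp t₀ a - v)
  rw [← h, ← sub_eq_zero, ← inner_sub_left] at e
  have e' : ((sharp t₀ a : k) - (v : k)) = 0 := inner_self_eq_zero.1 e
  exact Subtype.ext (sub_eq_zero.1 e')

theorem IsRepresentable.add {a b : Module.Dual ℝ t₀} (h : IsRepresentable t₀ a)
    (h' : IsRepresentable t₀ b) : IsRepresentable t₀ (a + b) := by
  refine ⟨sharp t₀ a + sharp t₀ b, fun x => ?_⟩
  rw [LinearMap.add_apply, ← sharp_inner h, ← sharp_inner h', ← inner_add_left]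
  rfl

theorem IsRepresentable.smul {a : Module.Dual ℝ t₀} (c : ℝ) (h : IsRepresentable t₀ a) :
    IsRepresentable t₀ (c • a) := by
  refine ⟨c • sharp t₀ a, fun x => ?_⟩
  rw [LinearMap.smul_apply, ← sharp_inner h, smul_eq_mul, ← real_inner_smul_left]
  rfl

theorem isRepresentable_zero : IsRepresentable t₀ 0 := ⟨0, fun x => by simp⟩

theorem sharp_zero : sharp t₀ 0 = 0 := sharp_eq fun x => by simp

theorem sharp_add {a b : Module.Dual ℝ t₀} (h : IsRepresentable t₀ a)
    (h' : IsRepresentable t₀ b) : sharp t₀ (a + b) = sharp t₀ a + sharp t₀ b := by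
  refine sharp_eq fun x => ?_
  rw [LinearMap.add_apply, ← sharp_inner h, ← sharp_inner h', ← inner_add_left]
  rfl

theorem sharp_smul {a : Module.Dual ℝ t₀} (c : ℝ) (h : IsRepresentable t₀ a) :
    sharp t₀ (c • a) = c • sharp t₀ a := by
  refine sharp_eq fun x => ?_
  rw [LinearMap.smul_apply, ← sharp_inner h, smul_eq_mul, ← real_inner_smul_left]
  rfl

theorem IsRepresentable.neg {a : Module.Dual ℝ t₀} (h : IsRepresentable t₀ a) :
    IsRepresentable t₀ (-a) := by
  rw [← neg_one_smul ℝ]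
  exact h.smul (-1)

theorem sharp_neg {a : Module.Dual ℝ t₀} (h : IsRepresentable t₀ a) :
    sharp t₀ (-a) = -sharp t₀ a := by
  rw [← neg_one_smul ℝ, sharp_smul (-1) h, neg_one_smul]

/-- On the nonzero vector `(x, y)` of `k ⊕ k` the operator `ad z` has exact gain `|a z|`, so
continuity of the bracket bounds `a`; the squares of both components are added because one of them
may vanish. Closedness makes `t₀` a Hilbert space, and the Riesz theorem applies. -/
theorem IsWeightPair.isRepresentable (hc : IsClosed (t₀ : Set k)) {a : Module.Dual ℝ t₀} {x y : k}
    (h : IsWeightPair t₀ a x y) (hne : x ≠ 0 ∨ y ≠ 0) : IsRepresentable t₀ a := by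
  obtain ⟨C, hC⟩ := HilbertLieAlgebra.norm_lie_le (k := k)
  have hpos : 0 < ‖x‖ ^ 2 + ‖y‖ ^ 2 := by
    rcases hne with hne | hne
    · have := norm_pos_iff.2 hne
      positivity
    · have := norm_pos_iff.2 hne
      positivity
  have hb : ∀ z : t₀, ‖a z‖ ≤ |C| * ‖(z : k)‖ := by
    intro z
    have e1 := hC z x
    have e2 := hC z y
    rw [(h z).1, norm_neg, norm_smul] at e1
    rw [(h z).2, norm_smul] at e2
    have hCz : C * ‖(z : k)‖ ≤ |C| * ‖(z : k)‖ :=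
      mul_le_mul_of_nonneg_right (le_abs_self C) (norm_nonneg _)
    have e1' : ‖a z‖ * ‖y‖ ≤ |C| * ‖(z : k)‖ * ‖x‖ :=
      e1.trans (mul_le_mul_of_nonneg_right hCz (norm_nonneg _))
    have e2' : ‖a z‖ * ‖x‖ ≤ |C| * ‖(z : k)‖ * ‖y‖ :=
      e2.trans (mul_le_mul_of_nonneg_right hCz (norm_nonneg _))
    have s1 := pow_le_pow_left₀ (by positivity) e1' 2
    have s2 := pow_le_pow_left₀ (by positivity) e2' 2
    have s3 : ‖a z‖ ^ 2 * (‖x‖ ^ 2 + ‖y‖ ^ 2) ≤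
        (|C| * ‖(z : k)‖) ^ 2 * (‖x‖ ^ 2 + ‖y‖ ^ 2) := by
      simp only [mul_pow] at s1 s2 ⊢
      linarith
    exact (sq_le_sq₀ (norm_nonneg _) (by positivity)).1 (le_of_mul_le_mul_right s3 hpos)
  have hcs : CompleteSpace t₀.toSubmodule := hc.completeSpace_coe
  let f : t₀.toSubmodule →L[ℝ] ℝ := LinearMap.mkContinuous a |C| hb
  refine ⟨(InnerProductSpace.toDual ℝ t₀.toSubmodule).symm f, fun z => ?_⟩
  exact InnerProductSpace.toDual_symm_apply (𝕜 := ℝ) (E := t₀.toSubmodule) (x := z) (y := f)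

/-! ### Diagonal operators -/

variable (t₀) in
/-- The pairs `(x, y)` for which `x + i y` lies in the weight space of `i a`, as a subspace of the
Hilbert space `k ⊕ k`. -/
def weightPairs (a : Module.Dual ℝ t₀) : Submodule ℝ (WithLp 2 (k × k)) where
  carrier := {p | IsWeightPair t₀ a p.fst p.snd}
  add_mem' h h' := h.add h'
  zero_mem' z := by simp
  smul_mem' c _ h := h.smul c

theorem mem_weightPairs {a : Module.Dual ℝ t₀} {p : WithLp 2 (k × k)} :
    p ∈ weightPairs t₀ a ↔ IsWeightPair t₀ a p.fst p.snd := Iff.rfl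

theorem isClosed_weightPairs (a : Module.Dual ℝ t₀) :
    IsClosed (weightPairs t₀ a : Set (WithLp 2 (k × k))) := by
  have e : (weightPairs t₀ a : Set (WithLp 2 (k × k))) =
      ⋂ h : t₀, {p | lieCLM k h p.fst = -(a h • p.snd)} ∩ {p | lieCLM k h p.snd = a h • p.fst} := by
    ext p
    simp only [SetLike.mem_coe, mem_weightPairs, Set.mem_iInter]
    rfl
  rw [e]
  have hf : Continuous fun p : WithLp 2 (k × k) => p.fst := by fun_prop
  have hs : Continuous fun p : WithLp 2 (k × k) => p.snd := by fun_prop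
  refine isClosed_iInter fun h => (isClosed_eq ?_ ?_).inter (isClosed_eq ?_ ?_)
  · exact (lieCLM k h).continuous.comp hf
  · exact (hs.const_smul _).neg
  · exact (lieCLM k h).continuous.comp hs
  · exact hf.const_smul _

theorem orthogonalFamily_weightPairs :
    OrthogonalFamily ℝ (fun a : Module.Dual ℝ t₀ => weightPairs t₀ a)
      fun a => (weightPairs t₀ a).subtypeₗᵢ := by
  intro a b hab p q
  have e := IsWeightPair.inner_eq p.2 (IsWeightPair.mul_I q.2) hab
  change ⟪(p : WithLp 2 (k × k)), (q : WithLp 2 (k × k))⟫_ℝ = 0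
  rw [WithLp.prod_inner_apply]
  rw [inner_neg_right] at e
  change ⟪p.1.fst, q.1.fst⟫_ℝ + ⟪p.1.snd, q.1.snd⟫_ℝ = 0
  linarith

/-- A vector `p` orthogonal to `(x, y)` and to its conjugate `(x, -y)` has first component
orthogonal to `x`. With `mul_I` the same applies to the second component, so density of real parts
gives density of pairs. -/
theorem HasDenseWeights.isHilbertSum (hd : HasDenseWeights t₀) :
    haveI := fun a : Module.Dual ℝ t₀ => (isClosed_weightPairs a).completeSpace_coe
    IsHilbertSum ℝ (fun a : Module.Dual ℝ t₀ => weightPairs t₀ a)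
      fun a => (weightPairs t₀ a).subtypeₗᵢ := by
  have := fun a : Module.Dual ℝ t₀ => (isClosed_weightPairs a).completeSpace_coe
  refine IsHilbertSum.mkInternal (F := weightPairs t₀) orthogonalFamily_weightPairs ?_
  rw [top_le_iff, Submodule.topologicalClosure_eq_top_iff, Submodule.eq_bot_iff]
  intro p hp
  have hp' : ∀ a x y, IsWeightPair t₀ a x y → ⟪x, p.fst⟫_ℝ + ⟪y, p.snd⟫_ℝ = 0 := by
    intro a x y h
    have e := (Submodule.mem_orthogonal _ _).1 hp (WithLp.toLp 2 (x, y))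
      (Submodule.mem_iSup_of_mem a h)
    rwa [WithLp.prod_inner_apply] at e
  have h1 : p.fst = 0 := hd _ fun a x y h => by
    have e1 := hp' a x y h
    have e2 := hp' _ _ _ h.conj
    rw [inner_neg_left] at e2
    rw [real_inner_comm]
    linarith
  have h2 : p.snd = 0 := hd _ fun a x y h => by
    have e1 := hp' _ _ _ h.mul_I
    have e2 := hp' _ _ _ h.mul_I.conj
    rw [neg_neg] at e2
    rw [inner_neg_left] at e1
    rw [real_inner_comm]
    linarith
  exact WithLp.ofLp_injective 2 (Prod.ext h1 h2)

/-- Multiplication by `i` on `k ⊕ k`, restricted to a weight space. -/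
def pairMulI (a : Module.Dual ℝ t₀) : weightPairs t₀ a →ₗᵢ[ℝ] weightPairs t₀ a where
  toFun p := ⟨WithLp.toLp 2 (-p.1.snd, p.1.fst), by
    have e := (IsWeightPair.mul_I p.2).smul (-1)
    simpa [mem_weightPairs] using e⟩
  map_add' p q := Subtype.ext (WithLp.ofLp_injective 2 (Prod.ext (neg_add _ _) rfl))
  map_smul' c p := Subtype.ext (WithLp.ofLp_injective 2 (Prod.ext (smul_neg c _).symm rfl))
  norm_map' p := by
    change ‖WithLp.toLp 2 (-p.1.snd, p.1.fst)‖ = ‖(p : WithLp 2 (k × k))‖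
    rw [WithLp.prod_norm_eq_of_L2, WithLp.prod_norm_eq_of_L2]
    change √(‖-p.1.snd‖ ^ 2 + ‖p.1.fst‖ ^ 2) = √(‖p.1.fst‖ ^ 2 + ‖p.1.snd‖ ^ 2)
    rw [norm_neg, add_comm]

/-- There is a bounded operator that acts on the weight space of `i a` as multiplication by
`i n(a)`. -/
theorem HasDenseWeights.exists_diagonal (hd : HasDenseWeights t₀) (n : Module.Dual ℝ t₀ → ℝ)
    (hneg : ∀ a, n (-a) = -n a) {C : ℝ} (hC : 0 ≤ C)
    (hn : ∀ a x y, IsWeightPair t₀ a x y → (x ≠ 0 ∨ y ≠ 0) → |n a| ≤ C) :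
    ∃ D : k →L[ℝ] k, ‖D‖ ≤ C ∧
      ∀ a x y, IsWeightPair t₀ a x y → D x = -(n a • y) ∧ D y = n a • x := by
  classical
  have := fun a : Module.Dual ℝ t₀ => (isClosed_weightPairs a).completeSpace_coe
  let V := hd.isHilbertSum.linearIsometryEquiv
  let T : ∀ a, weightPairs t₀ a →L[ℝ] weightPairs t₀ a := fun a =>
    n a • (pairMulI a).toContinuousLinearMap
  have hT : ∀ a, ‖T a‖ ≤ C := by
    intro a
    refine ContinuousLinearMap.opNorm_le_bound _ hC fun p => ?_
    by_cases hp : p = 0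
    · simp [hp]
    · have hne : p.1.fst ≠ 0 ∨ p.1.snd ≠ 0 := by
        by_contra! hc
        exact hp (Subtype.ext (WithLp.ofLp_injective 2 (Prod.ext hc.1 hc.2)))
      change ‖n a • pairMulI a p‖ ≤ _
      rw [norm_smul, LinearIsometry.norm_map]
      exact mul_le_mul_of_nonneg_right (hn a _ _ p.2 hne) (norm_nonneg _)
  -- The diagonal operator on `k ⊕ k`, transported from the Hilbert sum of the weight spaces; it
  -- acts on each by `n a` times multiplication by `i`.
  let S : WithLp 2 (k × k) →L[ℝ] WithLp 2 (k × k) :=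
    (V.symm : _ →L[ℝ] WithLp 2 (k × k)) ∘L (lp.mapCLM 2 T hC hT) ∘L (V : WithLp 2 (k × k) →L[ℝ] _)
  have hSn : ∀ p, ‖S p‖ ≤ C * ‖p‖ := by
    intro p
    change ‖V.symm (lp.mapCLM 2 T hC hT (V p))‖ ≤ _
    rw [LinearIsometryEquiv.norm_map, ← V.norm_map p]
    exact ContinuousLinearMap.le_of_opNorm_le _ (lp.norm_mapCLM_le 2 T hC hT) _
  have hS : ∀ a x y, IsWeightPair t₀ a x y →
      S (WithLp.toLp 2 (x, y)) = WithLp.toLp 2 (-(n a • y), n a • x) := by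
    intro a x y h
    let p : weightPairs t₀ a := ⟨WithLp.toLp 2 (x, y), h⟩
    have e1 : V (WithLp.toLp 2 (x, y)) = lp.single 2 a p :=
      (V.symm_apply_eq.1 (hd.isHilbertSum.linearIsometryEquiv_symm_apply_single p)).symm
    have e2 : lp.mapCLM 2 T hC hT (lp.single 2 a p) = lp.single 2 a (T a p) := by
      ext b
      rw [lp.mapCLM_apply_coe]
      by_cases hb : b = a
      · subst hb
        simp
      · simp [lp.single_apply, hb]
    change V.symm (lp.mapCLM 2 T hC hT (V _)) = _
    rw [e1, e2]
    refine (hd.isHilbertSum.linearIsometryEquiv_symm_apply_single (T a p)).trans ?_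
    change n a • WithLp.toLp 2 (-y, x) = _
    refine WithLp.ofLp_injective 2 (Prod.ext ?_ rfl)
    exact smul_neg _ _
  let incl : k →ₗ[ℝ] WithLp 2 (k × k) :=
    { toFun := fun x => WithLp.toLp 2 (x, 0)
      map_add' := fun x y => WithLp.ofLp_injective 2 (Prod.ext rfl (add_zero 0).symm)
      map_smul' := fun c x => WithLp.ofLp_injective 2 (Prod.ext rfl (smul_zero c).symm) }
  have hincl : ∀ x, ‖incl x‖ = ‖x‖ := fun x => by
    change ‖WithLp.toLp 2 (x, (0 : k))‖ = _
    rw [WithLp.prod_norm_eq_of_L2]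
    simp
  have hfst : ∀ p : WithLp 2 (k × k), ‖p.fst‖ ≤ ‖p‖ := fun p => by
    rw [WithLp.prod_norm_eq_of_L2]
    exact Real.le_sqrt_of_sq_le (by nlinarith [sq_nonneg ‖p.snd‖])
  -- The real operator is recovered as the first component of `S (x, 0)`. This is legitimate because
  -- `n (-a) = -n a` makes `S` commute with conjugation.
  let D₀ : k →ₗ[ℝ] k :=
    { toFun := fun x => (S (incl x)).fst
      map_add' := fun x y => by rw [map_add, map_add]; rfl
      map_smul' := fun c x => by rw [map_smul, map_smul]; rfl }
  let D : k →L[ℝ] k := D₀.mkContinuous C fun x => by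
    refine (hfst _).trans ((hSn _).trans ?_)
    rw [hincl]
  have key : ∀ a x y, IsWeightPair t₀ a x y → D x = -(n a • y) := by
    intro a x y h
    have e1 := hS a x y h
    have e2 := hS _ _ _ h.conj
    -- A real vector is the mean of a weight vector for `a` and its conjugate, which has weight
    -- `-a`.
    have e3 : (2 : ℝ) • incl x = WithLp.toLp 2 (x, y) + WithLp.toLp 2 (x, -y) := by
      refine WithLp.ofLp_injective 2 (Prod.ext (two_smul ℝ x) ?_)
      change (2 : ℝ) • (0 : k) = y + -y
      simp
    have e4 : (2 : ℝ) • D x = (2 : ℝ) • -(n a • y) := by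
      rw [← map_smul]
      change (S (incl ((2 : ℝ) • x))).fst = _
      rw [map_smul, e3, map_add, e1, e2, hneg]
      change -(n a • y) + -(-n a • -y) = _
      rw [neg_smul_neg, two_smul]
    exact smul_right_injective k (two_ne_zero (α := ℝ)) e4
  refine ⟨D, LinearMap.mkContinuous_norm_le _ hC _, fun a x y h => ⟨key a x y h, ?_⟩⟩
  rw [key a _ _ h.mul_I, smul_neg, neg_neg]

/-! ### Slanting operators -/

/-- The default value `0` for functionals without representing vector is compatible with the sign,
so no representability assumption is needed here, in contrast to sums. -/
theorem sharp_neg' (a : Module.Dual ℝ t₀) : sharp t₀ (-a) = -sharp t₀ a := by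
  by_cases h : IsRepresentable t₀ a
  · exact sharp_neg h
  · have h' : ¬ IsRepresentable t₀ (-a) := fun h' => h (by simpa using h'.neg)
    unfold IsRepresentable at h h'
    rw [sharp, sharp, dif_neg h', dif_neg h, neg_zero]

theorem IsSlanting.unique (hd : HasDenseWeights t₀) {ν : Module.Dual ℝ t₀} {D D' : k →L[ℝ] k}
    (h : IsSlanting t₀ ν D) (h' : IsSlanting t₀ ν D') : D = D' :=
  hd.clm_ext fun a x y hxy => by
    rw [(isSlanting_iff.1 h a x y hxy).1, (isSlanting_iff.1 h' a x y hxy).1]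

theorem exists_isSlanting (hd : HasDenseWeights t₀) {ν : Module.Dual ℝ t₀}
    (hν : ∃ C : ℝ, ∀ a ∈ weights t₀, |ν (sharp t₀ a)| ≤ C) : ∃ D, IsSlanting t₀ ν D := by
  obtain ⟨C, hC⟩ := hν
  obtain ⟨D, -, hD⟩ := hd.exists_diagonal (fun a => ν (sharp t₀ a))
    (fun a => by rw [sharp_neg', map_neg]) (abs_nonneg C) (fun a x y h hne => by
      -- The weight `0` is not covered by the bound over `weights t₀`, but its scalar is `0`.
      by_cases ha : a = 0
      · rw [ha, sharp_zero, map_zero, abs_zero]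
        exact abs_nonneg C
      · refine (hC a ⟨ha, fun hb => ?_⟩).trans (le_abs_self C)
        have := cmk_mem_weightSpace.2 h
        rw [hb, Submodule.mem_bot, cmk_eq_zero] at this
        exact hne.elim (fun h => h this.1) (fun h => h this.2))
  exact ⟨D, isSlanting_iff.2 hD⟩

/-- The complexified operator is diagonal with imaginary eigenvalues on mutually orthogonal spaces.
For real parts one has to separate the weights `a = b`, `a = -b` and all others, because `x`
involves both `a` and `-a`. -/
theorem IsSlanting.skew (hd : HasDenseWeights t₀) {ν : Module.Dual ℝ t₀} {D : k →L[ℝ] k}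
    (h : IsSlanting t₀ ν D) (x y : k) : ⟪D x, y⟫_ℝ = -⟪x, D y⟫_ℝ := by
  rw [isSlanting_iff] at h
  have key : ∀ a x y b x' y', IsWeightPair t₀ a x y → IsWeightPair t₀ b x' y' →
      ⟪D x, x'⟫_ℝ = -⟪x, D x'⟫_ℝ := by
    intro a x y b x' y' h1 h2
    rw [(h a x y h1).1, (h b x' y' h2).1, inner_neg_left, inner_neg_right, neg_neg,
      real_inner_smul_left, real_inner_smul_right]
    by_cases hab : a = b
    · subst hab
      -- Only the zero weight is its own negative, and there the eigenvalue is `0`.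
      by_cases ha : a = -a
      · have : a = 0 := LinearMap.ext fun z => self_eq_neg.1 (LinearMap.congr_fun ha z)
        rw [this, sharp_zero, map_zero]
        simp
      · have e := h1.inner_eq h2.conj ha
        rw [inner_neg_right] at e
        rw [← e]
        ring
    · have e1 := h1.inner_eq h2 hab
      by_cases ha : a = -b
      · rw [ha, sharp_neg', map_neg, e1]
        ring
      · have e := h1.inner_eq h2.conj ha
        rw [inner_neg_right] at e
        have e2 : ⟪x, y'⟫_ℝ = 0 := by linarith
        rw [← e1, e2]
        ring
  have e : ContinuousLinearMap.adjoint D = -D := by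
    refine hd.clm_ext fun a x y h1 => ?_
    rw [← sub_eq_zero]
    refine hd _ fun b x' y' h2 => ?_
    rw [inner_sub_left, ContinuousLinearMap.adjoint_inner_left, _root_.neg_apply,
      inner_neg_left, key a x y b x' y' h1 h2]
    ring
  rw [← ContinuousLinearMap.adjoint_inner_right, e, _root_.neg_apply, inner_neg_right]

/-- Weights add under the bracket and `a ↦ ν (sharp a)` is additive on representable functionals, so
eigenvalues add as well. Closedness of `t₀` provides representability; density then extends the rule
in one argument at a time. -/
theorem IsSlanting.leibniz (hd : HasDenseWeights t₀) (hc : IsClosed (t₀ : Set k))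
    {ν : Module.Dual ℝ t₀} {D : k →L[ℝ] k} (h : IsSlanting t₀ ν D) (x y : k) :
    D ⁅x, y⁆ = ⁅D x, y⁆ + ⁅x, D y⁆ := by
  rw [isSlanting_iff] at h
  have key : ∀ a x y b x' y', IsWeightPair t₀ a x y → IsWeightPair t₀ b x' y' →
      D ⁅x, x'⁆ = ⁅D x, x'⁆ + ⁅x, D x'⁆ := by
    intro a x y b x' y' h1 h2
    by_cases h10 : x = 0
    · simp [h10]
    by_cases h20 : x' = 0
    · simp [h20]
    have r1 := h1.isRepresentable hc (Or.inl h10)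
    have r2 := h2.isRepresentable hc (Or.inl h20)
    have e1 := (h _ _ _ (h1.lie h2)).1
    have e2 := (h _ _ _ (h1.lie h2.conj)).1
    rw [sharp_add r1 r2, map_add] at e1
    rw [sharp_add r1 r2.neg, sharp_neg', map_add, map_neg] at e2
    rw [(h _ _ _ h1).1, (h _ _ _ h2).1]
    -- The bracket of two real parts mixes the weights `a + b` and `a - b`; the two summands are its
    -- components.
    have e3 : (2 : ℝ) • ⁅x, x'⁆ = (⁅x, x'⁆ - ⁅y, y'⁆) + (⁅x, x'⁆ - ⁅y, -y'⁆) := by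
      rw [lie_neg, two_smul]
      abel
    refine smul_right_injective k (two_ne_zero (α := ℝ)) ?_
    change (2 : ℝ) • D ⁅x, x'⁆ = (2 : ℝ) • _
    rw [← map_smul, e3, map_add, e1, e2]
    simp only [lie_neg, neg_lie, smul_lie, lie_smul]
    module
  have key2 : ∀ b x' y', IsWeightPair t₀ b x' y' → ∀ x, D ⁅x, x'⁆ = ⁅D x, x'⁆ + ⁅x, D x'⁆ := by
    intro b x' y' h2 x
    have e : D ∘L (lieCLM k).flip x' = (lieCLM k).flip x' ∘L D + (lieCLM k).flip (D x') :=
      hd.clm_ext fun a x y h1 => key a x y b x' y' h1 h2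
    exact congrArg (fun f => f x) e
  have e : D ∘L lieCLM k x = lieCLM k (D x) + lieCLM k x ∘L D :=
    hd.clm_ext fun b x' y' h2 => key2 b x' y' h2 x
  exact congrArg (fun f => f y) e

/-- An automorphism fixing `t₀` pointwise maps every weight space into itself, and there the
slanting operator is a complex scalar. -/
theorem IsSlanting.comm (hd : HasDenseWeights t₀) {ν : Module.Dual ℝ t₀} {D : k →L[ℝ] k}
    (h : IsSlanting t₀ ν D) (θ : k ≃ₗ⁅ℝ⁆ k) (hθ : ∀ z : t₀, θ z = z) (hn : ∀ x, ‖θ x‖ = ‖x‖)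
    (x : k) : D (θ x) = θ (D x) := by
  rw [isSlanting_iff] at h
  let θ' : k →L[ℝ] k := LinearMap.mkContinuous (θ : k →ₗ[ℝ] k) 1 fun x => by
    rw [one_mul]
    exact (hn x).le
  have e : D ∘L θ' = θ' ∘L D := hd.clm_ext fun a x y h1 => by
    change D (θ x) = θ (D x)
    rw [(h _ _ _ (h1.map θ hθ)).1, (h _ _ _ h1).1]
    simp
  exact congrArg (fun f => f x) e

theorem isSlanting_slantOp {ν : Module.Dual ℝ t₀} (h : ∃ D, IsSlanting t₀ ν D) :
    IsSlanting t₀ ν (slantOp t₀ ν) := by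
  rw [slantOp, dif_pos h]
  exact h.choose_spec

theorem isTwistDerivation_slantOp (hd : HasDenseWeights t₀) (hc : IsClosed (t₀ : Set k))
    {ν : Module.Dual ℝ t₀} (h : ∃ D, IsSlanting t₀ ν D) (φ : k ≃ₗ⁅ℝ⁆ k)
    (hφ : ∀ x, ‖φ x‖ = ‖x‖) (ht : ∀ z : t₀, φ z = z) : IsTwistDerivation φ (slantOp t₀ ν) where
  isometry := hφ
  leibniz := (isSlanting_slantOp h).leibniz hd hc
  skew := (isSlanting_slantOp h).skew hd
  comm := (isSlanting_slantOp h).comm hd φ ht hφ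

/-- An element all of whose eigenvalues are bounded by `C` acts by an operator of norm at most
`C`. -/
theorem HasDenseWeights.norm_lie_le (hd : HasDenseWeights t₀) {z : t₀} {C : ℝ} (hC : 0 ≤ C)
    (h : ∀ a x y, IsWeightPair t₀ a x y → (x ≠ 0 ∨ y ≠ 0) → |a z| ≤ C) (w : k) :
    ‖⁅(z : k), w⁆‖ ≤ C * ‖w‖ := by
  obtain ⟨D, hDn, hD⟩ := hd.exists_diagonal (fun a => a z) (fun a => rfl) hC h
  have e : lieCLM k z = D := hd.clm_ext fun a x y h1 => by
    rw [(hD a x y h1).1]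
    exact (h1 z).1
  rw [← lieCLM_apply, e]
  exact D.le_of_opNorm_le hDn w

end WeightPairs

/-! ### Eigenspaces of linear maps of finite order -/

/-- A linear map of finite order on a complex vector space is diagonalizable, also on its invariant
subspaces. -/
theorem le_iSup_inf_eigenspace {V : Type*} [AddCommGroup V] [Module ℂ V] (f : Module.End ℂ V)
    {N : ℕ} (hN : N ≠ 0) (hf : f ^ N = 1) (W : Submodule ℂ V) (hW : ∀ v ∈ W, f v ∈ W) :
    W ≤ ⨆ m : Fin N, W ⊓
      Module.End.eigenspace f (Complex.exp (2 * Real.pi * Complex.I * ((m : ℕ) : ℤ) / N)) := by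
  intro v hv
  have hN' : (N : ℂ) ≠ 0 := Nat.cast_ne_zero.2 hN
  set ζ : ℂ := Complex.exp (2 * Real.pi * Complex.I / N) with hζ
  have hprim : IsPrimitiveRoot ζ N := Complex.isPrimitiveRoot_exp N hN
  have hζ0 : ζ ≠ 0 := Complex.exp_ne_zero _
  have hζm : ∀ m : ℕ, Complex.exp (2 * Real.pi * Complex.I * (m : ℤ) / N) = ζ ^ m := by
    intro m
    rw [hζ, ← Complex.exp_nat_mul]
    congr 1
    push_cast
    ring
  have hWj : ∀ j : ℕ, (f ^ j) v ∈ W := by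
    intro j
    induction j with
    | zero => simpa using hv
    | succ j ih => rw [pow_succ']; exact hW _ ih
  -- Discrete Fourier transform along the orbit of `v`: the average `p m` is the component of `v`
  -- with eigenvalue `ζ ^ m`.
  let c : ℕ → ℕ → V := fun m j => ((ζ⁻¹) ^ (m * j)) • (f ^ j) v
  let p : ℕ → V := fun m => (N : ℂ)⁻¹ • ∑ j ∈ Finset.range N, c m j
  have hcN : ∀ m, c m N = c m 0 := by
    intro m
    simp only [c, hf, mul_zero, pow_zero, one_smul]
    rw [mul_comm, pow_mul, inv_pow, hprim.pow_eq_one, inv_one, one_pow, one_smul]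
  have hshift : ∀ m, ∑ j ∈ Finset.range N, c m (j + 1) = ∑ j ∈ Finset.range N, c m j := by
    intro m
    have e1 := Finset.sum_range_succ (c m) N
    rw [Finset.sum_range_succ', hcN] at e1
    exact add_right_cancel e1
  have hp : ∀ m, p m ∈ W ⊓ Module.End.eigenspace f (ζ ^ m) := by
    intro m
    refine ⟨W.smul_mem _ (W.sum_mem fun j _ => W.smul_mem _ (hWj j)), ?_⟩
    refine Module.End.mem_eigenspace_iff.2 ?_
    change f ((N : ℂ)⁻¹ • ∑ j ∈ Finset.range N, c m j) =
      ζ ^ m • (N : ℂ)⁻¹ • ∑ j ∈ Finset.range N, c m j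
    rw [map_smul, map_sum, smul_comm, ← hshift m, Finset.smul_sum (r := ζ ^ m)]
    refine congrArg _ (Finset.sum_congr rfl fun j _ => ?_)
    simp only [c]
    rw [map_smul, smul_smul, mul_add, pow_add, mul_one, mul_comm ((ζ⁻¹) ^ (m * j)), ← mul_assoc,
      ← mul_pow, mul_inv_cancel₀ hζ0, one_pow, one_mul, pow_succ']
    rfl
  -- Orthogonality of the characters of the cyclic group of order `N`: after exchanging the sums
  -- only `j = 0` survives.
  have hsum : ∑ m ∈ Finset.range N, p m = v := by
    simp only [p, c]
    rw [← Finset.smul_sum, Finset.sum_comm]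
    simp_rw [← Finset.sum_smul]
    rw [Finset.sum_eq_single_of_mem 0 (Finset.mem_range.2 (Nat.pos_of_ne_zero hN))]
    · simp [smul_smul, hN']
    · intro j hj hj0
      have h1 : (ζ⁻¹) ^ j ≠ 1 := by
        rw [inv_pow, Ne, inv_eq_one]
        exact hprim.pow_ne_one_of_pos_of_lt hj0 (Finset.mem_range.1 hj)
      have h2 : ((ζ⁻¹) ^ j) ^ N = 1 := by
        rw [← pow_mul, mul_comm, pow_mul, inv_pow, hprim.pow_eq_one, inv_one, one_pow]
      have h3 : ∑ m ∈ Finset.range N, (ζ⁻¹) ^ (m * j) = 0 := by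
        simp_rw [mul_comm _ j, pow_mul]
        rw [geom_sum_eq h1, h2, sub_self, zero_div]
      rw [h3, zero_smul]
  rw [← hsum]
  refine Submodule.sum_mem _ fun m hm => ?_
  refine Submodule.mem_iSup_of_mem ⟨m, Finset.mem_range.1 hm⟩ ?_
  simpa only [hζm] using hp m

/-! ### Multiplicity one -/

section MultiplicityOne

variable {k : Type*} [HilbertLieAlgebra k] {t₀ : LieSubalgebra ℝ k} {φ : k ≃ₗ⁅ℝ⁆ k}

/-- A maximal abelian subalgebra contains every fixed element commuting with it. -/
theorem IsMaxAbelianIn.mem_of_lie_eq_zero {s : LieSubalgebra ℝ k} (hm : IsMaxAbelianIn t₀ s)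
    {z : k} (hz : z ∈ s) (h : ∀ x ∈ t₀, ⁅x, z⁆ = 0) : z ∈ t₀ := by
  have hab : ∀ x ∈ t₀.toSubmodule ⊔ (ℝ ∙ z), ∀ y ∈ t₀.toSubmodule ⊔ (ℝ ∙ z), ⁅x, y⁆ = 0 := by
    intro x hx y hy
    obtain ⟨x₁, hx₁, x₂, hx₂, rfl⟩ := Submodule.mem_sup.1 hx
    obtain ⟨y₁, hy₁, y₂, hy₂, rfl⟩ := Submodule.mem_sup.1 hy
    obtain ⟨c, rfl⟩ := Submodule.mem_span_singleton.1 hx₂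
    obtain ⟨d, rfl⟩ := Submodule.mem_span_singleton.1 hy₂
    have e1 : ⁅x₁, y₁⁆ = 0 := hm.1.2 x₁ hx₁ y₁ hy₁
    have e2 : ⁅x₁, z⁆ = 0 := h x₁ hx₁
    have e3 : ⁅z, y₁⁆ = 0 := by rw [← lie_skew, h y₁ hy₁, neg_zero]
    simp [add_lie, lie_add, smul_lie, lie_smul, e1, e2, e3]
  let u : LieSubalgebra ℝ k :=
    { t₀.toSubmodule ⊔ (ℝ ∙ z) with
      lie_mem' := fun {x y} hx hy => by
        change ⁅x, y⁆ ∈ t₀.toSubmodule ⊔ (ℝ ∙ z)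
        rw [hab x hx y hy]
        exact Submodule.zero_mem _ }
  have hu : u ≤ s := by
    intro x hx
    obtain ⟨x₁, hx₁, x₂, hx₂, rfl⟩ := Submodule.mem_sup.1 hx
    obtain ⟨c, rfl⟩ := Submodule.mem_span_singleton.1 hx₂
    exact s.add_mem (hm.1.1 hx₁) (s.smul_mem c hz)
  refine hm.2 (y := u) ⟨hu, hab⟩ (fun x hx => Submodule.mem_sup_left hx) ?_
  exact Submodule.mem_sup_right (Submodule.mem_span_singleton_self z)

/-- By maximality `t₀` equals its centraliser in the fixed point algebra, which is cut out by
continuous equations. -/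
theorem IsMaxAbelianIn.isClosed (hm : IsMaxAbelianIn t₀ (fixedPoints φ))
    (hφ : ∀ x, ‖φ x‖ = ‖x‖) : IsClosed (t₀ : Set k) := by
  have e : (t₀ : Set k) = {z | φ z = z} ∩ ⋂ x : t₀, {z | lieCLM k x z = 0} := by
    ext z
    simp only [SetLike.mem_coe, Set.mem_inter_iff, Set.mem_iInter]
    refine ⟨fun hz => ⟨hm.1.1 hz, fun x => hm.1.2 x x.2 z hz⟩, fun hz => ?_⟩
    exact hm.mem_of_lie_eq_zero hz.1 fun x hx => hz.2 ⟨x, hx⟩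
  have hc : Continuous φ :=
    (LinearIsometry.mk (φ : k →ₗ[ℝ] k) hφ).continuous
  rw [e]
  exact (isClosed_eq hc continuous_id).inter
    (isClosed_iInter fun x => isClosed_eq (lieCLM k x).continuous continuous_const)

/-- `x + i y` is a weight vector of weight `i a` with `φ⁻¹(x + i y) = e^{iθ} (x + i y)`. -/
structure IsTwistedPair (t₀ : LieSubalgebra ℝ k) (φ : k ≃ₗ⁅ℝ⁆ k) (a : Module.Dual ℝ t₀) (θ : ℝ)
    (x y : k) : Prop where
  pair : IsWeightPair t₀ a x y
  re : φ.symm x = Real.cos θ • x - Real.sin θ • y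
  im : φ.symm y = Real.sin θ • x + Real.cos θ • y

theorem cmk_mem_eigenspace {θ : ℝ} {x y : k} :
    (φ.symm : k →ₗ[ℝ] k).baseChange ℂ (cmk x y) = Complex.exp (θ * Complex.I) • cmk x y ↔
      φ.symm x = Real.cos θ • x - Real.sin θ • y ∧ φ.symm y = Real.sin θ • x + Real.cos θ • y := by
  rw [baseChange_cmk, smul_cmk, cmk_inj, Complex.exp_ofReal_mul_I_re, Complex.exp_ofReal_mul_I_im,
    add_comm (Real.cos θ • y)]
  rfl

theorem exp_eq_exp_angle (n : ℤ) (N : ℕ) :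
    Complex.exp (2 * Real.pi * Complex.I * n / N) =
      Complex.exp ((2 * Real.pi * (n / N) : ℝ) * Complex.I) := by
  congr 1
  push_cast
  ring

theorem isTwistedPair_iff {a : Module.Dual ℝ t₀} {θ : ℝ} {x y : k} :
    IsTwistedPair t₀ φ a θ x y ↔ cmk x y ∈ weightSpace t₀ a ∧
      (φ.symm : k →ₗ[ℝ] k).baseChange ℂ (cmk x y) = Complex.exp (θ * Complex.I) • cmk x y := by
  rw [cmk_mem_eigenspace, cmk_mem_weightSpace]
  exact ⟨fun h => ⟨h.pair, h.re, h.im⟩, fun h => ⟨h.1, h.2.1, h.2.2⟩⟩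

theorem mem_weightsAt {a : Module.Dual ℝ t₀} {n : ℤ} :
    a ∈ weightsAt t₀ φ n ↔ a ≠ 0 ∧ ∃ x y, (x ≠ 0 ∨ y ≠ 0) ∧
      IsTwistedPair t₀ φ a (2 * Real.pi * (n / autOrder φ)) x y := by
  refine and_congr Iff.rfl ⟨?_, ?_⟩
  · rintro ⟨z, hz, hz0, hφ⟩
    obtain ⟨x, y, rfl⟩ := exists_eq_cmk z
    refine ⟨x, y, ?_, ?_⟩
    · by_contra! hc
      exact hz0 (cmk_eq_zero.2 hc)
    · rw [isTwistedPair_iff]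
      exact ⟨hz, by rw [hφ, exp_eq_exp_angle]⟩
  · rintro ⟨x, y, hne, h⟩
    rw [isTwistedPair_iff] at h
    refine ⟨cmk x y, h.1, fun hc => ?_, by rw [h.2, exp_eq_exp_angle]⟩
    rw [cmk_eq_zero] at hc
    exact hne.elim (fun h => h hc.1) (fun h => h hc.2)

/-! ### Weight vectors of nonzero weight. -/

namespace IsWeightPair

variable {a : Module.Dual ℝ t₀} {x y x' y' : k}

/-- For `a ≠ 0` the weights `a` and `-a` differ, so a weight vector is orthogonal to the conjugate
of another one: the complex bilinear extension of the scalar product vanishes on the weight space.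
-/
theorem inner_eq_neg (h : IsWeightPair t₀ a x y) (h' : IsWeightPair t₀ a x' y') (ha : a ≠ 0) :
    ⟪x, y'⟫_ℝ = -⟪y, x'⟫_ℝ ∧ ⟪x, x'⟫_ℝ = ⟪y, y'⟫_ℝ := by
  have ha' : a ≠ -a := fun e => ha (LinearMap.ext fun z => self_eq_neg.1 (LinearMap.congr_fun e z))
  have e1 := h.inner_eq h'.conj ha'
  have e2 := h.inner_eq h'.mul_I.conj ha'
  rw [inner_neg_right] at e1
  rw [neg_neg] at e2
  exact ⟨by linarith, e2⟩

theorem norm_eq (h : IsWeightPair t₀ a x y) (ha : a ≠ 0) : ‖x‖ = ‖y‖ := by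
  have e := (h.inner_eq_neg h ha).2
  rw [real_inner_self_eq_norm_sq, real_inner_self_eq_norm_sq] at e
  exact (sq_eq_sq₀ (norm_nonneg _) (norm_nonneg _)).1 e

theorem inner_re_im (h : IsWeightPair t₀ a x y) (ha : a ≠ 0) : ⟪x, y⟫_ℝ = 0 := by
  have e := (h.inner_eq_neg h ha).1
  rw [real_inner_comm] at e
  rw [real_inner_comm]
  linarith

/-- Invariance of the scalar product. Once `[x, y]` is known to lie in `t₀`, this identifies it with
`-‖x‖²` times the representing vector of `a`. -/
theorem inner_lie_eq (h : IsWeightPair t₀ a x y) (z : t₀) :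
    ⟪⁅x, y⁆, (z : k)⟫_ℝ = -(a z * ‖x‖ ^ 2) := by
  rw [HilbertLieAlgebra.inner_lie, ← lie_skew, (h z).2, inner_neg_right, real_inner_smul_right,
    real_inner_self_eq_norm_sq]

theorem re_ne_zero (h : IsWeightPair t₀ a x y) (ha : a ≠ 0) (hne : x ≠ 0 ∨ y ≠ 0) : x ≠ 0 := by
  rcases hne with hx | hy
  · exact hx
  · rwa [← norm_ne_zero_iff, h.norm_eq ha, norm_ne_zero_iff]

end IsWeightPair

/-! ### Joint eigenvectors of the subalgebra and the automorphism: brackets and uniqueness up to a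
scalar. -/

namespace IsTwistedPair

variable {a : Module.Dual ℝ t₀} {θ : ℝ} {x y x' y' : k}

theorem add (h : IsTwistedPair t₀ φ a θ x y) (h' : IsTwistedPair t₀ φ a θ x' y') :
    IsTwistedPair t₀ φ a θ (x + x') (y + y') := by
  refine ⟨h.pair.add h'.pair, ?_, ?_⟩
  · rw [map_add, h.re, h'.re]
    module
  · rw [map_add, h.im, h'.im]
    module

theorem smul (c : ℝ) (h : IsTwistedPair t₀ φ a θ x y) :
    IsTwistedPair t₀ φ a θ (c • x) (c • y) := by
  refine ⟨h.pair.smul c, ?_, ?_⟩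
  · rw [map_smul, h.re]
    module
  · rw [map_smul, h.im]
    module

theorem mul_I (h : IsTwistedPair t₀ φ a θ x y) : IsTwistedPair t₀ φ a θ y (-x) := by
  refine ⟨h.pair.mul_I, ?_, ?_⟩
  · rw [h.im]
    module
  · rw [map_neg, h.re]
    module

/-- With `w = x + i y` and `w' = x' + i y'` this element is the real part of `[w̄', w]`. That
bracket has weight `-a + a = 0` and `φ⁻¹`-eigenvalue `e^{-iθ} e^{iθ} = 1`, so maximality places it
in `t₀`. `lie_mem_right` is the imaginary part. -/
theorem lie_mem_left (hm : IsMaxAbelianIn t₀ (fixedPoints φ)) (h : IsTwistedPair t₀ φ a θ x y)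
    (h' : IsTwistedPair t₀ φ a θ x' y') : ⁅x', x⁆ + ⁅y', y⁆ ∈ t₀ := by
  refine hm.mem_of_lie_eq_zero ?_ fun z hz => ?_
  · have e : φ.symm (⁅x', x⁆ + ⁅y', y⁆) = ⁅x', x⁆ + ⁅y', y⁆ := by
      rw [map_add, LieEquiv.map_lie, LieEquiv.map_lie, h.re, h.im, h'.re, h'.im]
      simp only [add_lie, lie_add, sub_lie, lie_sub, smul_lie, lie_smul]
      refine Eq.trans (b := (Real.sin θ ^ 2 + Real.cos θ ^ 2) • (⁅x', x⁆ + ⁅y', y⁆)) ?_ ?_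
      · module
      · rw [Real.sin_sq_add_cos_sq, one_smul]
    have e' := congrArg φ e
    rw [LieEquiv.apply_symm_apply] at e'
    exact e'.symm
  · have h1 := h.pair ⟨z, hz⟩
    have h2 := h'.pair ⟨z, hz⟩
    simp only at h1 h2
    rw [lie_add, leibniz_lie, leibniz_lie _ y', h1.1, h1.2, h2.1, h2.2]
    simp only [neg_lie, lie_neg, smul_lie, lie_smul]
    module

theorem lie_mem_right (hm : IsMaxAbelianIn t₀ (fixedPoints φ)) (h : IsTwistedPair t₀ φ a θ x y)
    (h' : IsTwistedPair t₀ φ a θ x' y') : ⁅x', y⁆ - ⁅y', x⁆ ∈ t₀ := by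
  have e := lie_mem_left hm h.mul_I h'
  rwa [lie_neg, ← sub_eq_add_neg] at e

theorem lie_mem (hm : IsMaxAbelianIn t₀ (fixedPoints φ)) (h : IsTwistedPair t₀ φ a θ x y) :
    ⁅x, y⁆ ∈ t₀ := by
  have e := lie_mem_right hm h h
  rw [← lie_skew y x, sub_neg_eq_add, ← two_smul ℝ] at e
  have e' := t₀.smul_mem (2⁻¹ : ℝ) e
  rw [smul_smul] at e'
  norm_num at e'
  exact e'

/-- Evaluating `inner_lie_eq` at `[x, y]` itself gives `‖[x, y]‖² = -a([x, y]) ‖x‖²`, and `[x, y] =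
0` would force `a = 0`. This sign is behind both multiplicity one and the positivity of compact
roots. -/
theorem weight_lie_neg (hm : IsMaxAbelianIn t₀ (fixedPoints φ)) (h : IsTwistedPair t₀ φ a θ x y)
    (ha : a ≠ 0) (hx : x ≠ 0) : a ⟨⁅x, y⁆, h.lie_mem hm⟩ < 0 := by
  have hx' : 0 < ‖x‖ ^ 2 := pow_pos (norm_pos_iff.2 hx) 2
  have e := h.pair.inner_lie_eq ⟨⁅x, y⁆, h.lie_mem hm⟩
  rw [real_inner_self_eq_norm_sq] at e
  have hw : ⁅x, y⁆ ≠ 0 := by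
    intro h0
    refine ha (LinearMap.ext fun z => ?_)
    have e2 := h.pair.inner_lie_eq z
    rw [h0, inner_zero_left, zero_eq_neg] at e2
    exact (mul_eq_zero.1 e2).resolve_right hx'.ne'
  have hw' : 0 < ‖⁅x, y⁆‖ ^ 2 := pow_pos (norm_pos_iff.2 hw) 2
  by_contra! hc
  have := mul_nonneg hc hx'.le
  linarith

/-- The `φ`-eigenspaces in the weight spaces of nonzero weights are one-dimensional. -/
theorem eq_zero_of_inner_eq_zero (hm : IsMaxAbelianIn t₀ (fixedPoints φ))
    (h : IsTwistedPair t₀ φ a θ x y) (ha : a ≠ 0) (hx : x ≠ 0)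
    (h' : IsTwistedPair t₀ φ a θ x' y') (h1 : ⟪x', x⟫_ℝ = 0) (h2 : ⟪y', x⟫_ℝ = 0) :
    x' = 0 ∧ y' = 0 := by
  have h3 := (h'.pair.inner_eq_neg h.pair ha).1
  have h4 := (h'.pair.inner_eq_neg h.pair ha).2
  rw [h2, neg_zero] at h3
  rw [h1] at h4
  -- `[w̄', w]` has both parts in `t₀`, and its pairing with any `h ∈ t₀` is a multiple of `a h` by
  -- products of components of `w` and `w'`, which vanish by orthogonality. So `z1` and `z2`
  -- together say `[w̄', w] = 0`.
  have z1 : ⁅x', x⁆ + ⁅y', y⁆ = 0 := by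
    have hmem := lie_mem_left hm h h'
    have e := h.pair ⟨_, hmem⟩
    rw [← inner_self_eq_zero (𝕜 := ℝ)]
    nth_rewrite 1 [inner_add_left]
    rw [HilbertLieAlgebra.inner_lie, HilbertLieAlgebra.inner_lie, ← lie_skew x, ← lie_skew y]
    simp only at e
    rw [e.1, e.2]
    simp [inner_smul_right, h2, h3]
  have z2 : ⁅x', y⁆ - ⁅y', x⁆ = 0 := by
    have hmem := lie_mem_right hm h h'
    have e := h.pair ⟨_, hmem⟩
    rw [← inner_self_eq_zero (𝕜 := ℝ)]
    nth_rewrite 1 [inner_sub_left]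
    rw [HilbertLieAlgebra.inner_lie, HilbertLieAlgebra.inner_lie, ← lie_skew x, ← lie_skew y]
    simp only at e
    rw [e.1, e.2]
    simp [inner_smul_right, h1, ← h4]
  have hw := h'.pair ⟨⁅x, y⁆, h.lie_mem hm⟩
  have hneg := h.weight_lie_neg hm ha hx
  set c := a ⟨⁅x, y⁆, h.lie_mem hm⟩
  simp only at hw
  set P := ⁅x, x'⁆ - ⁅y, y'⁆ with hP
  set Q := ⁅x, y'⁆ + ⁅y, x'⁆ with hQ
  have z1' : ⁅y, y'⁆ = -⁅x, x'⁆ := by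
    rw [← lie_skew x' x, ← lie_skew y' y, ← neg_add, neg_eq_zero] at z1
    exact (neg_eq_of_add_eq_zero_right z1).symm
  have z2' : ⁅y, x'⁆ = ⁅x, y'⁆ := by
    rw [← lie_skew x' y, ← lie_skew y' x, ← neg_sub', neg_eq_zero, sub_eq_zero] at z2
    exact z2
  -- Here `P + i Q = [w, w']`. Its squared norm is rewritten by invariance as the pairing of `[[w,
  -- w'], w̄]` with `w'`; by the Jacobi identity and `[w̄', w] = 0` that double bracket is `2 c w'`.
  -- Hence `‖[w, w']‖² = 2 c ‖w'‖²` with `c < 0`, which forces `w' = 0`.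
  have eP : ⟪P, P⟫_ℝ + ⟪Q, Q⟫_ℝ = ⟪⁅P, x⁆ + ⁅Q, y⁆, x'⟫_ℝ + ⟪⁅Q, x⁆ - ⁅P, y⁆, y'⟫_ℝ := by
    have a1 : ⟪P, P⟫_ℝ = ⟪P, ⁅x, x'⁆⟫_ℝ - ⟪P, ⁅y, y'⁆⟫_ℝ := by rw [← inner_sub_right, ← hP]
    have a2 : ⟪Q, Q⟫_ℝ = ⟪Q, ⁅x, y'⁆⟫_ℝ + ⟪Q, ⁅y, x'⁆⟫_ℝ := by rw [← inner_add_right, ← hQ]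
    rw [a1, a2, inner_add_left ⁅P, x⁆, inner_sub_left ⁅Q, x⁆, HilbertLieAlgebra.inner_lie P x x',
      HilbertLieAlgebra.inner_lie Q y x', HilbertLieAlgebra.inner_lie Q x y',
      HilbertLieAlgebra.inner_lie P y y']
    ring
  have e1 : ⁅P, x⁆ + ⁅Q, y⁆ = (2 * c) • x' := by
    have hPe : P = -((2 : ℝ) • ⁅y, y'⁆) := by rw [hP, z1']; module
    have hQe : Q = (2 : ℝ) • ⁅x, y'⁆ := by rw [hQ, z2']; module
    have j := leibniz_lie x y y'
    rw [hPe, hQe, neg_lie, smul_lie, smul_lie, ← lie_skew, ← lie_skew _ y, j, hw.2]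
    module
  have e2 : ⁅Q, x⁆ - ⁅P, y⁆ = (2 * c) • y' := by
    have hPe : P = (2 : ℝ) • ⁅x, x'⁆ := by rw [hP, z1']; module
    have hQe : Q = (2 : ℝ) • ⁅y, x'⁆ := by rw [hQ, z2']; module
    have j := leibniz_lie x y x'
    rw [hPe, hQe, smul_lie, smul_lie, ← lie_skew, ← lie_skew _ y, j, hw.1]
    module
  rw [e1, e2, real_inner_smul_left, real_inner_smul_left] at eP
  have p1 := real_inner_self_nonneg (x := P)
  have p2 := real_inner_self_nonneg (x := Q)
  have p3 := real_inner_self_nonneg (x := x')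
  have p4 := real_inner_self_nonneg (x := y')
  have p5 : c * (⟪x', x'⟫_ℝ + ⟪y', y'⟫_ℝ) ≥ 0 := by linarith
  have p6 : ⟪x', x'⟫_ℝ + ⟪y', y'⟫_ℝ ≤ 0 := by
    by_contra! hc
    have := mul_neg_of_neg_of_pos hneg hc
    linarith
  exact ⟨inner_self_eq_zero.1 (le_antisymm (by linarith) p3),
    inner_self_eq_zero.1 (le_antisymm (by linarith) p4)⟩

/-- Subtract from `w'` its Hermitian projection `(α + i β) w`; the difference is a twisted pair
orthogonal to `w`, hence zero. -/
theorem exists_smul_eq (hm : IsMaxAbelianIn t₀ (fixedPoints φ))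
    (h : IsTwistedPair t₀ φ a θ x y) (ha : a ≠ 0) (hx : x ≠ 0)
    (h' : IsTwistedPair t₀ φ a θ x' y') :
    ∃ α β : ℝ, x' = α • x - β • y ∧ y' = β • x + α • y := by
  have hx' : ‖x‖ ^ 2 ≠ 0 := pow_ne_zero 2 (norm_ne_zero_iff.2 hx)
  set α := ⟪x', x⟫_ℝ / ‖x‖ ^ 2 with hα
  set β := ⟪y', x⟫_ℝ / ‖x‖ ^ 2 with hβ
  have hyx : ⟪y, x⟫_ℝ = 0 := by rw [real_inner_comm]; exact h.pair.inner_re_im ha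
  have hn : ⟪x, x⟫_ℝ = ‖x‖ ^ 2 := real_inner_self_eq_norm_sq x
  have key := eq_zero_of_inner_eq_zero hm h ha hx
    ((h'.add (h.smul (-α))).add (h.mul_I.smul β)) (by
      rw [inner_add_left, inner_add_left, real_inner_smul_left, real_inner_smul_left, hyx, hn, hα]
      field_simp
      ring) (by
      rw [inner_add_left, inner_add_left, real_inner_smul_left, real_inner_smul_left,
        inner_neg_left, hyx, hn, hβ]
      field_simp
      ring)
  refine ⟨α, β, ?_, ?_⟩
  · rw [← sub_eq_zero, ← key.1]
    module
  · rw [← sub_eq_zero, ← key.2]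
    module

end IsTwistedPair

theorem symm_pow_autOrder (φ : k ≃ₗ⁅ℝ⁆ k) :
    ((φ.symm : k →ₗ[ℝ] k).baseChange ℂ) ^ autOrder φ = 1 := by
  rw [← LinearMap.baseChange_pow]
  have e : (φ.toLinearEquiv⁻¹) ^ autOrder φ = 1 := by
    rw [inv_pow, autOrder, pow_orderOf_eq_one, inv_one]
  have e' : ∀ n : ℕ, ((φ.symm : k →ₗ[ℝ] k) ^ n) = ((φ.toLinearEquiv⁻¹ ^ n : k ≃ₗ[ℝ] k) : k →ₗ[ℝ] k) := by
    intro n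
    induction n with
    | zero => rfl
    | succ n ih => rw [pow_succ, ih, pow_succ]; rfl
  rw [e', e]
  exact LinearMap.baseChange_id

theorem autOrder_ne_zero (hφ : FiniteOrder φ) : autOrder φ ≠ 0 := (orderOf_pos_iff.2 hφ).ne'

/-- The angle of a nonzero eigenvector of `φ⁻¹` is an integral multiple of `2π / N`. -/
theorem IsTwistedPair.exists_int (hφ : FiniteOrder φ) {a : Module.Dual ℝ t₀} {θ : ℝ} {x y : k}
    (h : IsTwistedPair t₀ φ a θ x y) (hne : x ≠ 0 ∨ y ≠ 0) :
    ∃ m : ℤ, θ = 2 * Real.pi * (m / autOrder φ) := by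
  have hN : (autOrder φ : ℝ) ≠ 0 := Nat.cast_ne_zero.2 (autOrder_ne_zero hφ)
  have e := (isTwistedPair_iff.1 h).2
  have e' : ∀ n : ℕ, (((φ.symm : k →ₗ[ℝ] k).baseChange ℂ) ^ n) (cmk x y) =
      (Complex.exp (θ * Complex.I)) ^ n • cmk x y := by
    intro n
    induction n with
    | zero => simp
    | succ n ih =>
      rw [pow_succ', Module.End.mul_apply, ih, map_smul, e, smul_smul, pow_succ]
  have e2 := e' (autOrder φ)
  rw [symm_pow_autOrder, Module.End.one_apply, ← Complex.exp_nat_mul] at e2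
  have hne' : cmk x y ≠ 0 := by
    rw [Ne, cmk_eq_zero]
    rintro ⟨h1, h2⟩
    exact hne.elim (fun h => h h1) (fun h => h h2)
  have e3 : Complex.exp (autOrder φ * (θ * Complex.I)) = 1 := by
    have : (Complex.exp (autOrder φ * (θ * Complex.I)) - 1) • cmk x y = 0 := by
      rw [sub_smul, ← e2, one_smul, sub_self]
    exact sub_eq_zero.1 ((smul_eq_zero.1 this).resolve_right hne')
  obtain ⟨m, hm⟩ := Complex.exp_eq_one_iff.1 e3
  refine ⟨m, ?_⟩
  have e4 : ((autOrder φ * θ : ℝ) : ℂ) * Complex.I = ((m * (2 * Real.pi) : ℝ) : ℂ) * Complex.I := by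
    push_cast
    linear_combination hm
  have e5 := Complex.ofReal_injective (mul_right_cancel₀ Complex.I_ne_zero e4)
  field_simp
  linarith

theorem weightSpace_le_iSup (hφ : FiniteOrder φ) (ht : t₀ ≤ fixedPoints φ)
    (a : Module.Dual ℝ t₀) :
    weightSpace t₀ a ≤ ⨆ m : Fin (autOrder φ), weightSpace t₀ a ⊓
      Module.End.eigenspace ((φ.symm : k →ₗ[ℝ] k).baseChange ℂ)
        (Complex.exp (2 * Real.pi * Complex.I * ((m : ℕ) : ℤ) / autOrder φ)) := by
  refine le_iSup_inf_eigenspace _ (autOrder_ne_zero hφ) (symm_pow_autOrder φ) _ fun z hz => ?_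
  obtain ⟨x, y, rfl⟩ := exists_eq_cmk z
  rw [baseChange_cmk]
  refine cmk_mem_weightSpace.2 ((cmk_mem_weightSpace.1 hz).map φ.symm fun z => ?_)
  have e : φ (z : k) = z := ht z.2
  conv_lhs => rw [← e]
  exact LieEquiv.symm_apply_apply φ z

theorem exists_mem_weightsAt (hφ : FiniteOrder φ) (ht : t₀ ≤ fixedPoints φ)
    {a : Module.Dual ℝ t₀} (ha : a ∈ weights t₀) : ∃ n : ℤ, a ∈ weightsAt t₀ φ n := by
  by_contra! hc
  refine ha.2 (eq_bot_iff.2 ((weightSpace_le_iSup hφ ht a).trans (iSup_le fun m => ?_)))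
  rintro z ⟨hz1, hz2⟩
  by_contra hz
  exact hc _ ⟨ha.1, z, hz1, hz, Module.End.mem_eigenspace_iff.1 hz2⟩

/-- Weight spaces of nonzero weights are finite-dimensional. -/
theorem finiteDimensional_weightSpace (hφ : FiniteOrder φ)
    (hm : IsMaxAbelianIn t₀ (fixedPoints φ)) {a : Module.Dual ℝ t₀} (ha : a ≠ 0) :
    FiniteDimensional ℂ (weightSpace t₀ a) := by
  have key : ∀ m : Fin (autOrder φ), FiniteDimensional ℂ (weightSpace t₀ a ⊓
      Module.End.eigenspace ((φ.symm : k →ₗ[ℝ] k).baseChange ℂ)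
        (Complex.exp (2 * Real.pi * Complex.I * ((m : ℕ) : ℤ) / autOrder φ)) :
          Submodule ℂ (ℂ ⊗[ℝ] k)) := by
    intro m
    set E := weightSpace t₀ a ⊓
      Module.End.eigenspace ((φ.symm : k →ₗ[ℝ] k).baseChange ℂ)
        (Complex.exp (2 * Real.pi * Complex.I * ((m : ℕ) : ℤ) / autOrder φ)) with hE
    have hmem : ∀ x y, cmk x y ∈ E ↔ IsTwistedPair t₀ φ a
        (2 * Real.pi * (((m : ℕ) : ℤ) / autOrder φ)) x y := by
      intro x y
      rw [isTwistedPair_iff, hE, Submodule.mem_inf, Module.End.mem_eigenspace_iff, exp_eq_exp_angle]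
    by_cases hb : E = ⊥
    · rw [hb]
      infer_instance
    · obtain ⟨z, hz, hz0⟩ := Submodule.exists_mem_ne_zero_of_ne_bot hb
      obtain ⟨x, y, rfl⟩ := exists_eq_cmk z
      have h := (hmem x y).1 hz
      have hx : x ≠ 0 := h.pair.re_ne_zero ha (by
        by_contra! hc
        exact hz0 (cmk_eq_zero.2 hc))
      have hle : E ≤ Submodule.span ℂ {cmk x y} := by
        intro w hw
        obtain ⟨x', y', rfl⟩ := exists_eq_cmk w
        obtain ⟨α, β, e1, e2⟩ := h.exists_smul_eq hm ha hx ((hmem x' y').1 hw)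
        refine Submodule.mem_span_singleton.2 ⟨⟨α, β⟩, ?_⟩
        rw [smul_cmk, cmk_inj]
        exact ⟨e1.symm, by rw [e2, add_comm]⟩
      exact Submodule.finiteDimensional_of_le hle
  exact Submodule.finiteDimensional_of_le (weightSpace_le_iSup hφ hm.1.1 a)

end MultiplicityOne

/-! ### Root spaces and compact roots of affinisations -/

section AffineRoots

variable {k : Type*} [HilbertLieAlgebra k] {t₀ : LieSubalgebra ℝ k} {φ : k ≃ₗ⁅ℝ⁆ k}
  {D : k →L[ℝ] k}

variable (t₀) in
/-- The functional `(z, h, r) ↦ i (a(h) + c r)` on `ℝ ⊕ t₀ ⊕ ℝ`. -/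
noncomputable def affineFunctional (a : Module.Dual ℝ t₀) (c : ℝ) : (ℝ × t₀ × ℝ) →ₗ[ℝ] ℂ :=
  imag (a ∘ₗ LinearMap.fst ℝ t₀ ℝ ∘ₗ LinearMap.snd ℝ ℝ (t₀ × ℝ) +
    c • (LinearMap.snd ℝ t₀ ℝ ∘ₗ LinearMap.snd ℝ ℝ (t₀ × ℝ)))

theorem affineFunctional_apply (a : Module.Dual ℝ t₀) (c z r : ℝ) (x : t₀) :
    affineFunctional t₀ a c (z, x, r) = Complex.I * ((a x + c * r : ℝ) : ℂ) := rfl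

theorem affineWeight_eq (N : ℕ) (ν : Module.Dual ℝ t₀) (p : Module.Dual ℝ t₀ × ℝ) :
    affineWeight t₀ N ν p = affineFunctional t₀ p.1 (p.2 / N + ν (sharp t₀ p.1)) := rfl

theorem affineFunctional_inj {a b : Module.Dual ℝ t₀} {c d : ℝ} :
    affineFunctional t₀ a c = affineFunctional t₀ b d ↔ a = b ∧ c = d := by
  refine ⟨fun h => ⟨LinearMap.ext fun x => ?_, ?_⟩, fun h => by rw [h.1, h.2]⟩
  · have e := LinearMap.congr_fun h (0, x, 0)
    rw [affineFunctional_apply, affineFunctional_apply] at e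
    simpa using e
  · have e := LinearMap.congr_fun h (0, 0, 1)
    rw [affineFunctional_apply, affineFunctional_apply] at e
    simpa using e

/-- The continuous integrand must vanish on one period. Isometry of `φ` makes `‖ξ‖` periodic,
although `ξ` itself is only twisted periodic. -/
theorem Loop.eq_zero_of_form_self (hφ : ∀ x, ‖φ x‖ = ‖x‖) {ξ : Loop φ}
    (h : Loop.form ξ ξ = 0) : ξ = 0 := by
  have hpi : (0 : ℝ) < 2 * Real.pi := by positivity
  have hcont : Continuous fun t => ⟪ξ.1 t, ξ.1 t⟫_ℝ :=
    (Loop.smooth ξ).continuous.inner (Loop.smooth ξ).continuous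
  have h0 : ∀ t ∈ Set.Icc 0 (2 * Real.pi), ξ.1 t = 0 := by
    by_contra! hc
    obtain ⟨t, ht, hne⟩ := hc
    have := intervalIntegral.integral_pos hpi hcont.continuousOn
      (fun t _ => real_inner_self_nonneg) ⟨t, ht, real_inner_self_pos.2 hne⟩
    rw [Loop.form] at h
    exact this.ne' ((mul_eq_zero.1 h).resolve_left (inv_pos.2 hpi).ne')
  have hper : Function.Periodic (fun t => ‖ξ.1 t‖) (2 * Real.pi) := fun t => by
    change ‖ξ.1 (t + 2 * Real.pi)‖ = ‖ξ.1 t‖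
    rw [ξ.2.2, ← hφ, LieEquiv.apply_symm_apply]
  refine Subtype.ext (funext fun t => ?_)
  obtain ⟨s, hs, e⟩ := hper.exists_mem_Ico₀ hpi t
  simp only [h0 s ⟨hs.1, hs.2.le⟩, norm_zero] at e
  exact norm_eq_zero.1 e

theorem Loop.form_self_nonneg (ξ : Loop φ) : 0 ≤ Loop.form ξ ξ := by
  have hpi : (0 : ℝ) < 2 * Real.pi := by positivity
  exact mul_nonneg (inv_pos.2 hpi).le
    (intervalIntegral.integral_nonneg hpi.le fun t _ => real_inner_self_nonneg)

/-- The real part of the loop `t ↦ e^{iτt} (x + i y)`. -/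
noncomputable def expCurve (τ : ℝ) (x y : k) (t : ℝ) : k :=
  Real.cos (τ * t) • x - Real.sin (τ * t) • y

theorem contDiff_expCurve (τ : ℝ) (x y : k) : ContDiff ℝ ∞ (expCurve τ x y) := by
  unfold expCurve
  have h1 : ContDiff ℝ ∞ fun t : ℝ => Real.cos (τ * t) := by fun_prop
  have h2 : ContDiff ℝ ∞ fun t : ℝ => Real.sin (τ * t) := by fun_prop
  exact (h1.smul contDiff_const).sub (h2.smul contDiff_const)

theorem hasDerivAt_expCurve (τ : ℝ) (x y : k) (t : ℝ) :
    HasDerivAt (expCurve τ x y) (-(τ • expCurve τ y (-x) t)) t := by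
  have h0 : HasDerivAt (fun t : ℝ => τ * t) τ t := by
    simpa using (hasDerivAt_id t).const_mul τ
  have h1 := (h0.cos.smul_const x).sub (h0.sin.smul_const y)
  refine h1.congr_deriv ?_
  unfold expCurve
  module

namespace IsTwistedPair

variable {a : Module.Dual ℝ t₀} {τ : ℝ} {x y : k}

/-- The loop `Re(e^{iτt} (x + i y))`. -/
noncomputable def loop (h : IsTwistedPair t₀ φ a (2 * Real.pi * τ) x y) : Loop φ :=
  ⟨expCurve τ x y, contDiff_expCurve τ x y, fun t => by
    unfold expCurve
    rw [map_sub, map_smul, map_smul, h.re, h.im, mul_add, mul_comm τ (2 * Real.pi),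
      Real.cos_add, Real.sin_add]
    module⟩

theorem loop_apply (h : IsTwistedPair t₀ φ a (2 * Real.pi * τ) x y) (t : ℝ) :
    h.loop.1 t = Real.cos (τ * t) • x - Real.sin (τ * t) • y := rfl

variable {ν : Module.Dual ℝ t₀}

/-- The complex loop `e^{iτt} (x + i y)` is an eigenvector of the derivation with eigenvalue `i (τ +
ν(α^♯))`: `iτ` from differentiation, the rest from the slanting operator. -/
theorem loopDer_loop (hD : IsTwistDerivation φ D) (hs : IsSlanting t₀ ν D)
    (h : IsTwistedPair t₀ φ a (2 * Real.pi * τ) x y) :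
    hD.loopDer h.loop = -((τ + ν (sharp t₀ a)) • h.mul_I.loop) := by
  refine Subtype.ext (funext fun t => ?_)
  have e := isSlanting_iff.1 hs a x y h.pair
  rw [hD.loopDer_apply]
  change deriv (expCurve τ x y) t + D (h.loop.1 t) =
    -((τ + ν (sharp t₀ a)) • h.mul_I.loop.1 t)
  rw [(hasDerivAt_expCurve τ x y t).deriv, loop_apply, loop_apply, map_sub, map_smul, map_smul,
    e.1, e.2]
  unfold expCurve
  module

theorem lie_loop (h : IsTwistedPair t₀ φ a (2 * Real.pi * τ) x y) (z : t₀) (t : ℝ) :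
    ⁅(z : k), h.loop.1 t⁆ = -(a z • h.mul_I.loop.1 t) := by
  rw [loop_apply, loop_apply, lie_sub, lie_smul, lie_smul, (h.pair z).1, (h.pair z).2]
  module

end IsTwistedPair

theorem IsSlanting.apply_eq_zero (hab : ∀ x ∈ t₀, ∀ y ∈ t₀, ⁅x, y⁆ = 0) {ν : Module.Dual ℝ t₀}
    (hs : IsSlanting t₀ ν D) (z : t₀) : D z = 0 := by
  have h : IsWeightPair t₀ 0 (z : k) 0 := fun w => by simp [hab w w.2 z z.2]
  rw [(isSlanting_iff.1 hs 0 _ _ h).1, smul_zero, neg_zero]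

variable {ν : Module.Dual ℝ t₀} {hD : IsTwistDerivation φ D} {ht : t₀ ≤ fixedPoints φ}

theorem loopDer_constLoop (hab : ∀ x ∈ t₀, ∀ y ∈ t₀, ⁅x, y⁆ = 0) (hs : IsSlanting t₀ ν D)
    (z : t₀) : hD.loopDer (constLoop t₀ ht z) = 0 := by
  refine Subtype.ext (funext fun t => ?_)
  rw [hD.loopDer_apply]
  change deriv (fun _ : ℝ => (z : k)) t + D z = 0
  rw [deriv_const, zero_add, hs.apply_eq_zero hab]

theorem cartan_lie (hab : ∀ x ∈ t₀, ∀ y ∈ t₀, ⁅x, y⁆ = 0) (hs : IsSlanting t₀ ν D)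
    (z r : ℝ) (x : t₀) (X : Affinisation hD) :
    ⁅cartan t₀ hD ht (z, x, r), X⁆ =
      Affinisation.mk hD 0 (⁅constLoop t₀ ht x, X.2.1⁆ + r • hD.loopDer X.2.1) 0 := by
  rw [Affinisation.lie_def]
  change Affinisation.mk hD (Loop.form (hD.loopDer (constLoop t₀ ht x)) X.2.1)
    (⁅constLoop t₀ ht x, X.2.1⁆ + r • hD.loopDer X.2.1 -
      X.2.2 • hD.loopDer (constLoop t₀ ht x)) 0 = _
  rw [loopDer_constLoop hab hs, smul_zero, sub_zero]
  have e : Loop.form (0 : Loop φ) X.2.1 = 0 := by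
    have := Loop.form_smul_left (0 : ℝ) (0 : Loop φ) X.2.1
    rwa [zero_smul, zero_mul] at this
  rw [e]

/-- The root space of `(a, c) ≠ 0` consists of the loops `e^{iτt} (x + i y)`, where
`τ = c - ν(α^♯)`. -/
theorem cmk_mem_rootSpace_cartan (hab : ∀ x ∈ t₀, ∀ y ∈ t₀, ⁅x, y⁆ = 0)
    (hs : IsSlanting t₀ ν D) {a : Module.Dual ℝ t₀} {c : ℝ} (hac : affineFunctional t₀ a c ≠ 0)
    {X Y : Affinisation hD}
    (hXY : cmk X Y ∈ rootSpace (cartan t₀ hD ht) (affineFunctional t₀ a c)) :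
    ∃ (x y : k) (h : IsTwistedPair t₀ φ a (2 * Real.pi * (c - ν (sharp t₀ a))) x y),
      X = Affinisation.mk hD 0 h.loop 0 ∧ Y = Affinisation.mk hD 0 h.mul_I.loop 0 := by
  have hXY' := (cmk_mem_rootSpace_imag _ _ X Y).1 hXY
  obtain ⟨z, ξ, s⟩ := X
  obtain ⟨z', η, s'⟩ := Y
  obtain ⟨p, hp⟩ : ∃ p, affineFunctional t₀ a c p ≠ 0 := by
    by_contra! hc
    exact hac (LinearMap.ext hc)
  obtain ⟨p1, p2, p3⟩ := p
  rw [affineFunctional_apply] at hp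
  have hp' : a p2 + c * p3 ≠ 0 := fun h0 => hp (by rw [h0]; simp)
  have key : ∀ (w r : ℝ) (x : t₀),
      (Affinisation.mk hD 0 (⁅constLoop t₀ ht x, ξ⁆ + r • hD.loopDer ξ) 0 =
        -((a x + c * r) • Affinisation.mk hD z' η s')) ∧
      (Affinisation.mk hD 0 (⁅constLoop t₀ ht x, η⁆ + r • hD.loopDer η) 0 =
        (a x + c * r) • Affinisation.mk hD z ξ s) := by
    intro w r x
    have e := hXY' (w, x, r)
    exact ⟨(cartan_lie hab hs w r x (z, ξ, s)).symm.trans e.1,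
      (cartan_lie hab hs w r x (z', η, s')).symm.trans e.2⟩
  have k1 := (key p1 p3 p2).1
  have k2 := (key p1 p3 p2).2
  -- Brackets with `t₀^e` have zero first and last components, so these components of an eigenvector
  -- vanish as soon as the functional is nonzero somewhere.
  have hz' : z' = 0 := by
    have e : (0 : ℝ) = -((a p2 + c * p3) * z') := congrArg (fun X => X.1) k1
    exact (mul_eq_zero.1 (zero_eq_neg.1 e)).resolve_left hp'
  have hs' : s' = 0 := by
    have e : (0 : ℝ) = -((a p2 + c * p3) * s') := congrArg (fun X => X.2.2) k1
    exact (mul_eq_zero.1 (zero_eq_neg.1 e)).resolve_left hp'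
  have hz : z = 0 := by
    have e : (0 : ℝ) = (a p2 + c * p3) * z := congrArg (fun X => X.1) k2
    exact (mul_eq_zero.1 e.symm).resolve_left hp'
  have hs0 : s = 0 := by
    have e : (0 : ℝ) = (a p2 + c * p3) * s := congrArg (fun X => X.2.2) k2
    exact (mul_eq_zero.1 e.symm).resolve_left hp'
  subst hz' hs' hz hs0
  have hpair : ∀ t, IsWeightPair t₀ a (ξ.1 t) (η.1 t) := by
    intro t x
    have k3 : ⁅constLoop t₀ ht x, ξ⁆ + (0 : ℝ) • hD.loopDer ξ = -((a x + c * 0) • η) :=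
      congrArg (fun X => X.2.1) (key 0 0 x).1
    have k4 : ⁅constLoop t₀ ht x, η⁆ + (0 : ℝ) • hD.loopDer η = (a x + c * 0) • ξ :=
      congrArg (fun X => X.2.1) (key 0 0 x).2
    rw [zero_smul, add_zero, mul_zero, add_zero] at k3 k4
    exact ⟨congrArg (fun ξ : Loop φ => ξ.1 t) k3, congrArg (fun ξ : Loop φ => ξ.1 t) k4⟩
  set n := ν (sharp t₀ a) with hn
  set τ := c - n with hτ
  -- Testing against `(0, 0, 1)` turns the root equation into `(ξ + i η)' = iτ (ξ + i η)`, because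
  -- the slanting operator is already a known scalar on the values.
  have hder : ∀ t, deriv ξ.1 t = -(τ • η.1 t) ∧ deriv η.1 t = τ • ξ.1 t := by
    intro t
    have k3 : ⁅constLoop t₀ ht 0, ξ⁆ + (1 : ℝ) • hD.loopDer ξ = -((a 0 + c * 1) • η) :=
      congrArg (fun X => X.2.1) (key 0 1 0).1
    have k4 : ⁅constLoop t₀ ht 0, η⁆ + (1 : ℝ) • hD.loopDer η = (a 0 + c * 1) • ξ :=
      congrArg (fun X => X.2.1) (key 0 1 0).2
    have h0 : constLoop t₀ ht 0 = 0 := rfl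
    rw [h0, zero_lie, zero_add, one_smul, map_zero, zero_add, mul_one] at k3 k4
    have k3' : deriv ξ.1 t + D (ξ.1 t) = -(c • η.1 t) := congrArg (fun ξ : Loop φ => ξ.1 t) k3
    have k4' : deriv η.1 t + D (η.1 t) = c • ξ.1 t := congrArg (fun ξ : Loop φ => ξ.1 t) k4
    have e := isSlanting_iff.1 hs a _ _ (hpair t)
    rw [e.1, ← eq_sub_iff_add_eq] at k3'
    rw [e.2, ← eq_sub_iff_add_eq] at k4'
    refine ⟨k3'.trans ?_, k4'.trans ?_⟩
    · rw [hτ]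
      module
    · rw [hτ]
      module
  have hξ : ∀ t, HasDerivAt ξ.1 (-(τ • η.1 t)) t := fun t => by
    rw [← (hder t).1]
    exact (Loop.differentiable ξ t).hasDerivAt
  have hη : ∀ t, HasDerivAt η.1 (τ • ξ.1 t) t := fun t => by
    rw [← (hder t).2]
    exact (Loop.differentiable η t).hasDerivAt
  have h0 : ∀ t : ℝ, HasDerivAt (fun t : ℝ => τ * t) τ t := fun t => by
    simpa using (hasDerivAt_id t).const_mul τ
  -- `hu` and `hw` state that `e^{-iτt} (ξ + i η)` is constant.
  have hu : ∀ t, Real.cos (τ * t) • ξ.1 t + Real.sin (τ * t) • η.1 t = ξ.1 0 := by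
    have hd : ∀ t, HasDerivAt (fun t => Real.cos (τ * t) • ξ.1 t + Real.sin (τ * t) • η.1 t) 0 t := by
      intro t
      refine (((h0 t).cos.smul (hξ t)).add ((h0 t).sin.smul (hη t))).congr_deriv ?_
      module
    intro t
    have e := is_const_of_deriv_eq_zero (fun t => (hd t).differentiableAt) (fun t => (hd t).deriv)
      t 0
    simpa using e
  have hw : ∀ t, Real.cos (τ * t) • η.1 t - Real.sin (τ * t) • ξ.1 t = η.1 0 := by
    have hd : ∀ t, HasDerivAt (fun t => Real.cos (τ * t) • η.1 t - Real.sin (τ * t) • ξ.1 t) 0 t := by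
      intro t
      refine (((h0 t).cos.smul (hη t)).sub ((h0 t).sin.smul (hξ t))).congr_deriv ?_
      module
    intro t
    have e := is_const_of_deriv_eq_zero (fun t => (hd t).differentiableAt) (fun t => (hd t).deriv)
      t 0
    simpa using e
  have hξe : ∀ t, ξ.1 t = Real.cos (τ * t) • ξ.1 0 - Real.sin (τ * t) • η.1 0 := by
    intro t
    rw [← hu t, ← hw t]
    refine Eq.trans (b := (Real.sin (τ * t) ^ 2 + Real.cos (τ * t) ^ 2) • ξ.1 t) ?_ ?_
    · rw [Real.sin_sq_add_cos_sq, one_smul]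
    · module
  have hηe : ∀ t, η.1 t = Real.cos (τ * t) • η.1 0 - Real.sin (τ * t) • -ξ.1 0 := by
    intro t
    rw [← hu t, ← hw t]
    refine Eq.trans (b := (Real.sin (τ * t) ^ 2 + Real.cos (τ * t) ^ 2) • η.1 t) ?_ ?_
    · rw [Real.sin_sq_add_cos_sq, one_smul]
    · module
  -- The twisted periodicity at `t = 0` says that the initial value is a `φ⁻¹`-eigenvector with
  -- eigenvalue `e^{2πiτ}`.
  have htw : IsTwistedPair t₀ φ a (2 * Real.pi * τ) (ξ.1 0) (η.1 0) := by
    refine ⟨hpair 0, ?_, ?_⟩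
    · rw [← ξ.2.2, zero_add, hξe, mul_comm τ]
    · rw [← η.2.2, zero_add, hηe, mul_comm τ]
      module
  refine ⟨ξ.1 0, η.1 0, htw, ?_, ?_⟩
  · exact Affinisation.ext' rfl (Subtype.ext (funext hξe)) rfl
  · exact Affinisation.ext' rfl (Subtype.ext (funext hηe)) rfl

theorem IsTwistedPair.cmk_loop_mem (hab : ∀ x ∈ t₀, ∀ y ∈ t₀, ⁅x, y⁆ = 0)
    (hs : IsSlanting t₀ ν D) {a : Module.Dual ℝ t₀} {c : ℝ} {x y : k}
    (h : IsTwistedPair t₀ φ a (2 * Real.pi * (c - ν (sharp t₀ a))) x y) :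
    cmk (Affinisation.mk hD 0 h.loop 0) (Affinisation.mk hD 0 h.mul_I.loop 0) ∈
      rootSpace (cartan t₀ hD ht) (affineFunctional t₀ a c) := by
  refine (cmk_mem_rootSpace_imag _ _ _ _).2 ?_
  rintro ⟨w, z, r⟩
  rw [cartan_lie hab hs, cartan_lie hab hs]
  have hc : ∀ {x y : k} (h : IsTwistedPair t₀ φ a (2 * Real.pi * (c - ν (sharp t₀ a))) x y),
      ⁅constLoop t₀ ht z, h.loop⁆ + r • hD.loopDer h.loop =
        -((a z + c * r) • h.mul_I.loop) := by
    intro x y h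
    rw [h.loopDer_loop hD hs]
    refine Subtype.ext (funext fun t => ?_)
    change ⁅(z : k), h.loop.1 t⁆ +
      r • -((c - ν (sharp t₀ a) + ν (sharp t₀ a)) • h.mul_I.loop.1 t) =
      -((a z + c * r) • h.mul_I.loop.1 t)
    rw [h.lie_loop]
    module
  constructor
  · refine Affinisation.ext' ?_ (hc h) ?_
    · exact neg_zero.symm.trans (congrArg Neg.neg (mul_zero _).symm)
    · exact neg_zero.symm.trans (congrArg Neg.neg (mul_zero _).symm)
  · refine Affinisation.ext' (mul_zero _).symm ((hc h.mul_I).trans ?_) (mul_zero _).symm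
    refine Subtype.ext (funext fun t => ?_)
    change -((a z + c * r) • expCurve _ (-x) (-y) t) = (a z + c * r) • expCurve _ x y t
    unfold expCurve
    module

theorem lie_starC {g : Type*} [LieRing g] [LieAlgebra ℝ g] (X Y : g) :
    ⁅cmk X Y, starC (cmk X Y)⁆ = cmk 0 ((2 : ℝ) • ⁅X, Y⁆) := by
  rw [starC_cmk, lie_cmk, cmk_inj, lie_neg, lie_self, lie_self, lie_neg, ← lie_skew X Y]
  exact ⟨by simp, by module⟩

/-- The rotation by `e^{iτt}` has determinant one and so does not change the bracket of real and
imaginary part: the pointwise bracket is the constant loop `[x, y]`. The central component is the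
cocycle. -/
theorem IsTwistedPair.lie_loop_mul_I (hm : IsMaxAbelianIn t₀ (fixedPoints φ))
    (hs : IsSlanting t₀ ν D) {a : Module.Dual ℝ t₀} {c : ℝ} {x y : k}
    (h : IsTwistedPair t₀ φ a (2 * Real.pi * (c - ν (sharp t₀ a))) x y) :
    ⁅Affinisation.mk hD 0 h.loop 0, Affinisation.mk hD 0 h.mul_I.loop 0⁆ =
      cartan t₀ hD ht (-(c * Loop.form h.mul_I.loop h.mul_I.loop), ⟨⁅x, y⁆, h.lie_mem hm⟩, 0) := by
  rw [Affinisation.lie_def]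
  refine Affinisation.ext' ?_ ?_ rfl
  · change Loop.form (hD.loopDer h.loop) h.mul_I.loop = -(c * _)
    rw [h.loopDer_loop hD hs, ← neg_smul, Loop.form_smul_left]
    ring
  · change ⁅h.loop, h.mul_I.loop⁆ + (0 : ℝ) • hD.loopDer h.mul_I.loop -
      (0 : ℝ) • hD.loopDer h.loop = _
    rw [zero_smul, zero_smul, add_zero, sub_zero]
    refine Subtype.ext (funext fun t => ?_)
    change ⁅h.loop.1 t, h.mul_I.loop.1 t⁆ = ⁅x, y⁆
    rw [h.loop_apply, h.mul_I.loop_apply]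
    set s := Real.sin ((c - ν (sharp t₀ a)) * t)
    set u := Real.cos ((c - ν (sharp t₀ a)) * t)
    have e : s ^ 2 + u ^ 2 = 1 := Real.sin_sq_add_cos_sq _
    refine Eq.trans (b := (s ^ 2 + u ^ 2) • ⁅x, y⁆) ?_ (by rw [e, one_smul])
    simp only [sub_lie, lie_sub, smul_lie, lie_smul, lie_neg, lie_self, smul_neg, smul_zero]
    rw [← lie_skew y x]
    module

theorem affineFunctional_ne_zero {a : Module.Dual ℝ t₀} (ha : a ≠ 0) (c : ℝ) :
    affineFunctional t₀ a c ≠ 0 := by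
  intro h
  refine ha (LinearMap.ext fun x => ?_)
  have e := LinearMap.congr_fun h (0, x, 0)
  rw [affineFunctional_apply] at e
  simpa using e

/-- For `v = X + i Y` one has `[v, v^*] = 2 i [X, Y]`, and the functional takes the value `-2 a([x,
y]) > 0` on it; the central component is invisible to the functional. One-dimensionality is
multiplicity one applied to the initial values of the loops. -/
theorem IsTwistedPair.isCompactRoot (hm : IsMaxAbelianIn t₀ (fixedPoints φ))
    (hs : IsSlanting t₀ ν D) {a : Module.Dual ℝ t₀} {c : ℝ} {x y : k} (ha : a ≠ 0) (hx : x ≠ 0)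
    (h : IsTwistedPair t₀ φ a (2 * Real.pi * (c - ν (sharp t₀ a))) x y) :
    IsCompactRoot (cartan t₀ hD ht) (affineFunctional t₀ a c) := by
  have hab := hm.1.2
  refine ⟨affineFunctional_ne_zero ha c, cmk (Affinisation.mk hD 0 h.loop 0)
    (Affinisation.mk hD 0 h.mul_I.loop 0), ?_, ?_,
    cmk 0 ((2 : ℝ) • (-(c * Loop.form h.mul_I.loop h.mul_I.loop), ⟨⁅x, y⁆, h.lie_mem hm⟩, 0)),
    -(2 * a ⟨⁅x, y⁆, h.lie_mem hm⟩), ?_, ?_, ?_⟩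
  · rw [Ne, cmk_eq_zero]
    rintro ⟨h0, -⟩
    have e : h.loop.1 0 = 0 := congrArg (fun X : Affinisation hD => X.2.1.1 0) h0
    rw [h.loop_apply] at e
    simp at e
    exact hx e
  · refine le_antisymm (fun w hw => ?_) ?_
    · obtain ⟨X, Y, rfl⟩ := exists_eq_cmk w
      obtain ⟨x', y', h', rfl, rfl⟩ :=
        cmk_mem_rootSpace_cartan hab hs (affineFunctional_ne_zero ha c) hw
      obtain ⟨α, β, e1, e2⟩ := h.exists_smul_eq hm ha hx h'
      refine Submodule.mem_span_singleton.2 ⟨⟨α, β⟩, ?_⟩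
      rw [smul_cmk, cmk_inj]
      constructor
      · refine Affinisation.ext' ?_ (Subtype.ext (funext fun t => ?_)) ?_
        · change α * 0 - β * 0 = (0 : ℝ)
          ring
        · change α • expCurve _ x y t - β • expCurve _ y (-x) t = expCurve _ x' y' t
          unfold expCurve
          rw [e1, e2]
          module
        · change α * 0 - β * 0 = (0 : ℝ)
          ring
      · refine Affinisation.ext' ?_ (Subtype.ext (funext fun t => ?_)) ?_
        · change α * 0 + β * 0 = (0 : ℝ)
          ring
        · change α • expCurve _ y (-x) t + β • expCurve _ x y t = expCurve _ y' (-x') t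
          unfold expCurve
          rw [e1, e2]
          module
        · change α * 0 + β * 0 = (0 : ℝ)
          ring
    · rw [Submodule.span_singleton_le_iff_mem]
      exact h.cmk_loop_mem hab hs
  · rw [lie_starC, baseChange_cmk, h.lie_loop_mul_I (ht := ht) hm hs, map_zero, map_smul]
  · rw [extendC_cmk, map_zero, zero_add, map_smul, affineFunctional_apply]
    simp only [mul_zero, add_zero, Complex.real_smul]
    push_cast
    linear_combination 2 * (a ⟨⁅x, y⁆, h.lie_mem hm⟩ : ℂ) * Complex.I_mul_I
  · have := h.weight_lie_neg hm ha hx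
    linarith

/-- No shape of `α` is assumed. It is imaginary because `t₀^e` acts on loops by operators skew for
the form, it kills the centre, and its `t₀`-part is nonzero because otherwise `α([v, v^*])` would be
zero. -/
theorem exists_of_isCompactRoot (hm : IsMaxAbelianIn t₀ (fixedPoints φ))
    (hs : IsSlanting t₀ ν D) {α : (ℝ × t₀ × ℝ) →ₗ[ℝ] ℂ}
    (hα : IsCompactRoot (cartan t₀ hD ht) α) :
    ∃ (a : Module.Dual ℝ t₀) (c : ℝ) (x y : k), a ≠ 0 ∧ x ≠ 0 ∧ α = affineFunctional t₀ a c ∧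
      IsTwistedPair t₀ φ a (2 * Real.pi * (c - ν (sharp t₀ a))) x y := by
  have hab := hm.1.2
  obtain ⟨hα0, v, hv0, hv, h, r, hjh, hr, hr0⟩ := hα
  have hmem : v ∈ rootSpace (cartan t₀ hD ht) α := by
    rw [hv]
    exact Submodule.mem_span_singleton_self v
  obtain ⟨X, Y, rfl⟩ := exists_eq_cmk v
  have hXY := (cmk_mem_rootSpace _ _ X Y).1 hmem
  -- This is `(ρ + iσ)(u + iw) = 0` with nonzero first factor.
  have hcomp : ∀ {u w ρ σ : ℝ}, (ρ ≠ 0 ∨ σ ≠ 0) → 0 = ρ * u - σ * w → 0 = ρ * w + σ * u →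
      u = 0 ∧ w = 0 := by
    intro u w ρ σ hne e1 e2
    have hpos : 0 < ρ ^ 2 + σ ^ 2 := by
      rcases hne with hne | hne <;> positivity
    constructor
    · have : (ρ ^ 2 + σ ^ 2) * u = 0 := by linear_combination -ρ * e1 - σ * e2
      exact (mul_eq_zero.1 this).resolve_left hpos.ne'
    · have : (ρ ^ 2 + σ ^ 2) * w = 0 := by linear_combination σ * e1 - ρ * e2
      exact (mul_eq_zero.1 this).resolve_left hpos.ne'
  obtain ⟨p, hp⟩ : ∃ p, α p ≠ 0 := by
    by_contra! hc
    exact hα0 (LinearMap.ext hc)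
  have hpne : (α p).re ≠ 0 ∨ (α p).im ≠ 0 := by
    by_contra! hc
    exact hp (Complex.ext hc.1 hc.2)
  have hL : ∀ p : ℝ × t₀ × ℝ, ∀ Z : Affinisation hD, ⁅cartan t₀ hD ht p, Z⁆ =
      Affinisation.mk hD 0 (⁅constLoop t₀ ht p.2.1, Z.2.1⁆ + p.2.2 • hD.loopDer Z.2.1) 0 :=
    fun p Z => cartan_lie hab hs p.1 p.2.2 p.2.1 Z
  have h1 : X.1 = 0 ∧ Y.1 = 0 := by
    have e1 := congrArg (fun Z : Affinisation hD => Z.1) ((hL p X).symm.trans (hXY p).1)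
    have e2 := congrArg (fun Z : Affinisation hD => Z.1) ((hL p Y).symm.trans (hXY p).2)
    exact hcomp hpne e1 e2
  have h2 : X.2.2 = 0 ∧ Y.2.2 = 0 := by
    have e1 := congrArg (fun Z : Affinisation hD => Z.2.2) ((hL p X).symm.trans (hXY p).1)
    have e2 := congrArg (fun Z : Affinisation hD => Z.2.2) ((hL p Y).symm.trans (hXY p).2)
    exact hcomp hpne e1 e2
  have hpos : 0 < Loop.form X.2.1 X.2.1 + Loop.form Y.2.1 Y.2.1 := by
    have n1 := Loop.form_self_nonneg X.2.1
    have n2 := Loop.form_self_nonneg Y.2.1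
    refine lt_of_le_of_ne (add_nonneg n1 n2) fun h0 => hv0 (cmk_eq_zero.2 ?_)
    have z1 := Loop.eq_zero_of_form_self hD.isometry (ξ := X.2.1) (by linarith)
    have z2 := Loop.eq_zero_of_form_self hD.isometry (ξ := Y.2.1) (by linarith)
    exact ⟨Affinisation.ext' h1.1 z1 h2.1, Affinisation.ext' h1.2 z2 h2.2⟩
  -- Pairing each component with its own bracket gives zero by skewness; adding the two relations
  -- leaves `Re α(p)` times the squared norm of the root vector.
  have hre : ∀ p, (α p).re = 0 := by
    intro p
    have e1 : ⁅constLoop t₀ ht p.2.1, X.2.1⁆ + p.2.2 • hD.loopDer X.2.1 =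
        (α p).re • X.2.1 - (α p).im • Y.2.1 :=
      congrArg (fun Z : Affinisation hD => Z.2.1) ((hL p X).symm.trans (hXY p).1)
    have e2 : ⁅constLoop t₀ ht p.2.1, Y.2.1⁆ + p.2.2 • hD.loopDer Y.2.1 =
        (α p).re • Y.2.1 + (α p).im • X.2.1 :=
      congrArg (fun Z : Affinisation hD => Z.2.1) ((hL p Y).symm.trans (hXY p).2)
    have hz : ∀ ζ : Loop φ, Loop.form (⁅constLoop t₀ ht p.2.1, ζ⁆ + p.2.2 • hD.loopDer ζ) ζ = 0 := by
      intro ζ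
      rw [Loop.form_add_left, Loop.form_smul_left, Affinisation.form_loopDer_self, Loop.form_lie,
        lie_self, mul_zero, add_zero]
      have := Loop.form_smul_right (0 : ℝ) (constLoop t₀ ht p.2.1) 0
      rwa [zero_smul, zero_mul] at this
    have f1 := hz X.2.1
    have f2 := hz Y.2.1
    rw [e1, sub_eq_add_neg, ← neg_smul, Loop.form_add_left, Loop.form_smul_left,
      Loop.form_smul_left] at f1
    rw [e2, Loop.form_add_left, Loop.form_smul_left, Loop.form_smul_left] at f2
    have f3 : (α p).re * (Loop.form X.2.1 X.2.1 + Loop.form Y.2.1 Y.2.1) = 0 := by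
      rw [Loop.form_comm Y.2.1 X.2.1] at f1
      linarith
    exact (mul_eq_zero.1 f3).resolve_right hpos.ne'
  have hcen : ∀ z : ℝ, α (z, 0, 0) = 0 := by
    intro z
    have e := hmem (z, 0, 0)
    rw [one_tmul_eq_cmk, lie_cmk, hL, hL] at e
    have hzero : ∀ Z : Affinisation hD, Affinisation.mk hD 0
        (⁅constLoop t₀ ht 0, Z.2.1⁆ + (0 : ℝ) • hD.loopDer Z.2.1) 0 = 0 := by
      intro Z
      have h0 : constLoop t₀ ht 0 = 0 := rfl
      rw [h0, zero_lie, zero_smul, add_zero]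
      rfl
    rw [hzero, hzero, zero_lie, zero_lie, sub_zero, add_zero, cmk_zero] at e
    exact (smul_eq_zero.1 e.symm).resolve_right hv0
  let ι : t₀ →ₗ[ℝ] ℝ × t₀ × ℝ := LinearMap.inr ℝ ℝ (t₀ × ℝ) ∘ₗ LinearMap.inl ℝ t₀ ℝ
  let a : Module.Dual ℝ t₀ := Complex.imLm ∘ₗ α ∘ₗ ι
  let c : ℝ := (α (0, 0, 1)).im
  have hαe : α = affineFunctional t₀ a c := by
    refine LinearMap.ext ?_
    rintro ⟨z, x, r⟩
    have hdec : ((z, x, r) : ℝ × t₀ × ℝ) = (z, 0, 0) + ι x + r • (0, 0, 1) := by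
      simp [ι]
    have hi : ∀ p, α p = Complex.I * ((α p).im : ℂ) := fun p => by
      apply Complex.ext <;> simp [hre p]
    rw [affineFunctional_apply, hdec, map_add, map_add, hcen, zero_add, map_smul, hi (ι x),
      hi (0, 0, 1)]
    change _ = Complex.I * (((α (ι x)).im + (α (0, 0, 1)).im * r : ℝ) : ℂ)
    simp only [Complex.real_smul]
    push_cast
    ring
  rw [hαe] at hmem hα0
  obtain ⟨x, y, h', rfl, rfl⟩ := cmk_mem_rootSpace_cartan hab hs hα0 hmem
  -- If `a = 0`, then `[v, v^*]` has only central and `t₀`-components, on both of which the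
  -- functional vanishes, contradicting positivity.
  have ha : a ≠ 0 := by
    intro ha
    obtain ⟨q, q', rfl⟩ := exists_eq_cmk h
    rw [lie_starC, baseChange_cmk, h'.lie_loop_mul_I (ht := ht) hm hs, cmk_inj] at hjh
    have hinj : ∀ p q : ℝ × t₀ × ℝ, cartan t₀ hD ht p = cartan t₀ hD ht q → p = q := by
      rintro ⟨p1, p2, p3⟩ ⟨q1, q2, q3⟩ e
      have e1 : p1 = q1 := congrArg (fun Z : Affinisation hD => Z.1) e
      have e2 : (p2 : k) = q2 := congrArg (fun Z : Affinisation hD => Z.2.1.1 0) e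
      have e3 : p3 = q3 := congrArg (fun Z : Affinisation hD => Z.2.2) e
      rw [e1, Subtype.ext e2, e3]
    have hq : q = 0 := hinj _ _ (by rw [hjh.1, map_zero])
    have hq' := hinj _ _ (hjh.2.trans (map_smul _ _ _).symm)
    rw [hαe, extendC_cmk, hq, hq', map_zero, map_smul, affineFunctional_apply,
      LinearMap.congr_fun ha ⟨⁅x, y⁆, _⟩] at hr
    simp at hr
    exact hr0.ne (by exact_mod_cast hr)
  refine ⟨a, c, x, y, ha, h'.pair.re_ne_zero ha ?_, hαe, h'⟩
  by_contra! hc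
  have hloop : ∀ {x y : k} (h : IsTwistedPair t₀ φ a (2 * Real.pi * (c - ν (sharp t₀ a))) x y),
      x = 0 → y = 0 → h.loop = 0 := by
    intro x y h hx hy
    refine Subtype.ext (funext fun t => ?_)
    rw [h.loop_apply, hx, hy]
    simp
  refine hv0 (cmk_eq_zero.2 ⟨?_, ?_⟩)
  · exact Affinisation.ext' rfl (hloop h' hc.1 hc.2) rfl
  · exact Affinisation.ext' rfl (hloop h'.mul_I hc.2 (by rw [hc.1, neg_zero])) rfl

/-- The compact roots of an affinisation. -/
theorem setOf_isCompactRoot (hm : IsMaxAbelianIn t₀ (fixedPoints φ)) (hφ : FiniteOrder φ)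
    (hs : IsSlanting t₀ ν D) :
    {α | IsCompactRoot (cartan t₀ hD ht) α} =
      affineWeight t₀ (autOrder φ) ν '' rootPairs t₀ φ := by
  ext α
  constructor
  · intro hα
    obtain ⟨a, c, x, y, ha, hx, rfl, h⟩ := exists_of_isCompactRoot hm hs hα
    obtain ⟨m, hm'⟩ := h.exists_int hφ (Or.inl hx)
    refine ⟨(a, m), ⟨m, rfl, mem_weightsAt.2 ⟨ha, x, y, Or.inl hx, hm' ▸ h⟩⟩, ?_⟩
    rw [affineWeight_eq]
    have e := mul_left_cancel₀ (by positivity) hm'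
    exact affineFunctional_inj.2 ⟨rfl, by linarith⟩
  · rintro ⟨⟨a, c⟩, ⟨n, rfl, hn⟩, rfl⟩
    obtain ⟨ha, x, y, hne, h⟩ := mem_weightsAt.1 hn
    rw [affineWeight_eq]
    refine IsTwistedPair.isCompactRoot (x := x) (y := y) hm hs ha (h.pair.re_ne_zero ha hne) ?_
    simpa using h

theorem affineWeight_injective {N : ℕ} (hN : N ≠ 0) (ν : Module.Dual ℝ t₀) :
    Function.Injective (affineWeight t₀ N ν) := by
  rintro ⟨a, m⟩ ⟨b, n⟩ h
  rw [affineWeight_eq, affineWeight_eq, affineFunctional_inj] at h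
  obtain ⟨h1, h2⟩ := h
  simp only at h1 h2
  subst h1
  have hN' : (N : ℝ) ≠ 0 := Nat.cast_ne_zero.2 hN
  have h3 : m / N = n / N := by linarith
  rw [div_left_inj' hN'] at h3
  rw [h3]

end AffineRoots

/-! ### Transport of root data along isomorphisms -/

section Transport

variable {T g g' : Type*} [AddCommGroup T] [Module ℝ T] [LieRing g] [LieAlgebra ℝ g]
  [LieRing g'] [LieAlgebra ℝ g'] {j : T →ₗ[ℝ] g} {j' : T →ₗ[ℝ] g'}

theorem baseChange_lie (Φ : g ≃ₗ⁅ℝ⁆ g') (x y : ℂ ⊗[ℝ] g) :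
    (Φ : g →ₗ[ℝ] g').baseChange ℂ ⁅x, y⁆ =
      ⁅(Φ : g →ₗ[ℝ] g').baseChange ℂ x, (Φ : g →ₗ[ℝ] g').baseChange ℂ y⁆ := by
  obtain ⟨a, b, rfl⟩ := exists_eq_cmk x
  obtain ⟨c, d, rfl⟩ := exists_eq_cmk y
  have e : ∀ x y, (Φ : g →ₗ[ℝ] g') ⁅x, y⁆ = ⁅(Φ : g →ₗ[ℝ] g') x, (Φ : g →ₗ[ℝ] g') y⁆ :=
    fun x y => LieEquiv.map_lie Φ x y
  rw [lie_cmk, baseChange_cmk, baseChange_cmk, baseChange_cmk, lie_cmk, map_sub, map_add,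
    e, e, e, e]

theorem baseChange_starC (Φ : g ≃ₗ⁅ℝ⁆ g') (x : ℂ ⊗[ℝ] g) :
    (Φ : g →ₗ[ℝ] g').baseChange ℂ (starC x) = starC ((Φ : g →ₗ[ℝ] g').baseChange ℂ x) := by
  obtain ⟨a, b, rfl⟩ := exists_eq_cmk x
  rw [starC_cmk, baseChange_cmk, baseChange_cmk, starC_cmk, map_neg]

theorem baseChange_symm (Φ : g ≃ₗ⁅ℝ⁆ g') (x : ℂ ⊗[ℝ] g') :
    (Φ : g →ₗ[ℝ] g').baseChange ℂ ((Φ.symm : g' →ₗ[ℝ] g).baseChange ℂ x) = x := by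
  obtain ⟨a, b, rfl⟩ := exists_eq_cmk x
  have e : ∀ x, (Φ : g →ₗ[ℝ] g') ((Φ.symm : g' →ₗ[ℝ] g) x) = x :=
    fun x => LieEquiv.apply_symm_apply Φ x
  rw [baseChange_cmk, baseChange_cmk, e, e]

theorem baseChange_cartan (Φ : g ≃ₗ⁅ℝ⁆ g') (hΦ : ∀ p, Φ (j p) = j' p) (h : ℂ ⊗[ℝ] T) :
    (Φ : g →ₗ[ℝ] g').baseChange ℂ (j.baseChange ℂ h) = j'.baseChange ℂ h := by
  obtain ⟨a, b, rfl⟩ := exists_eq_cmk h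
  have e : ∀ x, (Φ : g →ₗ[ℝ] g') (j x) = j' x := hΦ
  rw [baseChange_cmk, baseChange_cmk, baseChange_cmk, e, e]

theorem baseChange_mem_rootSpace (Φ : g ≃ₗ⁅ℝ⁆ g') (hΦ : ∀ p, Φ (j p) = j' p) {α : T →ₗ[ℝ] ℂ}
    {x : ℂ ⊗[ℝ] g} (hx : x ∈ rootSpace j α) :
    (Φ : g →ₗ[ℝ] g').baseChange ℂ x ∈ rootSpace j' α := by
  intro p
  have e : (1 : ℂ) ⊗ₜ[ℝ] j' p = (Φ : g →ₗ[ℝ] g').baseChange ℂ ((1 : ℂ) ⊗ₜ[ℝ] j p) := by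
    rw [LinearMap.baseChange_tmul, ← hΦ]
    rfl
  rw [e, ← baseChange_lie, hx p, map_smul]

theorem symm_apply_cartan (Φ : g ≃ₗ⁅ℝ⁆ g') (hΦ : ∀ p, Φ (j p) = j' p) (p : T) :
    Φ.symm (j' p) = j p := by
  rw [← hΦ, LieEquiv.symm_apply_apply]

theorem map_rootSpace (Φ : g ≃ₗ⁅ℝ⁆ g') (hΦ : ∀ p, Φ (j p) = j' p) (α : T →ₗ[ℝ] ℂ) :
    (rootSpace j α).map ((Φ : g →ₗ[ℝ] g').baseChange ℂ) = rootSpace j' α := by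
  refine le_antisymm ?_ fun x hx => ?_
  · rintro _ ⟨x, hx, rfl⟩
    exact baseChange_mem_rootSpace Φ hΦ hx
  · exact ⟨_, baseChange_mem_rootSpace Φ.symm (symm_apply_cartan Φ hΦ) hx, baseChange_symm Φ x⟩

theorem IsCompactRoot.map (Φ : g ≃ₗ⁅ℝ⁆ g') (hΦ : ∀ p, Φ (j p) = j' p) {α : T →ₗ[ℝ] ℂ}
    (h : IsCompactRoot j α) : IsCompactRoot j' α := by
  obtain ⟨hα, x, hx0, hx, t, r, ht, htr, hr⟩ := h
  refine ⟨hα, (Φ : g →ₗ[ℝ] g').baseChange ℂ x, fun h0 => hx0 ?_, ?_, t, r, ?_, htr, hr⟩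
  · have e := baseChange_symm Φ.symm x
    rw [LieEquiv.symm_symm, h0, map_zero] at e
    exact e.symm
  · rw [← map_rootSpace Φ hΦ, hx, Submodule.map_span, Set.image_singleton]
  · rw [← baseChange_starC, ← baseChange_lie, ← ht, baseChange_cartan Φ hΦ]

theorem IsCoroot.map (Φ : g ≃ₗ⁅ℝ⁆ g') (hΦ : ∀ p, Φ (j p) = j' p) {α : T →ₗ[ℝ] ℂ}
    {t : ℂ ⊗[ℝ] T} (h : IsCoroot j α t) : IsCoroot j' α t := by
  refine ⟨?_, h.2⟩
  rw [← baseChange_cartan Φ hΦ]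
  have e := Submodule.mem_map_of_mem (f := (Φ : g →ₗ[ℝ] g').baseChange ℂ) h.1
  rw [Submodule.map_span] at e
  refine Submodule.span_mono ?_ e
  rintro _ ⟨_, ⟨x, hx, y, hy, rfl⟩, rfl⟩
  exact ⟨_, baseChange_mem_rootSpace Φ hΦ hx, _, baseChange_mem_rootSpace Φ hΦ hy,
    baseChange_lie Φ x y⟩

theorem weylGroup_le (Φ : g ≃ₗ⁅ℝ⁆ g') (hΦ : ∀ p, Φ (j p) = j' p) :
    weylGroup j ≤ weylGroup j' := by
  refine Subgroup.closure_mono ?_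
  rintro r ⟨α, t, h1, h2, h3⟩
  exact ⟨α, t, h1.map Φ hΦ, h2.map Φ hΦ, h3⟩

theorem weylGroup_eq (Φ : g ≃ₗ⁅ℝ⁆ g') (hΦ : ∀ p, Φ (j p) = j' p) :
    weylGroup j = weylGroup j' :=
  le_antisymm (weylGroup_le Φ hΦ) (weylGroup_le Φ.symm (symm_apply_cartan Φ hΦ))

theorem setOf_isCompactRoot_eq (Φ : g ≃ₗ⁅ℝ⁆ g') (hΦ : ∀ p, Φ (j p) = j' p) :
    {α | IsCompactRoot j α} = {α | IsCompactRoot j' α} :=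
  Set.ext fun _ => ⟨fun h => h.map Φ hΦ, fun h => h.map Φ.symm (symm_apply_cartan Φ hΦ)⟩

end Transport

/-! ### The map of root systems -/

section RootSystems

variable {k : Type*} [HilbertLieAlgebra k] {t₀ : LieSubalgebra ℝ k} {μ ν : Module.Dual ℝ t₀}
  {N N' : ℕ}

/-- The shift `-μ(α^♯)` in the label cancels the extra `μ` in the slant, and the factors `N'`
cancel: both labels name one functional on `t₀^e`. -/
theorem affineWeight_untwistRoot (hN' : N' ≠ 0) (p : Module.Dual ℝ t₀ × ℝ) :
    affineWeight t₀ N' (μ + ν) (untwistRoot t₀ μ N N' p) = affineWeight t₀ N ν p := by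
  have hN'' : (N' : ℝ) ≠ 0 := Nat.cast_ne_zero.2 hN'
  rw [affineWeight_eq, affineWeight_eq, affineFunctional_inj]
  refine ⟨rfl, ?_⟩
  simp only [untwistRoot, LinearMap.add_apply]
  field_simp
  ring

theorem untwistRoot_injective (hN : N ≠ 0) (hN' : N' ≠ 0) :
    Function.Injective (untwistRoot t₀ μ N N') := fun p q h => by
  apply affineWeight_injective hN 0
  rw [← affineWeight_untwistRoot (μ := μ) hN', h, affineWeight_untwistRoot hN']

/-- Both sets label the same set of functionals injectively, so relabelling is a bijection.
Integrality of the second coordinate of the image needs no separate argument. -/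
theorem bijOn_untwistRoot (hN : N ≠ 0) (hN' : N' ≠ 0) {R R' : Set (Module.Dual ℝ t₀ × ℝ)}
    (h : affineWeight t₀ N ν '' R = affineWeight t₀ N' (μ + ν) '' R') :
    Set.BijOn (untwistRoot t₀ μ N N') R R' := by
  refine ⟨fun p hp => ?_, (untwistRoot_injective hN hN').injOn, fun q hq => ?_⟩
  · have hmem : affineWeight t₀ N ν p ∈ affineWeight t₀ N' (μ + ν) '' R' := by
      rw [← h]
      exact Set.mem_image_of_mem _ hp
    obtain ⟨q, hq, e⟩ := hmem
    have e' := e.trans (affineWeight_untwistRoot (N := N) (μ := μ) hN' p).symm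
    rw [← affineWeight_injective hN' _ e']
    exact hq
  · have hmem : affineWeight t₀ N' (μ + ν) q ∈ affineWeight t₀ N ν '' R := by
      rw [h]
      exact Set.mem_image_of_mem _ hq
    obtain ⟨p, hp, e⟩ := hmem
    exact ⟨p, hp, affineWeight_injective hN' _ ((affineWeight_untwistRoot hN' p).trans e)⟩

theorem qsmul_dual (q : ℚ) (a : Module.Dual ℝ t₀) : q • a = (q : ℝ) • a :=
  (Rat.cast_smul_eq_qsmul ℝ q a).symm

theorem isRepresentable_of_mem_span {R : Set (Module.Dual ℝ t₀ × ℝ)}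
    (hR : ∀ p ∈ R, IsRepresentable t₀ p.1) {p : Module.Dual ℝ t₀ × ℝ}
    (hp : p ∈ Submodule.span ℚ R) : IsRepresentable t₀ p.1 := by
  induction hp using Submodule.span_induction with
  | mem p hp => exact hR p hp
  | zero => exact isRepresentable_zero
  | add p q _ _ hp hq => exact hp.add hq
  | smul c p _ hp =>
    rw [Prod.smul_fst, qsmul_dual]
    exact hp.smul _

/-- Representability is essential: `sharp` takes a default value elsewhere and is not additive on
the full dual. -/
theorem untwistRoot_add {p q : Module.Dual ℝ t₀ × ℝ} (hp : IsRepresentable t₀ p.1)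
    (hq : IsRepresentable t₀ q.1) :
    untwistRoot t₀ μ N N' (p + q) = untwistRoot t₀ μ N N' p + untwistRoot t₀ μ N N' q := by
  refine Prod.ext rfl ?_
  simp only [untwistRoot, Prod.fst_add, Prod.snd_add, sharp_add hp hq, map_add]
  ring

theorem untwistRoot_smul (c : ℚ) {p : Module.Dual ℝ t₀ × ℝ} (hp : IsRepresentable t₀ p.1) :
    untwistRoot t₀ μ N N' (c • p) = c • untwistRoot t₀ μ N N' p := by
  refine Prod.ext rfl ?_
  simp only [untwistRoot, Prod.smul_fst, Prod.smul_snd, qsmul_dual, sharp_smul _ hp, map_smul,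
    smul_eq_mul, Rat.smul_def]
  ring

/-- On the rational span of the roots all functionals are representable, so the relabelling is
linear there. It leaves the first coordinate unchanged, and the form depends on nothing else. -/
theorem isRootSystemIso_untwistRoot (hN : N ≠ 0) (hN' : N' ≠ 0)
    {R R' : Set (Module.Dual ℝ t₀ × ℝ)} (hR : ∀ p ∈ R, IsRepresentable t₀ p.1)
    (hb : Set.BijOn (untwistRoot t₀ μ N N') R R') :
    IsRootSystemIso t₀ R R' (untwistRoot t₀ μ N N') := by
  have hrep := fun v : Submodule.span ℚ R => isRepresentable_of_mem_span hR v.2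
  have hmem : ∀ v ∈ Submodule.span ℚ R, untwistRoot t₀ μ N N' v ∈ Submodule.span ℚ R' := by
    intro v hv
    induction hv using Submodule.span_induction with
    | mem p hp => exact Submodule.subset_span (hb.mapsTo hp)
    | zero =>
      have e : untwistRoot t₀ μ N N' 0 = 0 := by
        simp [untwistRoot, sharp_zero]
      rw [e]
      exact Submodule.zero_mem _
    | add p q hp' hq' hp hq =>
      rw [untwistRoot_add (hrep ⟨p, hp'⟩) (hrep ⟨q, hq'⟩)]
      exact Submodule.add_mem _ hp hq
    | smul c p hp' hp =>
      rw [untwistRoot_smul c (hrep ⟨p, hp'⟩)]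
      exact Submodule.smul_mem _ c hp
  let f : Submodule.span ℚ R →ₗ[ℚ] Submodule.span ℚ R' :=
    { toFun := fun v => ⟨untwistRoot t₀ μ N N' v, hmem v v.2⟩
      map_add' := fun v w => Subtype.ext (untwistRoot_add (hrep v) (hrep w))
      map_smul' := fun c v => Subtype.ext (untwistRoot_smul c (hrep v)) }
  have hinj : Function.Injective f := fun v w h =>
    Subtype.ext (untwistRoot_injective hN hN' (congrArg Subtype.val h))
  have hsurj : Function.Surjective f := by
    rintro ⟨w, hw⟩
    induction hw using Submodule.span_induction with
    | mem q hq =>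
      obtain ⟨p, hp, rfl⟩ := hb.surjOn hq
      exact ⟨⟨p, Submodule.subset_span hp⟩, rfl⟩
    | zero => exact ⟨0, map_zero f⟩
    | add p q hp' hq' hp hq =>
      obtain ⟨v, hv⟩ := hp
      obtain ⟨w, hw⟩ := hq
      exact ⟨v + w, by rw [map_add, hv, hw]; rfl⟩
    | smul c p hp' hp =>
      obtain ⟨v, hv⟩ := hp
      exact ⟨c • v, by rw [map_smul, hv]; rfl⟩
  refine ⟨LinearEquiv.ofBijective f ⟨hinj, hsurj⟩, fun v _ => rfl, fun v => ⟨fun hv => ?_,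
    fun hv => ?_⟩, fun v w => rfl⟩
  · exact hb.mapsTo hv
  · obtain ⟨p, hp, e⟩ := hb.surjOn hv
    have e' : p = v := untwistRoot_injective hN hN' e
    rwa [← e']

end RootSystems

/-! ### Finite-dimensional invariant subspaces are spanned by weight vectors -/

section FiniteDimensionalInvariant

variable {k : Type*} [HilbertLieAlgebra k] {t₀ : LieSubalgebra ℝ k}

/-- A joint eigenvector of all products of two adjoint operators is the real part of a weight
vector. -/
theorem exists_isWeightPair (hab : ∀ x ∈ t₀, ∀ y ∈ t₀, ⁅x, y⁆ = 0) {v : k} (hv : v ≠ 0)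
    {χ : t₀ × t₀ → ℝ} (hχ : ∀ p : t₀ × t₀, ⁅(p.1 : k), ⁅(p.2 : k), v⁆⁆ = χ p • v) :
    ∃ a y, IsWeightPair t₀ a v y := by
  by_cases h0 : ∀ h : t₀, ⁅(h : k), v⁆ = 0
  · exact ⟨0, 0, fun h => by simp [h0 h]⟩
  · push Not at h0
    obtain ⟨h₁, hne⟩ := h0
    have hv' : 0 < ‖v‖ ^ 2 := pow_pos (norm_pos_iff.2 hv) 2
    have hw' : 0 < ‖⁅(h₁ : k), v⁆‖ ^ 2 := pow_pos (norm_pos_iff.2 hne) 2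
    have hinner : ∀ h : t₀, ⟪⁅(h : k), ⁅(h₁ : k), v⁆⁆, v⟫_ℝ = χ (h, h₁) * ‖v‖ ^ 2 := by
      intro h
      rw [hχ (h, h₁), real_inner_smul_left, real_inner_self_eq_norm_sq]
    have hneg : χ (h₁, h₁) < 0 := by
      have e := hinner h₁
      rw [inner_lie_left, real_inner_self_eq_norm_sq] at e
      by_contra! hc
      have := mul_nonneg hc hv'.le
      linarith
    -- `s` is the value the weight will take at `h₁`: the eigenvalue of `(ad h₁)²` is minus its
    -- square. The imaginary part is then forced to be `-s⁻¹ [h₁, v]`.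
    set s := √(-χ (h₁, h₁)) with hs
    have hs0 : 0 < s := Real.sqrt_pos.2 (by linarith)
    have hs2 : s * s = -χ (h₁, h₁) := Real.mul_self_sqrt (by linarith)
    let a : Module.Dual ℝ t₀ :=
      { toFun := fun h => -((s * ‖v‖ ^ 2)⁻¹ * ⟪⁅(h : k), ⁅(h₁ : k), v⁆⁆, v⟫_ℝ)
        map_add' := fun x y => by
          change -((s * ‖v‖ ^ 2)⁻¹ * ⟪⁅(x : k) + (y : k), ⁅(h₁ : k), v⁆⁆, v⟫_ℝ) = _
          rw [add_lie, inner_add_left]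
          ring
        map_smul' := fun c x => by
          change -((s * ‖v‖ ^ 2)⁻¹ * ⟪⁅c • (x : k), ⁅(h₁ : k), v⁆⁆, v⟫_ℝ) = _
          rw [smul_lie, real_inner_smul_left, RingHom.id_apply, smul_eq_mul]
          ring }
    have ha : ∀ h, a h = -(s⁻¹ * χ (h, h₁)) := by
      intro h
      change -((s * ‖v‖ ^ 2)⁻¹ * ⟪⁅(h : k), ⁅(h₁ : k), v⁆⁆, v⟫_ℝ) = _
      rw [hinner]
      field_simp
    refine ⟨a, -(s⁻¹ • ⁅(h₁ : k), v⁆), fun h => ⟨?_, ?_⟩⟩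
    · have e1 : ⁅(h₁ : k), ⁅(h : k), ⁅(h₁ : k), v⁆⁆⁆ = ⁅(h : k), ⁅(h₁ : k), ⁅(h₁ : k), v⁆⁆⁆ := by
        rw [leibniz_lie, hab _ h₁.2 _ h.2, zero_lie, zero_add]
      rw [hχ (h, h₁), hχ (h₁, h₁), lie_smul, lie_smul] at e1
      have e2 : ⁅(h : k), v⁆ = (χ (h₁, h₁))⁻¹ • χ (h, h₁) • ⁅(h₁ : k), v⁆ := by
        rw [e1, smul_smul, inv_mul_cancel₀ hneg.ne, one_smul]
      have e3 : χ (h₁, h₁) = -(s * s) := by linarith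
      rw [e2, ha, smul_neg, smul_smul, smul_smul, e3]
      simp only [neg_smul, neg_neg, inv_neg, neg_mul, mul_inv]
      congr 2
      ring
    · rw [lie_neg, lie_smul, hχ (h, h₁), ha, smul_smul, neg_smul]

/-- A single `ad h` is skew and need not have real eigenvectors, but the products `ad h ad h'` form
a commuting family of symmetric operators, which is simultaneously diagonalisable over the reals. -/
theorem le_span_isWeightPair (hab : ∀ x ∈ t₀, ∀ y ∈ t₀, ⁅x, y⁆ = 0) (E : Submodule ℝ k)
    [FiniteDimensional ℝ E] (hE : ∀ h ∈ t₀, ∀ x ∈ E, ⁅h, x⁆ ∈ E) :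
    E ≤ Submodule.span ℝ {x : k | ∃ a y, IsWeightPair t₀ a x y} := by
  let ad : t₀ → k →ₗ[ℝ] k := fun h => (lieCLM k h : k →ₗ[ℝ] k)
  have hadE : ∀ p : t₀ × t₀, ∀ x ∈ E, (ad p.1 ∘ₗ ad p.2) x ∈ E := fun p x hx =>
    hE _ p.1.2 _ (hE _ p.2.2 _ hx)
  let A : t₀ × t₀ → E →ₗ[ℝ] E := fun p => (ad p.1 ∘ₗ ad p.2).restrict (hadE p)
  have hA : ∀ p x, ((A p x : E) : k) = ⁅(p.1 : k), ⁅(p.2 : k), (x : k)⁆⁆ := fun p x => rfl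
  have hcomm : ∀ (h h' : t₀) (x : k), ⁅(h : k), ⁅(h' : k), x⁆⁆ = ⁅(h' : k), ⁅(h : k), x⁆⁆ := by
    intro h h' x
    rw [leibniz_lie, hab _ h.2 _ h'.2, zero_lie, zero_add]
  have hsymm : ∀ p, (A p).IsSymmetric := by
    intro p x y
    rw [Submodule.coe_inner, Submodule.coe_inner, hA, hA, inner_lie_left, inner_lie_left, neg_neg,
      hcomm]
  have hpair : Pairwise (Function.onFun Commute A) := by
    intro p q _
    refine LinearMap.ext fun x => Subtype.ext ?_
    rw [Module.End.mul_apply, Module.End.mul_apply, hA, hA, hA, hA, hcomm p.2 q.1, hcomm p.2 q.2,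
      hcomm p.1 q.1, hcomm p.1 q.2]
  have htop := LinearMap.IsSymmetric.iSup_iInf_eq_top_of_commute hsymm hpair
  have key : ∀ x ∈ (⨆ χ : t₀ × t₀ → ℝ, ⨅ p, Module.End.eigenspace (A p) (χ p)),
      (x : k) ∈ Submodule.span ℝ {x : k | ∃ a y, IsWeightPair t₀ a x y} := by
    intro x hx
    have hle : (⨆ χ : t₀ × t₀ → ℝ, ⨅ p, Module.End.eigenspace (A p) (χ p)) ≤
        (Submodule.span ℝ {x : k | ∃ a y, IsWeightPair t₀ a x y}).comap E.subtype := by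
      refine iSup_le fun χ v hv => ?_
      change (v : k) ∈ Submodule.span ℝ {x : k | ∃ a y, IsWeightPair t₀ a x y}
      by_cases hv0 : (v : k) = 0
      · rw [hv0]
        exact Submodule.zero_mem _
      · refine Submodule.subset_span (exists_isWeightPair hab hv0 (χ := χ) fun p => ?_)
        have e := Module.End.mem_eigenspace_iff.1
          ((Submodule.mem_iInf (fun p => Module.End.eigenspace (A p) (χ p))).1 hv p)
        exact congrArg Subtype.val e
    exact hle hx
  intro x hx
  exact key ⟨x, hx⟩ (by rw [htop]; exact Submodule.mem_top)

end FiniteDimensionalInvariant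

/-! ### Skew-adjoint Hilbert--Schmidt operators are compact -/

section Compact

variable {K H : Type*} [Ring K] [Algebra ℝ K] [NormedAddCommGroup H]
  [InnerProductSpace ℝ H] [CompleteSpace H] [Module K H] [IsScalarTower ℝ K H]

/-- The truncations of `x` to finitely many output coordinates have finite rank and converge in
norm: the error is bounded by the tail of the series of the Hilbert-Schmidt norm. -/
theorem U2.isCompactOperator_op (x : U2 K H) : IsCompactOperator (U2.op x) := by
  let e := hBasis H
  let F : Finset (basisIndex H) → H →L[ℝ] H := fun s =>
    ∑ i ∈ s, (ContinuousLinearMap.toSpanSingleton ℝ (e i)) ∘L ((innerSL ℝ (e i)) ∘L U2.op x)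
  have hF : ∀ s v, F s v = ∑ i ∈ s, ⟪e i, U2.op x v⟫_ℝ • e i := by
    intro s v
    simp [F]
  have hFc : ∀ s, IsCompactOperator (F s) := by
    intro s
    have : F s ∈ compactOperator (RingHom.id ℝ) H H := by
      refine Submodule.sum_mem _ fun i _ => ?_
      change IsCompactOperator _
      have hc : IsCompactOperator ((innerSL ℝ (e i)) ∘L U2.op x : H →L[ℝ] ℝ) :=
        isCompactOperator_of_locallyCompactSpace_dom
          ((innerSL ℝ (e i)) ∘L U2.op x : H →L[ℝ] ℝ)
      exact hc.clm_comp (ContinuousLinearMap.toSpanSingleton ℝ (e i))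
    exact this
  set f : basisIndex H → ℝ := fun i => ‖U2.op x (e i)‖ ^ 2 with hf
  have hs : Summable f := U2.op_hs x
  have hbound : ∀ s v, ‖U2.op x v - F s v‖ ^ 2 ≤ (∑' i, f i - ∑ i ∈ s, f i) * ‖v‖ ^ 2 := by
    classical
    intro s v
    set u := U2.op x v - F s v with hu
    have h1 := e.hasSum_inner_mul_inner u u
    rw [real_inner_self_eq_norm_sq] at h1
    have h2 : HasSum (fun i => f i - if i ∈ s then f i else 0) (∑' i, f i - ∑ i ∈ s, f i) := by
      refine hs.hasSum.sub ?_
      have := hasSum_sum_of_ne_finset_zero (L := .unconditional _) (f := fun i => if i ∈ s then f i else 0) (s := s)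
        (fun i hi => by simp [hi])
      rwa [Finset.sum_congr rfl fun i hi => if_pos hi] at this
    refine hasSum_le (fun j => ?_) h1 (h2.mul_right (‖v‖ ^ 2))
    have hj : ⟪e j, u⟫_ℝ = if j ∈ s then 0 else ⟪e j, U2.op x v⟫_ℝ := by
      rw [hu, hF, inner_sub_right, inner_sum]
      simp_rw [real_inner_smul_right]
      have ho : ∀ i, ⟪e j, e i⟫_ℝ = if j = i then 1 else 0 :=
        fun i => orthonormal_iff_ite.1 e.orthonormal j i
      simp_rw [ho]
      by_cases hjs : j ∈ s <;> simp [hjs]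
    have hj' : ⟪u, e j⟫_ℝ = if j ∈ s then 0 else ⟪e j, U2.op x v⟫_ℝ := by
      rw [real_inner_comm, hj]
    rw [hj', hj]
    by_cases hjs : j ∈ s
    · simp [hjs]
    · simp only [hjs, if_false, sub_zero]
      -- Skewness turns output coordinates of `x v` into pairings with `x (e j)`, whose squared
      -- norms are summable.
      have e1 : ⟪e j, U2.op x v⟫_ℝ = -⟪U2.op x (e j), v⟫_ℝ := by
        rw [(U2.op_skew x).2, neg_neg]
      rw [e1, neg_mul_neg, ← sq, hf, ← mul_pow]
      exact sq_le_sq' (abs_le.1 (abs_real_inner_le_norm _ _)).1 (real_inner_le_norm _ _)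
  have htend : Filter.Tendsto F Filter.atTop (nhds (U2.op x)) := by
    rw [tendsto_iff_norm_sub_tendsto_zero]
    have h1 : Filter.Tendsto (fun s => √(∑' i, f i - ∑ i ∈ s, f i)) Filter.atTop (nhds 0) := by
      have h2 : Filter.Tendsto (fun s => ∑' i, f i - ∑ i ∈ s, f i) Filter.atTop
          (nhds (∑' i, f i - ∑' i, f i)) := tendsto_const_nhds.sub hs.hasSum
      rw [sub_self] at h2
      have h3 := (Real.continuous_sqrt.tendsto 0).comp h2
      rwa [Real.sqrt_zero] at h3
    refine squeeze_zero (fun _ => norm_nonneg _) (fun s => ?_) h1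
    refine ContinuousLinearMap.opNorm_le_bound _ (Real.sqrt_nonneg _) fun v => ?_
    rw [_root_.sub_apply, norm_sub_rev]
    have hnn : 0 ≤ ∑' i, f i - ∑ i ∈ s, f i :=
      sub_nonneg.2 (hs.sum_le_tsum s fun i _ => sq_nonneg _)
    refine (sq_le_sq₀ (norm_nonneg _) (by positivity)).1 ?_
    rw [mul_pow, Real.sq_sqrt hnn]
    exact hbound s v
  exact isCompactOperator_of_tendsto htend (Filter.Eventually.of_forall hFc)

end Compact

/-! ### The scalars -/

/-- A finite family of scalars that is an orthonormal basis with respect to the form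
`(c, d) ↦ r(c^* d)`, where `r` is the real part. -/
structure ScalarData (K : Type*) [Ring K] [StarRing K] [Algebra ℝ K] where
  /-- The number of basis elements. -/
  n : ℕ
  /-- The basis. -/
  b : Fin n → K
  /-- The real part. -/
  r : K →ₗ[ℝ] ℝ
  r_star : ∀ c, r (star c) = r c
  add_star : ∀ c, c + star c = (2 * r c) • (1 : K)
  sum_smul : ∀ c, ∑ i, r (star (b i) * c) • b i = c

/-- Scalar data for the real numbers. -/
def ScalarData.real : ScalarData ℝ where
  n := 1
  b := fun _ => 1
  r := LinearMap.id
  r_star := fun c => by simp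
  add_star := fun c => by simp; ring
  sum_smul := fun c => by simp

/-- Scalar data for the complex numbers. -/
noncomputable def ScalarData.complex : ScalarData ℂ where
  n := 2
  b := ![1, Complex.I]
  r := Complex.reLm
  r_star := fun c => by simp
  add_star := fun c => by
    apply Complex.ext <;> simp; ring
  sum_smul := fun c => by
    apply Complex.ext <;> simp [Fin.sum_univ_two]

/-- The real part of a quaternion. -/
noncomputable def quaternionRe : ℍ[ℝ] →ₗ[ℝ] ℝ where
  toFun c := c.re
  map_add' _ _ := rfl
  map_smul' _ _ := rfl

theorem quaternionRe_apply (c : ℍ[ℝ]) : quaternionRe c = c.re := rfl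

/-- Scalar data for the quaternions. -/
noncomputable def ScalarData.quaternion : ScalarData ℍ[ℝ] where
  n := 4
  b := ![1, ⟨0, 1, 0, 0⟩, ⟨0, 0, 1, 0⟩, ⟨0, 0, 0, 1⟩]
  r := quaternionRe
  r_star := fun c => by simp [quaternionRe_apply]
  add_star := fun c => by
    apply QuaternionAlgebra.ext <;> simp [quaternionRe_apply]
    ring
  sum_smul := fun c => by
    apply QuaternionAlgebra.ext <;> simp [Fin.sum_univ_four, quaternionRe_apply]
    · change c.re + c.imI * 0 + c.imJ * 0 + c.imK * 0 = c.re
      ring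
    · change c.imI * 1 + c.imJ * 0 + c.imK * 0 = c.imI
      ring
    · change c.imI * 0 + c.imJ * 1 + c.imK * 0 = c.imJ
      ring
    · change c.imI * 0 + c.imJ * 0 + c.imK * 1 = c.imK
      ring

/-- Transport of scalar data along an isomorphism. -/
def ScalarData.transport {K K' : Type*} [Ring K] [StarRing K] [Algebra ℝ K] [Ring K']
    [StarRing K'] [Algebra ℝ K'] (d : ScalarData K') (e : K ≃⋆ₐ[ℝ] K') : ScalarData K where
  n := d.n
  b := fun i => e.symm (d.b i)
  r :=
    { toFun := fun c => d.r (e c)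
      map_add' := fun x y => by rw [map_add, map_add]
      map_smul' := fun c x => by rw [map_smul, map_smul]; rfl }
  r_star := fun c => by
    change d.r (e (star c)) = d.r (e c)
    rw [map_star, d.r_star]
  add_star := fun c => by
    apply e.injective
    change e (c + star c) = e ((2 * d.r (e c)) • (1 : K))
    rw [map_add, map_star, d.add_star, map_smul, map_one]
  sum_smul := fun c => by
    apply e.injective
    refine Eq.trans ?_ (d.sum_smul (e c))
    change e (∑ i, d.r (e (star (e.symm (d.b i)) * c)) • e.symm (d.b i)) = _
    rw [map_sum]
    refine Finset.sum_congr rfl fun i _ => ?_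
    change e (d.r (e (star (e.symm (d.b i)) * c)) • e.symm (d.b i)) = _
    rw [map_smul, map_mul, map_star, StarAlgEquiv.apply_symm_apply]

theorem nonempty_scalarData {K : Type*} [Ring K] [StarRing K] [Algebra ℝ K]
    (hK : Nonempty (K ≃⋆ₐ[ℝ] ℝ) ∨ Nonempty (K ≃⋆ₐ[ℝ] ℂ) ∨ Nonempty (K ≃⋆ₐ[ℝ] ℍ[ℝ])) :
    Nonempty (ScalarData K) := by
  rcases hK with ⟨⟨e⟩⟩ | ⟨⟨e⟩⟩ | ⟨⟨e⟩⟩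
  · exact ⟨ScalarData.real.transport e⟩
  · exact ⟨ScalarData.complex.transport e⟩
  · exact ⟨ScalarData.quaternion.transport e⟩

/-! ### Finite-dimensional subspaces and orthogonal projections -/

section Projections

variable {K H : Type*} [Ring K] [StarRing K] [Algebra ℝ K] [NormedAddCommGroup H]
  [InnerProductSpace ℝ H] [Module K H] [IsScalarTower ℝ K H]

theorem inner_smul_self [IsHilbertOver K H] (d : ScalarData K) (c : K) (v : H) :
    ⟪v, c • v⟫_ℝ = d.r c * ‖v‖ ^ 2 := by
  have e1 : ⟪v, c • v⟫_ℝ = ⟪v, star c • v⟫_ℝ := by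
    rw [real_inner_comm, IsHilbertOver.inner_smul]
  have e2 : ⟪v, (c + star c) • v⟫_ℝ = 2 * d.r c * ‖v‖ ^ 2 := by
    rw [d.add_star, smul_assoc, one_smul, real_inner_smul_right, real_inner_self_eq_norm_sq]
  rw [add_smul, inner_add_right, ← e1] at e2
  linarith

/-- The scalar multiples of a vector lie in a finite-dimensional subspace. -/
theorem ScalarData.exists_finiteDimensional (d : ScalarData K) (S : Finset H) :
    ∃ F : Submodule ℝ H, FiniteDimensional ℝ F ∧ ∀ v ∈ S, ∀ c : K, c • v ∈ F := by
  classical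
  refine ⟨Submodule.span ℝ (Finset.univ.biUnion fun i => S.image fun v => d.b i • v : Finset H),
    FiniteDimensional.span_finset ℝ _, fun v hv c => ?_⟩
  rw [← d.sum_smul c, Finset.sum_smul]
  refine Submodule.sum_mem _ fun i _ => ?_
  rw [smul_assoc]
  refine Submodule.smul_mem _ _ (Submodule.subset_span ?_)
  simp only [Finset.coe_biUnion, Finset.coe_image, Set.mem_iUnion]
  exact ⟨i, by simp, v, hv, rfl⟩

variable [CompleteSpace H]

/-- `‖P v‖²` is a finite sum of squared coordinates of `v` along `F`, and each of these is summable
over the basis by Parseval. -/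
theorem isHilbertSchmidt_starProjection (F : Submodule ℝ H) [FiniteDimensional ℝ F] :
    IsHilbertSchmidt F.starProjection := by
  let g := stdOrthonormalBasis ℝ F
  have e : ∀ v, ‖F.starProjection v‖ ^ 2 = ∑ j, ⟪v, (g j : H)⟫_ℝ ^ 2 := by
    intro v
    have e1 := g.sum_sq_norm_inner_right (F.orthogonalProjectionOnto v)
    rw [Submodule.starProjection_apply, ← Submodule.coe_norm, ← e1]
    refine Finset.sum_congr rfl fun j _ => ?_
    rw [Real.norm_eq_abs, sq_abs, Submodule.coe_inner, real_inner_comm]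
    congr 1
    exact Submodule.inner_orthogonalProjectionOnto_eq_of_mem_right (g j) v
  have hs : ∀ v : H, Summable fun i => ⟪hBasis H i, v⟫_ℝ ^ 2 := by
    intro v
    have := (hBasis H).summable_inner_mul_inner v v
    refine this.congr fun i => ?_
    rw [real_inner_comm v, sq]
  refine (summable_sum (s := Finset.univ) fun j _ => hs (g j)).congr fun i => ?_
  rw [e]

theorem infinite_basisIndex (hH : ¬ FiniteDimensional ℝ H) : Infinite (basisIndex H) := by
  by_contra hc
  rw [not_infinite_iff_finite] at hc
  have := Fintype.ofFinite (basisIndex H)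
  exact hH (Module.Finite.of_basis (hBasis H).toOrthonormalBasis.toBasis)

/-- A Hilbert--Schmidt operator on an infinite-dimensional space is arbitrarily small on suitable
unit vectors orthogonal to a given finite-dimensional subspace. -/
theorem IsHilbertSchmidt.exists_norm_lt (hH : ¬ FiniteDimensional ℝ H) {x : H →L[ℝ] H}
    (hx : IsHilbertSchmidt x) (F : Submodule ℝ H) [FiniteDimensional ℝ F] {ε : ℝ} (hε : 0 < ε) :
    ∃ u ∈ Fᗮ, ‖u‖ = 1 ∧ ‖x u‖ < ε := by
  have := infinite_basisIndex hH
  have hlim : ∀ y : H →L[ℝ] H, IsHilbertSchmidt y → ∀ δ : ℝ, 0 < δ →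
      ∀ᶠ i in Filter.cofinite, ‖y (hBasis H i)‖ < δ := by
    intro y hy δ hδ
    have e := hy.tendsto_cofinite_zero.eventually (gt_mem_nhds (pow_pos hδ 2))
    exact e.mono fun i hi => lt_of_pow_lt_pow_left₀ 2 hδ.le hi
  -- The bound `1/2` keeps the component of a basis vector orthogonal to `F` of norm at least `1/2`;
  -- normalising then costs the factor `2` in the last condition.
  obtain ⟨δ, hδ, hδ1, hδ2⟩ : ∃ δ : ℝ, 0 < δ ∧ δ ≤ 1 / 2 ∧ 2 * (1 + ‖x‖) * δ < ε := by
    have hp : 0 < 2 * (1 + ‖x‖) := by positivity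
    refine ⟨min (1 / 2) (ε / (2 * (2 * (1 + ‖x‖)))), by positivity, min_le_left _ _, ?_⟩
    calc _ ≤ 2 * (1 + ‖x‖) * (ε / (2 * (2 * (1 + ‖x‖)))) :=
          mul_le_mul_of_nonneg_left (min_le_right _ _) hp.le
      _ = ε / 2 := by field_simp
      _ < ε := by linarith
  -- All but finitely many basis vectors are nearly annihilated both by `x` and by the projection to
  -- `F`.
  obtain ⟨i, hi1, hi2⟩ := ((hlim x hx δ hδ).and
    (hlim _ (isHilbertSchmidt_starProjection F) δ hδ)).exists
  set e := hBasis H i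
  have he : ‖e‖ = 1 := (hBasis H).orthonormal.1 i
  set w := e - F.starProjection e
  have hw : w ∈ Fᗮ := F.sub_starProjection_mem_orthogonal e
  have hwn : 1 / 2 ≤ ‖w‖ := by
    have := norm_sub_norm_le e (F.starProjection e)
    rw [he] at this
    linarith
  have hxw : ‖x w‖ ≤ (1 + ‖x‖) * δ := by
    change ‖x (e - F.starProjection e)‖ ≤ _
    rw [map_sub]
    have h2 := x.le_opNorm (F.starProjection e)
    have h3 : ‖x‖ * ‖F.starProjection e‖ ≤ ‖x‖ * δ :=
      mul_le_mul_of_nonneg_left hi2.le (norm_nonneg _)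
    have := norm_sub_le (x e) (x (F.starProjection e))
    linarith
  have hw0 : 0 < ‖w‖ := by linarith
  refine ⟨‖w‖⁻¹ • w, Submodule.smul_mem _ _ hw, ?_, ?_⟩
  · rw [norm_smul, norm_inv, norm_norm, inv_mul_cancel₀ hw0.ne']
  · rw [map_smul, norm_smul, norm_inv, norm_norm]
    have : ‖w‖⁻¹ ≤ 2 := by
      rw [inv_le_comm₀ hw0 two_pos]
      linarith
    calc ‖w‖⁻¹ * ‖x w‖ ≤ 2 * ((1 + ‖x‖) * δ) := by gcongr
      _ < ε := by linarith

end Projections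

/-! ### Invariant finite-dimensional subspaces and compressions -/

section Compression

section

variable {K H : Type*} [NormedAddCommGroup H] [InnerProductSpace ℝ H] {F : Submodule ℝ H}

/-- A skew operator preserving `F` also preserves its orthogonal complement. -/
theorem starProjection_apply_of_skew [FiniteDimensional ℝ F] {x : H →L[ℝ] H}
    (hx : ∀ v w, ⟪x v, w⟫_ℝ = -⟪v, x w⟫_ℝ) (hF : ∀ v ∈ F, x v ∈ F) (v : H) :
    F.starProjection (x v) = x (F.starProjection v) := by
  refine Submodule.eq_starProjection_of_mem_orthogonal (hF _ (Submodule.starProjection_apply_mem F v))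
    ?_
  rw [← map_sub, Submodule.mem_orthogonal]
  intro u hu
  have e := (Submodule.mem_orthogonal _ _).1 (F.sub_starProjection_mem_orthogonal v) _ (hF u hu)
  rw [hx] at e
  linarith

theorem starProjection_smul_of_mem [Ring K] [StarRing K] [Module K H] [IsHilbertOver K H]
    [FiniteDimensional ℝ F] (hF : ∀ (c : K), ∀ v ∈ F, c • v ∈ F)
    (c : K) (v : H) : F.starProjection (c • v) = c • F.starProjection v := by
  refine Submodule.eq_starProjection_of_mem_orthogonal (hF c _ (Submodule.starProjection_apply_mem F v))
    ?_
  rw [← smul_sub, Submodule.mem_orthogonal]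
  intro u hu
  have e := (Submodule.mem_orthogonal _ _).1 (F.sub_starProjection_mem_orthogonal v) _
    (hF (star c) u hu)
  rw [IsHilbertOver.inner_smul, star_star] at e
  exact e

theorem inner_starProjection [FiniteDimensional ℝ F] (v w : H) :
    ⟪F.starProjection v, w⟫_ℝ = ⟪v, F.starProjection w⟫_ℝ :=
  Submodule.inner_starProjection_left_eq_right F v w

theorem starProjection_idem [FiniteDimensional ℝ F] (v : H) :
    F.starProjection (F.starProjection v) = F.starProjection v :=
  Submodule.starProjection_eq_self_iff.2 (Submodule.starProjection_apply_mem F v)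

end

variable {K H : Type*} [Ring K] [StarRing K] [Algebra ℝ K] [NormedAddCommGroup H]
  [InnerProductSpace ℝ H] [CompleteSpace H] [Module K H] [IsScalarTower ℝ K H]
  [IsHilbertOver K H] {t : LieSubalgebra ℝ (U2 K H)} {F F' : Submodule ℝ H}

/-- `F` is a finite-dimensional `K`-subspace of `H` that is invariant under `t`. -/
structure IsInvariantSubspace (t : LieSubalgebra ℝ (U2 K H)) (F : Submodule ℝ H) : Prop where
  finite : FiniteDimensional ℝ F
  smul_mem : ∀ (c : K), ∀ v ∈ F, c • v ∈ F
  op_mem : ∀ h ∈ t, ∀ v ∈ F, U2.op h v ∈ F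

theorem IsInvariantSubspace.sup (hF : IsInvariantSubspace t F) (hF' : IsInvariantSubspace t F') :
    IsInvariantSubspace t (F ⊔ F') := by
  have := hF.finite
  have := hF'.finite
  refine ⟨inferInstance, fun c v hv => ?_, fun h hh v hv => ?_⟩
  · obtain ⟨x, hx, y, hy, rfl⟩ := Submodule.mem_sup.1 hv
    rw [smul_add]
    exact Submodule.add_mem_sup (hF.smul_mem c x hx) (hF'.smul_mem c y hy)
  · obtain ⟨x, hx, y, hy, rfl⟩ := Submodule.mem_sup.1 hv
    rw [map_add]
    exact Submodule.add_mem_sup (hF.op_mem h hh x hx) (hF'.op_mem h hh y hy)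

theorem compress_mem [FiniteDimensional ℝ F] (hF : ∀ (c : K), ∀ v ∈ F, c • v ∈ F) (x : U2 K H) :
    F.starProjection * U2.op x * F.starProjection ∈ u2 K H := by
  refine ⟨⟨fun c v => ?_, fun v w => ?_⟩, (isHilbertSchmidt_starProjection F).comp_left _⟩
  · simp only [mul_apply_eq_comp]
    rw [starProjection_smul_of_mem hF, (U2.op_skew x).1, starProjection_smul_of_mem hF]
  · simp only [mul_apply_eq_comp]
    rw [inner_starProjection, (U2.op_skew x).2, inner_starProjection]

/-- The compression of an operator to a finite-dimensional `K`-subspace. -/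
noncomputable def compress (F : Submodule ℝ H) [FiniteDimensional ℝ F]
    (hF : ∀ (c : K), ∀ v ∈ F, c • v ∈ F) : U2 K H →ₗ[ℝ] U2 K H where
  toFun x := ⟨_, compress_mem hF x⟩
  map_add' x y := U2.op_ext fun v => by
    change F.starProjection ((U2.op x + U2.op y) (F.starProjection v)) =
      F.starProjection (U2.op x (F.starProjection v)) + F.starProjection (U2.op y (F.starProjection v))
    rw [_root_.add_apply, map_add]
  map_smul' c x := U2.op_ext fun v => by
    change F.starProjection ((c • U2.op x) (F.starProjection v)) =
      c • F.starProjection (U2.op x (F.starProjection v))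
    rw [_root_.smul_apply, map_smul]

section

variable [FiniteDimensional ℝ F] (hF : ∀ (c : K), ∀ v ∈ F, c • v ∈ F)

theorem op_compress (x : U2 K H) (v : H) :
    U2.op (compress F hF x) v = F.starProjection (U2.op x (F.starProjection v)) := rfl

/-- `h` commutes with the projection to `F`. So compression commutes with `ad h` and preserves
weight spaces. -/
theorem lie_compress {h : U2 K H} (hh : ∀ v ∈ F, U2.op h v ∈ F) (x : U2 K H) :
    ⁅h, compress F hF x⁆ = compress F hF ⁅h, x⁆ := by
  have e := starProjection_apply_of_skew (U2.op_skew h).2 hh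
  refine U2.op_ext fun v => ?_
  rw [U2.op_lie_apply, op_compress, op_compress, op_compress, U2.op_lie_apply, map_sub, e, e]

theorem IsWeightPair.compress (hh : ∀ h ∈ t, ∀ v ∈ F, U2.op h v ∈ F) {a : Module.Dual ℝ t}
    {x y : U2 K H} (h : IsWeightPair t a x y) :
    IsWeightPair t a (compress F hF x) (compress F hF y) := fun z => by
  rw [lie_compress hF (hh z z.2), lie_compress hF (hh z z.2), (h z).1, (h z).2, map_neg, map_smul,
    map_smul]
  exact ⟨rfl, rfl⟩

/-- Compression is an orthogonal projection of `u₂(H)`. The consequence used later is that an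
element orthogonal to its own compression has zero compression. -/
theorem inner_compress (x : U2 K H) : ⟪x, compress F hF x⟫_ℝ = ‖compress F hF x‖ ^ 2 := by
  set P := F.starProjection with hP
  have hPP : ∀ v, P (P v) = P v := starProjection_idem
  have hPs : ∀ v w, ⟪P v, w⟫_ℝ = ⟪v, P w⟫_ℝ := inner_starProjection
  have hPhs : IsHilbertSchmidt P := isHilbertSchmidt_starProjection F
  rw [← real_inner_self_eq_norm_sq, U2.inner_def, U2.inner_def]
  have e1 : trPair (U2.op x) (U2.op (compress F hF x)) =
      trPair (P * U2.op x) (U2.op (compress F hF x)) := by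
    refine tsum_congr fun i => ?_
    rw [mul_apply_eq_comp, hPs, op_compress, hPP]
  have e2 : trPair (P * U2.op x) (U2.op (compress F hF x)) =
      trPair (-(U2.op x * P)) (-U2.op (compress F hF x)) := by
    refine trPair_adjoint (fun v w => ?_) (fun v w => ?_) ((U2.op_hs x).comp_left P) ?_
      (U2.op_hs _) ?_
    · rw [mul_apply_eq_comp, _root_.neg_apply, mul_apply_eq_comp, hPs, inner_neg_right,
        (U2.op_skew x).2]
    · rw [_root_.neg_apply, inner_neg_right, (U2.op_skew _).2]
    · rw [← neg_mul]
      exact hPhs.comp_left _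
    · exact U2.op_hs (-compress F hF x)
  rw [e1, e2]
  refine tsum_congr fun i => ?_
  rw [_root_.neg_apply, _root_.neg_apply, inner_neg_neg, mul_apply_eq_comp, op_compress,
    hPs (U2.op x _), hPP]

theorem finiteDimensional_range_compress (x : U2 K H) :
    FiniteDimensional ℝ (LinearMap.range (U2.op (compress F hF x) : H →ₗ[ℝ] H)) := by
  refine Submodule.finiteDimensional_of_le (S₂ := F) ?_
  rintro _ ⟨v, rfl⟩
  exact Submodule.starProjection_apply_mem F _

/-- A compressed operator is determined by its action on `F`. -/
theorem finiteDimensional_range_compressMap :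
    FiniteDimensional ℝ (LinearMap.range (compress F hF)) := by
  let f : LinearMap.range (compress F hF) →ₗ[ℝ] (F →ₗ[ℝ] F) :=
    { toFun := fun x => F.orthogonalProjectionOnto.toLinearMap ∘ₗ
        (U2.op x.1 : H →ₗ[ℝ] H) ∘ₗ F.subtype
      map_add' := fun x y => LinearMap.ext fun v =>
        map_add F.orthogonalProjectionOnto (U2.op x.1 v) (U2.op y.1 v)
      map_smul' := fun c x => LinearMap.ext fun v =>
        map_smul F.orthogonalProjectionOnto c (U2.op x.1 v) }
  refine FiniteDimensional.of_injective f ?_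
  rintro ⟨_, x, rfl⟩ ⟨_, y, rfl⟩ hxy
  refine Subtype.ext (U2.op_ext fun v => ?_)
  have e := congrArg Subtype.val
    (LinearMap.congr_fun hxy ⟨F.starProjection v, Submodule.starProjection_apply_mem F v⟩)
  change F.starProjection (U2.op (compress F hF x) (F.starProjection v)) =
    F.starProjection (U2.op (compress F hF y) (F.starProjection v)) at e
  rwa [op_compress, op_compress, starProjection_idem, starProjection_idem,
    starProjection_idem] at e

end

theorem compress_mem_span (hab : ∀ x ∈ t, ∀ y ∈ t, ⁅x, y⁆ = 0) [FiniteDimensional ℝ F]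
    (hF : ∀ (c : K), ∀ v ∈ F, c • v ∈ F) (hh : ∀ h ∈ t, ∀ v ∈ F, U2.op h v ∈ F) (x : U2 K H) :
    compress F hF x ∈ Submodule.span ℝ {x : U2 K H | ∃ a y, IsWeightPair t a x y} := by
  have := finiteDimensional_range_compressMap hF
  refine le_span_isWeightPair hab (LinearMap.range (compress F hF)) ?_ ⟨x, rfl⟩
  rintro h ht _ ⟨y, rfl⟩
  exact ⟨⁅h, y⁆, (lie_compress hF (hh h ht) y).symm⟩

/-- The invariant finite-dimensional `K`-subspaces span a dense subspace of `H`. -/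
theorem eq_zero_of_forall_invariantSubspace (d : ScalarData K)
    (hab : ∀ x ∈ t, ∀ y ∈ t, ⁅x, y⁆ = 0) {w : H}
    (hw : ∀ F, IsInvariantSubspace t F → ∀ v ∈ F, ⟪w, v⟫_ℝ = 0) : w = 0 := by
  have hcomm : ∀ h ∈ t, ∀ h' ∈ t, ∀ v, U2.op h (U2.op h' v) = U2.op h' (U2.op h v) := by
    intro h hh h' hh' v
    have e := U2.op_lie_apply h h' v
    rw [hab h hh h' hh', U2.op_zero, _root_.zero_apply] at e
    exact (sub_eq_zero.1 e.symm)
  have hzero : ∀ h ∈ t, U2.op h w = 0 := by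
    intro h hh
    -- The square of a skew compact operator is symmetric and compact, so the real spectral theorem
    -- applies to it.
    set S : H →L[ℝ] H := U2.op h * U2.op h with hS
    have hSa : ∀ v, S v = U2.op h (U2.op h v) := fun _ => rfl
    have hsymm : S.IsSymmetric := by
      intro v u
      change ⟪S v, u⟫_ℝ = ⟪v, S u⟫_ℝ
      rw [hSa, hSa, (U2.op_skew h).2, (U2.op_skew h).2, neg_neg]
    have hcpt : IsCompactOperator S := by
      have := (U2.isCompactOperator_op h).clm_comp (U2.op h)
      exact this
    have hbot := ContinuousLinearMap.orthogonalComplement_iSup_eigenspaces_eq_bot hcpt hsymm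
    have hSw : S w = 0 := by
      rw [← Submodule.mem_bot ℝ, ← hbot, Submodule.mem_orthogonal]
      intro u hu
      -- Eigenspaces for nonzero eigenvalues are finite-dimensional invariant `K`-subspaces, hence
      -- orthogonal to `w`; the kernel of `S` is orthogonal to `S w` anyway.
      have hle : (⨆ μ, Module.End.eigenspace (S : H →ₗ[ℝ] H) μ) ≤ (Submodule.span ℝ {S w})ᗮ := by
        refine iSup_le fun μ v hv => ?_
        rw [Submodule.mem_orthogonal_singleton_iff_inner_right]
        have hv' : S v = μ • v := Module.End.mem_eigenspace_iff.1 hv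
        have e : ⟪S w, v⟫_ℝ = μ * ⟪w, v⟫_ℝ := by
          have := hsymm w v
          change ⟪S w, v⟫_ℝ = ⟪w, S v⟫_ℝ at this
          rw [this, hv', real_inner_smul_right]
        rw [e]
        by_cases hμ : μ = 0
        · rw [hμ, zero_mul]
        · refine mul_eq_zero_of_right _ (hw (Module.End.eigenspace (S : H →ₗ[ℝ] H) μ) ⟨?_, ?_, ?_⟩ v hv)
          · exact ContinuousLinearMap.finite_dimensional_eigenspace hcpt μ hμ
          · intro c u hu
            have hu' : S u = μ • u := Module.End.mem_eigenspace_iff.1 hu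
            refine Module.End.mem_eigenspace_iff.2 ?_
            change S (c • u) = μ • c • u
            rw [hSa, (U2.op_skew h).1, (U2.op_skew h).1, ← hSa, hu', smul_comm]
          · intro h' hh' u hu
            have hu' : S u = μ • u := Module.End.mem_eigenspace_iff.1 hu
            refine Module.End.mem_eigenspace_iff.2 ?_
            change S (U2.op h' u) = μ • U2.op h' u
            rw [hSa, hcomm h hh h' hh', hcomm h hh h' hh', ← hSa, hu', map_smul]
      have := hle hu
      rw [Submodule.mem_orthogonal_singleton_iff_inner_right] at this
      rw [real_inner_comm]
      exact this
    have e := (U2.op_skew h).2 w (U2.op h w)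
    rw [← hSa, hSw, inner_zero_right, neg_zero] at e
    exact inner_self_eq_zero.1 e
  obtain ⟨F₀, hF₀, hmem⟩ := d.exists_finiteDimensional ({w} : Finset H)
  -- As `w` is annihilated by all of `t`, the line `K w` is itself an invariant subspace, so `w` is
  -- orthogonal to itself.
  let G : Submodule ℝ H :=
    { carrier := {v | ∃ c : K, v = c • w}
      add_mem' := by
        rintro _ _ ⟨c, rfl⟩ ⟨c', rfl⟩
        exact ⟨c + c', (add_smul _ _ _).symm⟩
      zero_mem' := ⟨0, (zero_smul _ _).symm⟩
      smul_mem' := by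
        rintro r _ ⟨c, rfl⟩
        exact ⟨r • c, (smul_assoc _ _ _).symm⟩ }
  have hG : IsInvariantSubspace t G := by
    refine ⟨Submodule.finiteDimensional_of_le (S₂ := F₀) ?_, ?_, ?_⟩
    · rintro _ ⟨c, rfl⟩
      exact hmem w (by simp) c
    · rintro c _ ⟨c', rfl⟩
      exact ⟨c * c', (mul_smul _ _ _).symm⟩
    · rintro h hh _ ⟨c, rfl⟩
      rw [(U2.op_skew h).1, hzero h hh, smul_zero]
      exact G.zero_mem
  exact inner_self_eq_zero.1 (hw G hG w ⟨1, (one_smul K w).symm⟩)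

/-- An operator all of whose compressions to invariant subspaces vanish is zero. -/
theorem eq_zero_of_compress (d : ScalarData K) (hab : ∀ x ∈ t, ∀ y ∈ t, ⁅x, y⁆ = 0) {z : U2 K H}
    (hz : ∀ (F : Submodule ℝ H) [FiniteDimensional ℝ F] (hF : ∀ (c : K), ∀ v ∈ F, c • v ∈ F),
      (∀ h ∈ t, ∀ v ∈ F, U2.op h v ∈ F) → compress F hF z = 0) : z = 0 := by
  have h1 : ∀ F, IsInvariantSubspace t F → ∀ v ∈ F, U2.op z v = 0 := by
    intro F hF v hv
    refine eq_zero_of_forall_invariantSubspace d hab fun F' hF' w hw => ?_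
    -- The join contains both `v` and `w`, so vanishing of the compression to it gives `⟨z v, w⟩ =
    -- 0`.
    have hs := hF.sup hF'
    have := hs.finite
    have e := congrArg (fun x => U2.op x v) (hz (F ⊔ F') hs.smul_mem hs.op_mem)
    have hv' : (F ⊔ F').starProjection v = v :=
      Submodule.starProjection_eq_self_iff.2 (Submodule.mem_sup_left hv)
    have hw' : (F ⊔ F').starProjection w = w :=
      Submodule.starProjection_eq_self_iff.2 (Submodule.mem_sup_right hw)
    rw [op_compress, U2.op_zero, _root_.zero_apply, hv'] at e
    rw [← hw', ← inner_starProjection, e, inner_zero_left]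
  refine U2.op_ext fun v => ?_
  rw [U2.op_zero, _root_.zero_apply]
  refine eq_zero_of_forall_invariantSubspace d hab fun F hF w hw => ?_
  rw [(U2.op_skew z).2, h1 F hF w hw, inner_zero_right, neg_zero]

/-- The weight spaces of an abelian subalgebra of `u₂(H)` span a dense subspace. -/
theorem hasDenseWeights (d : ScalarData K) (hab : ∀ x ∈ t, ∀ y ∈ t, ⁅x, y⁆ = 0) :
    HasDenseWeights t := by
  intro z hz
  refine eq_zero_of_compress d hab fun F _ hF hh => ?_
  have hle : Submodule.span ℝ {x : U2 K H | ∃ a y, IsWeightPair t a x y} ≤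
      (Submodule.span ℝ {z})ᗮ := by
    refine Submodule.span_le.2 ?_
    rintro x ⟨a, y, h⟩
    exact Submodule.mem_orthogonal_singleton_iff_inner_right.2 (hz a x y h)
  -- The compression of `z` is a combination of real parts of weight vectors, so `z` is orthogonal
  -- to it.
  have e := Submodule.mem_orthogonal_singleton_iff_inner_right.1
    (hle (compress_mem_span hab hF hh z))
  rw [inner_compress] at e
  exact norm_eq_zero.1 (pow_eq_zero_iff two_ne_zero |>.1 e)

end Compression

/-! ### Orthogonality over the scalars -/

/-- The vectors `v` and `w` are orthogonal over `K`. -/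
def ScalarOrth (K : Type*) {H : Type*} [Ring K] [NormedAddCommGroup H] [InnerProductSpace ℝ H]
    [Module K H] (v w : H) : Prop := ∀ c : K, ⟪v, c • w⟫_ℝ = 0

namespace ScalarOrth

variable {K H : Type*} [Ring K] [NormedAddCommGroup H] [InnerProductSpace ℝ H] [Module K H]
  {v w : H}

theorem inner_eq (h : ScalarOrth K v w) : ⟪v, w⟫_ℝ = 0 := by
  rw [← one_smul K w]
  exact h 1

theorem inner_smul_left (h : ScalarOrth K v w) (c : K) : ⟪c • w, v⟫_ℝ = 0 := by
  rw [real_inner_comm]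
  exact h c

variable [StarRing K] [IsHilbertOver K H]

theorem symm (h : ScalarOrth K v w) : ScalarOrth K w v := fun c => by
  rw [real_inner_comm, IsHilbertOver.inner_smul]
  exact h _


end ScalarOrth

/-! ### Rank one operators over the scalars and unit vectors nearly annihilated by a given operator.
-/

section RankTwo

variable {K H : Type*} [Ring K] [StarRing K] [Algebra ℝ K] [NormedAddCommGroup H]
  [InnerProductSpace ℝ H] [Module K H]

variable (d : ScalarData K)

/-- The `K`-linear operator `u ↦ ∑ ⟨b_i w, u⟩ b_i v`. -/
noncomputable def rankOne (v w : H) : H →L[ℝ] H :=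
  ∑ i, ContinuousLinearMap.toSpanSingleton ℝ (d.b i • v) ∘L innerSL ℝ (d.b i • w)

theorem rankOne_apply (v w u : H) :
    rankOne d v w u = ∑ i, ⟪d.b i • w, u⟫_ℝ • d.b i • v := by
  simp [rankOne]

variable [IsScalarTower ℝ K H]

theorem ScalarData.exists_unit_orth [CompleteSpace H] (d : ScalarData K)
    (hH : ¬ FiniteDimensional ℝ H) (S : Finset H) (x : U2 K H) {ε : ℝ}
    (hε : 0 < ε) : ∃ u : H, ‖u‖ = 1 ∧ (∀ v ∈ S, ScalarOrth K u v) ∧ ‖U2.op x u‖ < ε := by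
  obtain ⟨F, hF, hS⟩ := d.exists_finiteDimensional S
  obtain ⟨u, hu, hu1, hxu⟩ := (U2.op_hs x).exists_norm_lt hH F hε
  exact ⟨u, hu1, fun v hv c => Submodule.inner_left_of_mem_orthogonal (hS v hv c) hu, hxu⟩

variable [IsHilbertOver K H]

theorem ScalarData.norm_smul_le (c : K) (v : H) : ‖c • v‖ ≤ √(d.r (star c * c)) * ‖v‖ := by
  have e : ‖c • v‖ ^ 2 = d.r (star c * c) * ‖v‖ ^ 2 := by
    rw [← real_inner_self_eq_norm_sq, IsHilbertOver.inner_smul, ← mul_smul, inner_smul_self d]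
  have e2 : √(‖c • v‖ ^ 2) = √(d.r (star c * c) * ‖v‖ ^ 2) := by rw [e]
  rw [Real.sqrt_sq (norm_nonneg _), Real.sqrt_mul' _ (sq_nonneg _),
    Real.sqrt_sq (norm_nonneg _)] at e2
  exact e2.le

variable [CompleteSpace H]

/-! ### Operators of rank two -/

/-- In the orthonormal basis `b`, left multiplication by `c` has matrix `r(b_i^* c b_j)`, and `star
c` has the transposed matrix. Moving `c` through the pairing and through the vectors `b_i v`
therefore gives the same double sum. -/
theorem rankOne_smul (v w : H) (c : K) (u : H) :
    rankOne d v w (c • u) = c • rankOne d v w u := by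
  have e1 : ∀ i, ⟪d.b i • w, c • u⟫_ℝ =
      ∑ j, d.r (star (d.b j) * (star c * d.b i)) * ⟪d.b j • w, u⟫_ℝ := by
    intro i
    rw [real_inner_comm, IsHilbertOver.inner_smul, ← mul_smul, real_inner_comm]
    conv_lhs => rw [← d.sum_smul (star c * d.b i)]
    rw [Finset.sum_smul, sum_inner]
    refine Finset.sum_congr rfl fun j _ => ?_
    rw [smul_assoc, real_inner_smul_left]
  have e2 : ∀ j, c • d.b j • v = ∑ i, d.r (star (d.b i) * (c * d.b j)) • d.b i • v := by
    intro j
    rw [← mul_smul]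
    conv_lhs => rw [← d.sum_smul (c * d.b j)]
    rw [Finset.sum_smul]
    exact Finset.sum_congr rfl fun i _ => smul_assoc _ _ _
  have e3 : ∀ i j, d.r (star (d.b j) * (star c * d.b i)) = d.r (star (d.b i) * (c * d.b j)) := by
    intro i j
    rw [← d.r_star]
    simp only [star_mul, star_star, mul_assoc]
  rw [rankOne_apply, rankOne_apply, Finset.smul_sum]
  simp_rw [e1, smul_comm c _ (_ : H), e2, Finset.sum_smul, Finset.smul_sum]
  rw [Finset.sum_comm]
  refine Finset.sum_congr rfl fun j _ => Finset.sum_congr rfl fun i _ => ?_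
  rw [e3, smul_smul, mul_comm]

theorem inner_rankOne (v w u u' : H) :
    ⟪rankOne d v w u, u'⟫_ℝ = ⟪u, rankOne d w v u'⟫_ℝ := by
  rw [rankOne_apply, rankOne_apply, sum_inner, inner_sum]
  refine Finset.sum_congr rfl fun i _ => ?_
  rw [real_inner_smul_left, real_inner_smul_right, real_inner_comm u, mul_comm]

theorem isHilbertSchmidt_rankOne (v w : H) : IsHilbertSchmidt (rankOne d v w) := by
  refine Finset.sum_induction _ IsHilbertSchmidt (fun _ _ => IsHilbertSchmidt.add)
    (by simp [IsHilbertSchmidt, summable_zero]) fun i _ => ?_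
  have e := ((hBasis H).summable_inner_mul_inner (d.b i • w) (d.b i • w)).mul_right
    (‖d.b i • v‖ ^ 2)
  refine e.congr fun j => ?_
  have : (ContinuousLinearMap.toSpanSingleton ℝ (d.b i • v) ∘L innerSL ℝ (d.b i • w))
      (hBasis H j) = ⟪d.b i • w, hBasis H j⟫_ℝ • d.b i • v := by simp
  rw [this, norm_smul ⟪d.b i • w, hBasis H j⟫_ℝ, mul_pow, Real.norm_eq_abs, sq_abs,
    sq ⟪d.b i • w, hBasis H j⟫_ℝ, real_inner_comm (d.b i • w) (hBasis H j)]

/-- The skew-adjoint operator `u ↦ ∑ (⟨b_i w, u⟩ b_i v - ⟨b_i v, u⟩ b_i w)`. -/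
noncomputable def rankTwo (v w : H) : U2 K H :=
  ⟨rankOne d v w - rankOne d w v, by
    refine ⟨⟨fun c u => ?_, fun u u' => ?_⟩, ?_⟩
    · rw [_root_.sub_apply, _root_.sub_apply, rankOne_smul, rankOne_smul, smul_sub]
    · rw [_root_.sub_apply, _root_.sub_apply, inner_sub_left, inner_sub_right, inner_rankOne,
        inner_rankOne]
      ring
    · exact hs_of_memLp ((hs_memLp (isHilbertSchmidt_rankOne d v w)).sub
        (hs_memLp (isHilbertSchmidt_rankOne d w v)))⟩

theorem op_rankTwo (v w u : H) :
    U2.op (rankTwo d v w) u = rankOne d v w u - rankOne d w v u := rfl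

theorem rankTwo_swap (v w : H) : rankTwo d w v = -rankTwo d v w :=
  U2.op_ext fun _ => (neg_sub _ _).symm

theorem rankOne_apply_orth {w u : H} (h : ScalarOrth K u w) (v : H) : rankOne d v w u = 0 := by
  rw [rankOne_apply]
  refine Finset.sum_eq_zero fun i _ => ?_
  rw [h.inner_smul_left, zero_smul]

theorem rankOne_apply_self {w : H} (hw : ‖w‖ = 1) (v : H) : rankOne d v w w = v := by
  rw [rankOne_apply]
  have e : ∀ i, ⟪d.b i • w, w⟫_ℝ • d.b i • v = (d.r (star (d.b i) * 1) • d.b i) • v := by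
    intro i
    rw [real_inner_comm, inner_smul_self d, hw, mul_one, d.r_star, one_pow, mul_one, smul_assoc]
  simp_rw [e]
  rw [← Finset.sum_smul, d.sum_smul, one_smul]

theorem rankTwo_apply_orth {v w u : H} (hv : ScalarOrth K u v) (hw : ScalarOrth K u w) :
    U2.op (rankTwo d v w) u = 0 := by
  rw [op_rankTwo, rankOne_apply_orth d hv, rankOne_apply_orth d hw, sub_zero]

theorem rankTwo_apply_right {v w : H} (h : ScalarOrth K w v) (hw : ‖w‖ = 1) :
    U2.op (rankTwo d v w) w = v := by
  rw [op_rankTwo, rankOne_apply_orth d h, rankOne_apply_self d hw, sub_zero]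

theorem op_rankOne_left (z : U2 K H) (v w u : H) :
    U2.op z (rankOne d v w u) = rankOne d (U2.op z v) w u := by
  rw [rankOne_apply, rankOne_apply, map_sum]
  refine Finset.sum_congr rfl fun i _ => ?_
  rw [map_smul, (U2.op_skew z).1]

theorem op_rankOne_right (z : U2 K H) (v w u : H) :
    rankOne d v w (U2.op z u) = -rankOne d v (U2.op z w) u := by
  rw [rankOne_apply, rankOne_apply, ← Finset.sum_neg_distrib]
  refine Finset.sum_congr rfl fun i _ => ?_
  rw [← (U2.op_skew z).1, (U2.op_skew z).2, neg_smul, neg_neg]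

theorem lie_rankTwo (z : U2 K H) (v w : H) :
    ⁅z, rankTwo d v w⁆ = rankTwo d (U2.op z v) w + rankTwo d v (U2.op z w) := by
  refine U2.op_ext fun u => ?_
  rw [U2.op_lie_apply, U2.op_add, _root_.add_apply]
  simp only [op_rankTwo, map_sub, op_rankOne_left, op_rankOne_right]
  abel

/-- An operator that commutes with the operators `rankTwo d u u'`, for all unit vectors `u'`
orthogonal to a given finite set, annihilates `u`. -/
theorem op_eq_zero_of_lie_rankTwo (hH : ¬ FiniteDimensional ℝ H) (S : Finset H) {u : H} {x : U2 K H}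
    (h : ∀ u', ‖u'‖ = 1 → (∀ v ∈ S, ScalarOrth K u' v) → ⁅x, rankTwo d u u'⁆ = 0) :
    U2.op x u = 0 := by
  classical
  by_contra hne
  have hpos : 0 < ‖U2.op x u‖ := norm_pos_iff.2 hne
  -- `M` bounds the norm of `rankOne d u y u'` by `M ‖y‖` for unit vectors `u'`.
  set M : ℝ := ∑ i, √(d.r (star (d.b i) * d.b i)) * ‖d.b i • u‖ with hM
  have hM0 : 0 ≤ M := Finset.sum_nonneg fun i _ => mul_nonneg (Real.sqrt_nonneg _) (norm_nonneg _)
  -- Evaluating the vanishing commutator at such a `u'` gives `x u` plus a term of size at most `M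
  -- ‖x u'‖`. The choice of `ε` makes this smaller than `‖x u‖`, a contradiction.
  obtain ⟨u', hu1, hS, hxu⟩ := d.exists_unit_orth hH (S ∪ {u, U2.op x u}) x
    (ε := ‖U2.op x u‖ / (M + 1)) (by positivity)
  have e := h u' hu1 fun v hv => hS v (Finset.mem_union_left _ hv)
  have o1 : ScalarOrth K u' u := hS u (by simp)
  have o2 : ScalarOrth K u' (U2.op x u) := hS _ (by simp)
  rw [lie_rankTwo] at e
  have e2 := congrArg (fun y => U2.op y u') e
  simp only [U2.op_add, _root_.add_apply, U2.op_zero, _root_.zero_apply] at e2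
  rw [rankTwo_apply_right d o2 hu1, op_rankTwo, rankOne_apply_orth d o1, sub_zero] at e2
  have e3 : ‖U2.op x u‖ = ‖rankOne d u (U2.op x u') u'‖ := by
    rw [eq_neg_of_add_eq_zero_left e2, norm_neg]
  have e4 : ‖rankOne d u (U2.op x u') u'‖ ≤ M * ‖U2.op x u'‖ := by
    rw [rankOne_apply, hM, Finset.sum_mul]
    refine (norm_sum_le _ _).trans (Finset.sum_le_sum fun i _ => ?_)
    rw [norm_smul]
    have h1 : ‖⟪d.b i • U2.op x u', u'⟫_ℝ‖ ≤ √(d.r (star (d.b i) * d.b i)) * ‖U2.op x u'‖ := by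
      refine (norm_inner_le_norm _ _).trans ?_
      rw [hu1, mul_one]
      exact d.norm_smul_le _ _
    calc _ ≤ √(d.r (star (d.b i) * d.b i)) * ‖U2.op x u'‖ * ‖d.b i • u‖ :=
          mul_le_mul_of_nonneg_right h1 (norm_nonneg _)
      _ = _ := by ring
  have e5 : M * ‖U2.op x u'‖ ≤ M * (‖U2.op x u‖ / (M + 1)) :=
    mul_le_mul_of_nonneg_left hxu.le hM0
  have e6 : M * (‖U2.op x u‖ / (M + 1)) < ‖U2.op x u‖ := by
    rw [← mul_div_assoc, div_lt_iff₀ (by positivity)]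
    nlinarith
  linarith

theorem eq_zero_of_forall_lie_eq_zero (d : ScalarData K) (hH : ¬ FiniteDimensional ℝ H) {x : U2 K H}
    (h : ∀ y : U2 K H, ⁅x, y⁆ = 0) : x = 0 :=
  U2.op_ext fun u => by
    rw [op_eq_zero_of_lie_rankTwo d hH ∅ (u := u) (fun u' _ _ => h _), U2.op_zero,
      _root_.zero_apply]

/-! ### The centroid of `u₂(H)` -/

section Centroid

variable {A : U2 K H →ₗ[ℝ] U2 K H}

theorem centroid_lie_left (hA : ∀ x y : U2 K H, A ⁅x, y⁆ = ⁅x, A y⁆) (x y : U2 K H) :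
    A ⁅x, y⁆ = ⁅A x, y⁆ := by
  rw [← lie_skew, map_neg, hA, lie_skew]

/-- Write `v ∧ w` for `rankTwo d v w`. For `u` and `u'` orthogonal to `v` and `w` the bracket `[v ∧
w, u ∧ u']` vanishes, hence so does `[A(v ∧ w), u ∧ u']`; enough such `u'` exist to annihilate `u`.
-/
theorem centroid_rankTwo_apply_orth (hH : ¬ FiniteDimensional ℝ H)
    (hA : ∀ x y : U2 K H, A ⁅x, y⁆ = ⁅x, A y⁆) {v w u : H} (hv : ScalarOrth K u v) (hw : ScalarOrth K u w) :
    U2.op (A (rankTwo d v w)) u = 0 := by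
  classical
  refine op_eq_zero_of_lie_rankTwo d hH {v, w} fun u' _ hu' => ?_
  rw [← centroid_lie_left hA, lie_rankTwo, rankTwo_apply_orth d hv hw,
    rankTwo_apply_orth d (hu' v (by simp)) (hu' w (by simp))]
  have e1 : rankTwo d (0 : H) u' = 0 := U2.op_ext fun y => by
    simp [op_rankTwo, rankOne_apply, U2.op_zero]
  have e2 : rankTwo d u (0 : H) = 0 := U2.op_ext fun y => by
    simp [op_rankTwo, rankOne_apply, U2.op_zero]
  rw [e1, e2, add_zero, map_zero]

/-- Apply `A` to `v ∧ w = [v ∧ u, u ∧ w]` and evaluate at `w`. So `A(v ∧ w) w` does not depend on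
`w`; the next lemma removes the orthogonality of `w` and `u` by comparing both with a third vector.
-/
theorem centroid_rankTwo_apply_eq_of_orth (hH : ¬ FiniteDimensional ℝ H)
    (hA : ∀ x y : U2 K H, A ⁅x, y⁆ = ⁅x, A y⁆) {v w u : H} (hwv : ScalarOrth K w v)
    (huv : ScalarOrth K u v) (hwu : ScalarOrth K w u) (hw : ‖w‖ = 1) (hu : ‖u‖ = 1) :
    U2.op (A (rankTwo d v w)) w = U2.op (A (rankTwo d v u)) u := by
  have e : ⁅rankTwo d v u, rankTwo d u w⁆ = rankTwo d v w := by
    rw [lie_rankTwo, rankTwo_apply_right d huv hu, rankTwo_apply_orth d hwv hwu]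
    have e2 : rankTwo d u (0 : H) = 0 := U2.op_ext fun y => by
      simp [op_rankTwo, rankOne_apply, U2.op_zero]
    rw [e2, add_zero]
  rw [← e, centroid_lie_left hA, U2.op_lie_apply, rankTwo_apply_right d hwu hw,
    centroid_rankTwo_apply_orth d hH hA hwv hwu, map_zero, sub_zero]

theorem centroid_rankTwo_apply_eq (hH : ¬ FiniteDimensional ℝ H)
    (hA : ∀ x y : U2 K H, A ⁅x, y⁆ = ⁅x, A y⁆) {v w u : H} (hwv : ScalarOrth K w v)
    (huv : ScalarOrth K u v) (hw : ‖w‖ = 1) (hu : ‖u‖ = 1) :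
    U2.op (A (rankTwo d v w)) w = U2.op (A (rankTwo d v u)) u := by
  classical
  obtain ⟨y, hy, hS, -⟩ := d.exists_unit_orth hH {v, w, u} (0 : U2 K H) one_pos
  rw [centroid_rankTwo_apply_eq_of_orth d hH hA hwv (hS v (by simp)) (hS w (by simp)).symm hw hy,
    centroid_rankTwo_apply_eq_of_orth d hH hA huv (hS v (by simp)) (hS u (by simp)).symm hu hy]

theorem inner_centroid_rankTwo (v w : H) (c : K) :
    ⟪U2.op (A (rankTwo d v w)) w, c • v⟫_ℝ = ⟪U2.op (A (rankTwo d w v)) v, star c • w⟫_ℝ := by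
  have e : U2.op (-A (rankTwo d v w)) v = -U2.op (A (rankTwo d v w)) v := rfl
  rw [rankTwo_swap d v w, map_neg, e, inner_neg_left, ← IsHilbertOver.inner_smul,
    (U2.op_skew _).2, (U2.op_skew _).1, real_inner_comm]

/-- Choose `y` orthogonal to `v` and `v'` and pass from `(v, w)` to `(v, y)`, `(v', y)` and `(v',
w')`. The middle move swaps the two vectors, which replaces `c` by `star c`, and swaps back. -/
theorem inner_centroid_rankTwo_eq (hH : ¬ FiniteDimensional ℝ H)
    (hA : ∀ x y : U2 K H, A ⁅x, y⁆ = ⁅x, A y⁆) {v w v' w' : H} (hv : ‖v‖ = 1) (hw : ‖w‖ = 1)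
    (hv' : ‖v'‖ = 1) (hw' : ‖w'‖ = 1) (h : ScalarOrth K w v) (h' : ScalarOrth K w' v') (c : K) :
    ⟪U2.op (A (rankTwo d v w)) w, c • v⟫_ℝ = ⟪U2.op (A (rankTwo d v' w')) w', c • v'⟫_ℝ := by
  classical
  obtain ⟨y, hy, hS, -⟩ := d.exists_unit_orth hH {v, v'} (0 : U2 K H) one_pos
  have o1 : ScalarOrth K y v := hS v (by simp)
  have o2 : ScalarOrth K y v' := hS v' (by simp)
  rw [centroid_rankTwo_apply_eq d hH hA h o1 hw hy, inner_centroid_rankTwo,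
    centroid_rankTwo_apply_eq d hH hA o1.symm o2.symm hv hv', inner_centroid_rankTwo, star_star,
    centroid_rankTwo_apply_eq d hH hA o2 h' hy hw']

/-- All pairings of `A(v ∧ w) w` with `K v` are independent of the pair and invariant under `star`,
hence governed by one real number; the component outside `ℝ v` turns out to be zero. -/
theorem exists_centroid_rankTwo_apply (hH : ¬ FiniteDimensional ℝ H)
    (hA : ∀ x y : U2 K H, A ⁅x, y⁆ = ⁅x, A y⁆) :
    ∃ c : ℝ, ∀ v w : H, ‖v‖ = 1 → ‖w‖ = 1 → ScalarOrth K w v →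
      U2.op (A (rankTwo d v w)) w = c • v := by
  classical
  obtain ⟨v₀, hv₀, -, -⟩ := d.exists_unit_orth hH ∅ (0 : U2 K H) one_pos
  obtain ⟨w₀, hw₀, hS₀, -⟩ := d.exists_unit_orth hH {v₀} (0 : U2 K H) one_pos
  have h₀ : ScalarOrth K w₀ v₀ := hS₀ v₀ (by simp)
  refine ⟨⟪U2.op (A (rankTwo d v₀ w₀)) w₀, (1 : K) • v₀⟫_ℝ, fun v w hv hw h => ?_⟩
  rw [inner_centroid_rankTwo_eq d hH hA hv₀ hw₀ hv hw h₀ h]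
  set η := U2.op (A (rankTwo d v w)) w with hη
  -- Exchanging `v` and `w` conjugates `c`, while the pairing is the same for `(v, w)` and `(w, v)`.
  have hstar : ∀ c : K, ⟪η, star c • v⟫_ℝ = ⟪η, c • v⟫_ℝ := by
    intro c
    rw [hη, inner_centroid_rankTwo, star_star,
      inner_centroid_rankTwo_eq d hH hA hw hv hv hw h.symm h]
  have hr : ∀ c : K, ⟪η, c • v⟫_ℝ = d.r c * ⟪η, (1 : K) • v⟫_ℝ := by
    intro c
    have e : ⟪η, (c + star c) • v⟫_ℝ = 2 * d.r c * ⟪η, (1 : K) • v⟫_ℝ := by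
      rw [d.add_star, smul_assoc, real_inner_smul_right]
    rw [add_smul, inner_add_right, hstar] at e
    linarith
  set g := ⟪η, (1 : K) • v⟫_ℝ
  have ho : ScalarOrth K v (η - g • v) := by
    refine ScalarOrth.symm fun c => ?_
    rw [inner_sub_left, real_inner_smul_left, inner_smul_self d, hr, hv]
    ring
  obtain ⟨y, hy, hS, -⟩ := d.exists_unit_orth hH {v, η - g • v} (0 : U2 K H) one_pos
  -- With `y` orthogonal also to the remainder, `η = A(v ∧ y) y`, and `A(v ∧ y)` is skew and
  -- annihilates the remainder.
  have e1 : ⟪η, η - g • v⟫_ℝ = 0 := by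
    have e : η = U2.op (A (rankTwo d v y)) y :=
      centroid_rankTwo_apply_eq d hH hA h (hS v (by simp)) hw hy
    conv_lhs => rw [e, (U2.op_skew _).2, ← e]
    rw [centroid_rankTwo_apply_orth d hH hA ho.symm (hS (η - g • v) (by simp)).symm,
      inner_zero_right, neg_zero]
  have e2 : ⟪η - g • v, η - g • v⟫_ℝ = 0 := by
    rw [inner_sub_left η, real_inner_smul_left, e1, ho.inner_eq, mul_zero, sub_zero]
  exact sub_eq_zero.1 (inner_self_eq_zero.1 e2)

/-- A linear operator on `u₂(H)` that commutes with the adjoint representation is a real scalar. -/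
theorem exists_eq_smul_of_map_lie (d : ScalarData K) (hH : ¬ FiniteDimensional ℝ H)
    (hA : ∀ x y : U2 K H, A ⁅x, y⁆ = ⁅x, A y⁆) : ∃ c : ℝ, ∀ x, A x = c • x := by
  obtain ⟨c, hc⟩ := exists_centroid_rankTwo_apply d hH hA
  have hT : ∀ v w : H, ‖v‖ = 1 → ‖w‖ = 1 → ScalarOrth K w v →
      A (rankTwo d v w) = c • rankTwo d v w := by
    intro v w hv hw h
    rw [← sub_eq_zero]
    set y := A (rankTwo d v w) - c • rankTwo d v w with hy
    have hop : ∀ u, U2.op y u = U2.op (A (rankTwo d v w)) u - c • U2.op (rankTwo d v w) u :=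
      fun _ => rfl
    have hyw : U2.op y w = 0 := by
      rw [hop, hc v w hv hw h, rankTwo_apply_right d h hw, sub_self]
    have hyv : U2.op y v = 0 := by
      have e := hc w v hw hv h.symm
      have e' := rankTwo_apply_right d h.symm hv
      rw [rankTwo_swap d v w] at e e'
      rw [map_neg] at e
      change -U2.op (A (rankTwo d v w)) v = _ at e
      change -U2.op (rankTwo d v w) v = _ at e'
      rw [hop, neg_eq_iff_eq_neg.1 e, neg_eq_iff_eq_neg.1 e', smul_neg, sub_self]
    -- The difference `y` annihilates `v` and `w`, so its range is orthogonal to both over `K`;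
    -- there `y` vanishes. Thus `y² = 0`, and a skew operator with zero square is zero.
    have horth : ∀ f : H, U2.op y f = 0 → ∀ u, ScalarOrth K (U2.op y u) f := by
      intro f hf u a
      rw [(U2.op_skew y).2, (U2.op_skew y).1, hf, smul_zero, inner_zero_right, neg_zero]
    refine U2.op_ext fun u => ?_
    have e : U2.op y (U2.op y u) = 0 := by
      rw [hop, centroid_rankTwo_apply_orth d hH hA (horth v hyv u) (horth w hyw u),
        rankTwo_apply_orth d (horth v hyv u) (horth w hyw u), smul_zero, sub_zero]
    have e2 : ⟪U2.op y u, U2.op y u⟫_ℝ = 0 := by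
      rw [(U2.op_skew y).2, e, inner_zero_right, neg_zero]
    exact inner_self_eq_zero.1 e2
  refine ⟨c, fun x => sub_eq_zero.1 (U2.op_ext fun u => ?_)⟩
  rw [U2.op_zero, _root_.zero_apply]
  have hunit : ∀ u : H, ‖u‖ = 1 → U2.op (A x - c • x) u = 0 := by
    intro u hu
    refine op_eq_zero_of_lie_rankTwo d hH {u} fun u' hu' hS => ?_
    rw [sub_lie, smul_lie, ← centroid_lie_left hA, hA, hT u u' hu hu' (hS u (by simp)), lie_smul,
      sub_self]
  by_cases hu : u = 0
  · rw [hu, map_zero]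
  · have e := hunit (‖u‖⁻¹ • u) (by
      rw [norm_smul, norm_inv, norm_norm, inv_mul_cancel₀ (norm_ne_zero_iff.2 hu)])
    rw [map_smul] at e
    exact (smul_eq_zero.1 e).resolve_left (inv_ne_zero (norm_ne_zero_iff.2 hu))

end Centroid

/-! ### Automorphisms of finite order are isometric -/

/-- The one-dimensional abelian subalgebra spanned by an element. -/
def lineSubalgebra {g : Type*} [LieRing g] [LieAlgebra ℝ g] (x : g) : LieSubalgebra ℝ g where
  toSubmodule := Submodule.span ℝ {x}
  lie_mem' := by
    intro a b ha hb
    obtain ⟨r, rfl⟩ := Submodule.mem_span_singleton.1 ha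
    obtain ⟨s, rfl⟩ := Submodule.mem_span_singleton.1 hb
    rw [lie_smul, smul_lie, lie_self, smul_zero, smul_zero]
    exact Submodule.zero_mem _

theorem lie_eq_zero_of_mem_lineSubalgebra {g : Type*} [LieRing g] [LieAlgebra ℝ g] {x : g} :
    ∀ a ∈ lineSubalgebra x, ∀ b ∈ lineSubalgebra x, ⁅a, b⁆ = 0 := by
  intro a ha b hb
  obtain ⟨r, rfl⟩ := Submodule.mem_span_singleton.1 ha
  obtain ⟨s, rfl⟩ := Submodule.mem_span_singleton.1 hb
  rw [lie_smul, smul_lie, lie_self, smul_zero, smul_zero]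

/-- `ad (φ x)` is conjugate to `ad x` under `φ`, so its eigenvalues obey the bound for `ad x`.
Weight vectors of the line through `φ x` are dense, so these eigenvalues control its norm, with no
continuity of `φ` assumed. -/
theorem norm_lie_map_le (d : ScalarData K) (φ : U2 K H ≃ₗ⁅ℝ⁆ U2 K H) :
    ∃ C : ℝ, ∀ x w : U2 K H, ‖⁅φ x, w⁆‖ ≤ C * ‖x‖ * ‖w‖ := by
  obtain ⟨C, hC⟩ := HilbertLieAlgebra.norm_lie_le (k := U2 K H)
  have hC' : ∀ x y : U2 K H, ‖⁅x, y⁆‖ ≤ |C| * ‖x‖ * ‖y‖ := fun x y =>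
    (hC x y).trans (by gcongr; exact le_abs_self C)
  refine ⟨|C|, fun x w => ?_⟩
  let z : lineSubalgebra (φ x) := ⟨φ x, Submodule.mem_span_singleton_self _⟩
  refine (hasDenseWeights d lie_eq_zero_of_mem_lineSubalgebra).norm_lie_le (z := z)
    (C := |C| * ‖x‖) (by positivity)
    (fun a p q h hne => ?_) w
  have e1 := congrArg φ.symm (h z).1
  have e2 := congrArg φ.symm (h z).2
  rw [LieEquiv.map_lie, map_neg, map_smul] at e1
  rw [LieEquiv.map_lie, map_smul] at e2
  change ⁅φ.symm (φ x), _⁆ = _ at e1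
  change ⁅φ.symm (φ x), _⁆ = _ at e2
  rw [LieEquiv.symm_apply_apply] at e1 e2
  have n1 := hC' x (φ.symm p)
  have n2 := hC' x (φ.symm q)
  rw [e1, norm_neg, norm_smul, Real.norm_eq_abs] at n1
  rw [e2, norm_smul, Real.norm_eq_abs] at n2
  set B := |C| * ‖x‖
  have hB : 0 ≤ B := by positivity
  have hinj : ∀ y, y ≠ 0 → 0 < ‖φ.symm y‖ := fun y hy => by
    rw [norm_pos_iff]
    intro h0
    exact hy (by rw [← LieEquiv.apply_symm_apply φ y, h0, map_zero])
  have hsum : 0 < ‖φ.symm p‖ + ‖φ.symm q‖ := by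
    rcases hne with hne | hne
    · have := hinj _ hne
      positivity
    · have := hinj _ hne
      positivity
  refine le_of_mul_le_mul_right ?_ hsum
  linarith

/-- Closed graph theorem: the bound on `ad (φ x)` shows that the discrepancy `y - φ x` of a limit in
the graph commutes with everything, and the centre of `u₂(H)` is trivial. -/
theorem continuous_of_lieEquiv (d : ScalarData K) (hH : ¬ FiniteDimensional ℝ H) (φ : U2 K H ≃ₗ⁅ℝ⁆ U2 K H) :
    Continuous φ := by
  obtain ⟨C, hC⟩ := norm_lie_map_le d φ
  refine LinearMap.continuous_of_seq_closed_graph (φ : U2 K H →ₗ[ℝ] U2 K H) fun u x y hu hy => ?_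
  change y = φ x
  rw [← sub_eq_zero]
  refine eq_zero_of_forall_lie_eq_zero d hH fun w => ?_
  have h1 : Filter.Tendsto (fun n => ⁅φ (u n - x), w⁆) Filter.atTop (nhds ⁅y - φ x, w⁆) := by
    have : Filter.Tendsto (fun n => φ (u n - x)) Filter.atTop (nhds (y - φ x)) := by
      simp_rw [map_sub]
      exact hy.sub tendsto_const_nhds
    exact (((lieCLM (U2 K H)).flip w).continuous.tendsto _).comp this
  have h2 : Filter.Tendsto (fun n => ⁅φ (u n - x), w⁆) Filter.atTop (nhds 0) := by
    refine squeeze_zero_norm (fun n => hC _ _) ?_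
    have : Filter.Tendsto (fun n => ‖u n - x‖) Filter.atTop (nhds 0) :=
      tendsto_iff_norm_sub_tendsto_zero.1 hu
    simpa using (this.const_mul C).mul_const ‖w‖
  exact tendsto_nhds_unique h1 h2

/-- Automorphisms of finite order of `u₂(H)` are isometric. -/
theorem FiniteOrder.norm_map (d : ScalarData K) (hH : ¬ FiniteDimensional ℝ H) {φ : U2 K H ≃ₗ⁅ℝ⁆ U2 K H}
    (hφ : FiniteOrder φ) (x : U2 K H) : ‖φ x‖ = ‖x‖ := by
  let Φ : U2 K H →L[ℝ] U2 K H := ⟨(φ : U2 K H →ₗ[ℝ] U2 K H), continuous_of_lieEquiv d hH φ⟩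
  -- Invariance of the scalar product makes `Φ^* Φ` commute with the adjoint representation, so it
  -- is a real scalar `c ≥ 0` and `φ` scales squared norms by `c`; iterating to the order of `φ`
  -- gives `c ^ n = 1`.
  let A : U2 K H →L[ℝ] U2 K H := ContinuousLinearMap.adjoint Φ ∘L Φ
  have hAi : ∀ x y, ⟪A x, y⟫_ℝ = ⟪φ x, φ y⟫_ℝ := fun x y =>
    ContinuousLinearMap.adjoint_inner_left Φ y (Φ x)
  have hA : ∀ x y : U2 K H, A ⁅x, y⁆ = ⁅x, A y⁆ := by
    intro x y
    refine ext_inner_right ℝ fun z => ?_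
    rw [hAi, LieEquiv.map_lie, inner_lie_left, ← LieEquiv.map_lie, ← hAi, inner_lie_left]
  obtain ⟨c, hc⟩ := exists_eq_smul_of_map_lie d hH (A := (A : U2 K H →ₗ[ℝ] U2 K H)) hA
  have hn : ∀ y, ‖φ y‖ ^ 2 = c * ‖y‖ ^ 2 := by
    intro y
    have e : A y = c • y := hc y
    rw [← real_inner_self_eq_norm_sq, ← hAi, e, real_inner_smul_left, real_inner_self_eq_norm_sq]
  by_cases hx : x = 0
  · rw [hx, map_zero]
  have hpos : 0 < ‖x‖ ^ 2 := pow_pos (norm_pos_iff.2 hx) 2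
  have hc0 : 0 ≤ c := by
    by_contra! hneg
    have := hn x
    nlinarith [sq_nonneg ‖φ x‖]
  obtain ⟨n, hn0, hpow⟩ := isOfFinOrder_iff_pow_eq_one.1 hφ
  have hit : ∀ m : ℕ, ‖(φ.toLinearEquiv ^ m) x‖ ^ 2 = c ^ m * ‖x‖ ^ 2 := by
    intro m
    induction m with
    | zero => rw [pow_zero, pow_zero, one_mul]; rfl
    | succ m ih =>
      rw [pow_succ' φ.toLinearEquiv]
      change ‖φ ((φ.toLinearEquiv ^ m) x)‖ ^ 2 = _
      rw [hn, ih, pow_succ']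
      ring
  have e := hit n
  rw [hpow] at e
  change ‖x‖ ^ 2 = _ at e
  have hcn : c ^ n = 1 := by
    have : (c ^ n - 1) * ‖x‖ ^ 2 = 0 := by linarith
    exact sub_eq_zero.1 ((mul_eq_zero.1 this).resolve_right hpos.ne')
  have hc1 : c = 1 := (pow_eq_one_iff_of_nonneg hc0 hn0.ne').1 hcn
  have e2 := hn x
  rw [hc1, one_mul] at e2
  exact (pow_left_inj₀ (norm_nonneg _) (norm_nonneg _) two_ne_zero).1 e2

end RankTwo

section BoundedSkew

variable {K H : Type*} [Ring K] [StarRing K] [Algebra ℝ K] [NormedAddCommGroup H]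
  [InnerProductSpace ℝ H] [CompleteSpace H] [Module K H] [IsScalarTower ℝ K H]
  [IsHilbertOver K H]

/-! ### The adjoint action of bounded skew-adjoint operators -/

theorem summable_of_adjoint {x y : H →L[ℝ] H} (hx : ∀ v w, ⟪x v, w⟫_ℝ = ⟪v, y w⟫_ℝ)
    (hy : IsHilbertSchmidt y) : IsHilbertSchmidt x ∧
      ∑' i, ‖x (hBasis H i)‖ ^ 2 = ∑' i, ‖y (hBasis H i)‖ ^ 2 := by
  have e := hs_adjoint (hBasis H) (hBasis H) hx
  have hs : IsHilbertSchmidt x := by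
    have f : ∑' i, ENNReal.ofReal (‖x (hBasis H i)‖ ^ 2) ≠ ⊤ := by
      rw [e, ← ENNReal.ofReal_tsum_of_nonneg (fun _ => by positivity) hy]
      exact ENNReal.ofReal_ne_top
    refine (ENNReal.summable_toReal f).congr fun i => ?_
    rw [ENNReal.toReal_ofReal (by positivity)]
  have e2 := trPair_self_adjoint hx hs hy
  simp only [trPair, real_inner_self_eq_norm_sq] at e2
  exact ⟨hs, e2⟩

variable {L : H →L[ℝ] H}

theorem adjoint_comp_skew (hL : IsSkew K L) (x : U2 K H) (v w : H) :
    ⟪(U2.op x * L) v, w⟫_ℝ = ⟪v, (L * U2.op x) w⟫_ℝ := by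
  rw [mul_apply_eq_comp, mul_apply_eq_comp, (U2.op_skew x).2, hL.2, neg_neg]

theorem isHilbertSchmidt_comp_skew (hL : IsSkew K L) (x : U2 K H) :
    IsHilbertSchmidt (U2.op x * L) :=
  (summable_of_adjoint (adjoint_comp_skew hL x) ((U2.op_hs x).comp_left L)).1

theorem commutator_skew_mem (hL : IsSkew K L) (x : U2 K H) :
    L * U2.op x - U2.op x * L ∈ u2 K H := by
  refine ⟨⟨fun c v => ?_, fun v w => ?_⟩, hs_of_memLp ((hs_memLp ((U2.op_hs x).comp_left L)).sub
    (hs_memLp (isHilbertSchmidt_comp_skew hL x)))⟩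
  · simp [hL.1, (U2.op_skew x).1, smul_sub]
  · rw [_root_.sub_apply, _root_.sub_apply, inner_sub_left, inner_sub_right]
    simp only [mul_apply_eq_comp]
    rw [hL.2, (U2.op_skew x).2 v, (U2.op_skew x).2 (L v), hL.2 v]
    ring

/-- The derivation `x ↦ L x - x L` of `u₂(H)`, for a bounded skew-adjoint operator `L`. -/
noncomputable def adSkew (hL : IsSkew K L) : U2 K H →L[ℝ] U2 K H :=
  LinearMap.mkContinuous
    { toFun := fun x => ⟨_, commutator_skew_mem hL x⟩
      map_add' := fun x y => U2.op_ext fun v => by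
        change L ((U2.op x + U2.op y) v) - (U2.op x + U2.op y) (L v) =
          (L (U2.op x v) - U2.op x (L v)) + (L (U2.op y v) - U2.op y (L v))
        rw [_root_.add_apply, _root_.add_apply, map_add]
        abel
      map_smul' := fun c x => U2.op_ext fun v => by
        change L ((c • U2.op x) v) - (c • U2.op x) (L v) = c • (L (U2.op x v) - U2.op x (L v))
        rw [_root_.smul_apply, _root_.smul_apply, map_smul, smul_sub] }
    (2 * ‖L‖) fun x => by
      have h1 := summable_of_adjoint (adjoint_comp_skew hL x) ((U2.op_hs x).comp_left L)
      have h2 : ∀ i, ‖L (U2.op x (hBasis H i)) - U2.op x (L (hBasis H i))‖ ^ 2 ≤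
          2 * (‖(L * U2.op x) (hBasis H i)‖ ^ 2 + ‖(U2.op x * L) (hBasis H i)‖ ^ 2) := by
        intro i
        have := norm_sub_le (L (U2.op x (hBasis H i))) (U2.op x (L (hBasis H i)))
        have := pow_le_pow_left₀ (norm_nonneg _) this 2
        simp only [mul_apply_eq_comp]
        nlinarith [sq_nonneg (‖L (U2.op x (hBasis H i))‖ - ‖U2.op x (L (hBasis H i))‖)]
      have hs1 : Summable fun i => ‖(L * U2.op x) (hBasis H i)‖ ^ 2 := (U2.op_hs x).comp_left L
      have hs2 : Summable fun i => ‖(U2.op x * L) (hBasis H i)‖ ^ 2 := h1.1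
      have h3 : ∑' i, ‖(L * U2.op x) (hBasis H i)‖ ^ 2 ≤ ‖L‖ ^ 2 * ‖x‖ ^ 2 := by
        rw [U2.norm_def, U2.norm_toLp_sq, ← tsum_mul_left]
        refine hs1.tsum_le_tsum (fun i => ?_) ((U2.op_hs x).mul_left _)
        rw [← mul_pow]
        exact pow_le_pow_left₀ (norm_nonneg _) (L.le_opNorm _) 2
      refine (sq_le_sq₀ (norm_nonneg _) (by positivity)).1 ?_
      rw [U2.norm_def, U2.norm_toLp_sq]
      calc _ ≤ ∑' i, 2 * (‖(L * U2.op x) (hBasis H i)‖ ^ 2 + ‖(U2.op x * L) (hBasis H i)‖ ^ 2) :=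
            Summable.tsum_le_tsum h2 (commutator_skew_mem hL x).2 ((hs1.add hs2).mul_left 2)
        _ = 2 * (2 * ∑' i, ‖(L * U2.op x) (hBasis H i)‖ ^ 2) := by
            rw [tsum_mul_left, hs1.tsum_add hs2, h1.2, ← two_mul]
        _ ≤ (2 * ‖L‖ * ‖x‖) ^ 2 := by
            rw [mul_pow, mul_pow]
            linarith

theorem op_adSkew (hL : IsSkew K L) (x : U2 K H) (v : H) :
    U2.op (adSkew hL x) v = L (U2.op x v) - U2.op x (L v) := rfl

/-- Invariance of the trace form, with one argument only bounded. It converts the trace condition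
defining `Λ_μ` into information on its adjoint action. -/
theorem trPair_skew_lie (hL : IsSkew K L) (x y : U2 K H) :
    trPair L (U2.op ⁅x, y⁆) = ⟪adSkew hL x, y⟫_ℝ := by
  rw [U2.inner_def]
  have hLx := (U2.op_hs x).comp_left L
  have hLy := (U2.op_hs y).comp_left L
  have hxL := isHilbertSchmidt_comp_skew hL x
  have hyL := isHilbertSchmidt_comp_skew hL y
  have e1 : trPair (U2.op y * L) (U2.op x) = trPair (L * U2.op x) (U2.op y) := by
    have a1 : trPair (U2.op y * L) (U2.op x) = trPair (L * U2.op y) (-U2.op x) :=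
      trPair_adjoint (adjoint_comp_skew hL y) (fun v w => by
        rw [_root_.neg_apply, inner_neg_right, (U2.op_skew x).2]) hyL hLy (U2.op_hs x)
        (U2.op_hs (-x))
    rw [a1]
    refine tsum_congr fun i => ?_
    rw [mul_apply_eq_comp, mul_apply_eq_comp, _root_.neg_apply, inner_neg_right, hL.2, neg_neg,
      real_inner_comm]
  have e2 : trPair (U2.op (adSkew hL x)) (U2.op y) =
      trPair (L * U2.op x) (U2.op y) - trPair (U2.op x * L) (U2.op y) := by
    unfold trPair
    rw [← (summable_trPair hLx (U2.op_hs y)).tsum_sub (summable_trPair hxL (U2.op_hs y))]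
    refine tsum_congr fun i => ?_
    rw [← inner_sub_left]
    rfl
  rw [e2, ← e1]
  unfold trPair
  rw [← (summable_trPair hyL (U2.op_hs x)).tsum_sub (summable_trPair hxL (U2.op_hs y))]
  refine tsum_congr fun i => ?_
  rw [U2.op_lie_apply, inner_sub_right, mul_apply_eq_comp, mul_apply_eq_comp, (U2.op_skew y).2,
    (U2.op_skew x).2]
  ring

end BoundedSkew

/-! ### Elements of weight spaces have finite rank -/

section FiniteRank

variable {K H : Type*} [Ring K] [StarRing K] [Algebra ℝ K] [NormedAddCommGroup H]
  [InnerProductSpace ℝ H] [CompleteSpace H] [Module K H] [IsScalarTower ℝ K H]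
  [IsHilbertOver K H] {t₀ : LieSubalgebra ℝ (U2 K H)} {φ : U2 K H ≃ₗ⁅ℝ⁆ U2 K H}

/-- The underlying operator has finite rank. -/
def HasFiniteRank (x : U2 K H) : Prop :=
  FiniteDimensional ℝ (LinearMap.range (U2.op x : H →ₗ[ℝ] H))

theorem HasFiniteRank.of_le {x : U2 K H} {F : Submodule ℝ H} [FiniteDimensional ℝ F]
    (h : ∀ v, U2.op x v ∈ F) : HasFiniteRank x := by
  refine Submodule.finiteDimensional_of_le (S₂ := F) ?_
  rintro _ ⟨v, rfl⟩
  exact h v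

theorem HasFiniteRank.add {x y : U2 K H} (hx : HasFiniteRank x) (hy : HasFiniteRank y) :
    HasFiniteRank (x + y) := by
  unfold HasFiniteRank at hx hy
  exact HasFiniteRank.of_le
    (F := LinearMap.range (U2.op x : H →ₗ[ℝ] H) ⊔ LinearMap.range (U2.op y : H →ₗ[ℝ] H))
    fun v => Submodule.add_mem_sup ⟨v, rfl⟩ ⟨v, rfl⟩

theorem HasFiniteRank.smul {x : U2 K H} (c : ℝ) (hx : HasFiniteRank x) :
    HasFiniteRank (c • x) := by
  unfold HasFiniteRank at hx
  exact HasFiniteRank.of_le (F := LinearMap.range (U2.op x : H →ₗ[ℝ] H))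
    fun v => Submodule.smul_mem _ c ⟨v, rfl⟩

theorem HasFiniteRank.lie {x y : U2 K H} (hx : HasFiniteRank x) (hy : HasFiniteRank y) :
    HasFiniteRank ⁅x, y⁆ := by
  unfold HasFiniteRank at hx hy
  exact HasFiniteRank.of_le
    (F := LinearMap.range (U2.op x : H →ₗ[ℝ] H) ⊔ LinearMap.range (U2.op y : H →ₗ[ℝ] H))
    fun v => Submodule.sub_mem _ (Submodule.mem_sup_left ⟨_, rfl⟩) (Submodule.mem_sup_right ⟨_, rfl⟩)

/-- The real parts of the elements of a weight space that have finite rank. -/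
def finiteRankParts (t₀ : LieSubalgebra ℝ (U2 K H)) (a : Module.Dual ℝ t₀) :
    Submodule ℝ (U2 K H) where
  carrier := {x | HasFiniteRank x ∧ ∃ y, IsWeightPair t₀ a x y}
  add_mem' := by
    rintro x x' ⟨h, y, hy⟩ ⟨h', y', hy'⟩
    exact ⟨h.add h', y + y', hy.add hy'⟩
  zero_mem' := ⟨HasFiniteRank.of_le (F := ⊥) fun v => rfl, 0, fun z => by simp⟩
  smul_mem' := by
    rintro c x ⟨h, y, hy⟩
    exact ⟨h.smul c, c • y, hy.smul c⟩

theorem finiteDimensional_finiteRankParts (hφ : FiniteOrder φ)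
    (hm : IsMaxAbelianIn t₀ (fixedPoints φ)) {a : Module.Dual ℝ t₀} (ha : a ≠ 0) :
    FiniteDimensional ℝ (finiteRankParts t₀ a) := by
  have h1 := finiteDimensional_weightSpace hφ hm ha
  have h2 : FiniteDimensional ℝ (weightSpace t₀ a) := FiniteDimensional.trans ℝ ℂ _
  have h3 : FiniteDimensional ℝ ((weightSpace t₀ a).restrictScalars ℝ) := h2
  refine Submodule.finiteDimensional_of_le
    (S₂ := ((weightSpace t₀ a).restrictScalars ℝ).map reC) ?_
  rintro x ⟨-, y, h⟩
  exact ⟨cmk x y, cmk_mem_weightSpace.2 h, reC_cmk x y⟩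

/-- The finite rank real parts of this weight form a finite-dimensional space `F`. The component of
`x` orthogonal to `F` has all its invariant compressions in `F`, hence is orthogonal to them, hence
has zero compressions and vanishes. -/
theorem IsWeightPair.hasFiniteRank (d : ScalarData K) (hφ : FiniteOrder φ)
    (hm : IsMaxAbelianIn t₀ (fixedPoints φ)) {a : Module.Dual ℝ t₀} (ha : a ≠ 0) {x y : U2 K H}
    (h : IsWeightPair t₀ a x y) : HasFiniteRank x := by
  have := finiteDimensional_finiteRankParts hφ hm ha
  set F := finiteRankParts t₀ a
  have hp : F.starProjection x ∈ F := Submodule.starProjection_apply_mem F x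
  obtain ⟨hr, y', hy'⟩ := hp
  have hz : x - F.starProjection x = 0 := by
    refine eq_zero_of_compress (t := t₀) d hm.1.2 fun G _ hG hh => ?_
    have hw : IsWeightPair t₀ a (x - F.starProjection x) (y - y') := by
      have := h.add (hy'.smul (-1))
      rwa [neg_one_smul, neg_one_smul, ← sub_eq_add_neg, ← sub_eq_add_neg] at this
    have hmem : TwistedLoop.compress G hG (x - F.starProjection x) ∈ F :=
      ⟨finiteDimensional_range_compress hG _, _, hw.compress hG hh⟩
    have e := Submodule.inner_left_of_mem_orthogonal hmem (F.sub_starProjection_mem_orthogonal x)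
    rw [inner_compress] at e
    exact norm_eq_zero.1 (pow_eq_zero_iff two_ne_zero |>.1 e)
  rw [sub_eq_zero.1 hz]
  exact hr

end FiniteRank

/-! ### The adjoint action of `Λ_μ` -/

section SharpOp

variable {K H : Type*} [Ring K] [StarRing K] [Algebra ℝ K] [NormedAddCommGroup H]
  [InnerProductSpace ℝ H] [CompleteSpace H] [Module K H] [IsScalarTower ℝ K H]
  [IsHilbertOver K H] {t₀ : LieSubalgebra ℝ (U2 K H)} {φ : U2 K H ≃ₗ⁅ℝ⁆ U2 K H}
  {μ : Module.Dual ℝ t₀} {L : H →L[ℝ] H}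

theorem IsSharpOp.exists_seq (hL : IsSharpOp t₀ μ L) (s : Finset H) :
    ∃ h : ℕ → t₀, ∀ v ∈ s,
      Filter.Tendsto (fun n => U2.op (h n : U2 K H) v) Filter.atTop (nhds (L v)) := by
  choose h hh hs using fun n : ℕ => hL.2.1 s (1 / ((n : ℝ) + 1)) Nat.one_div_pos_of_nat
  refine ⟨fun n => ⟨h n, hh n⟩, fun v hv => ?_⟩
  rw [tendsto_iff_norm_sub_tendsto_zero]
  refine squeeze_zero (fun _ => norm_nonneg _) (fun n => ?_) tendsto_one_div_add_atTop_nhds_zero_nat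
  rw [norm_sub_rev]
  exact (hs n v hv).le

/-- `Λ_μ` acts on each weight space by a scalar. -/
theorem IsSharpOp.exists_eigenvalue (hL : IsSharpOp t₀ μ L) {a : Module.Dual ℝ t₀} {x y : U2 K H}
    (h : IsWeightPair t₀ a x y) (hx : x ≠ 0) : ∃ c : ℝ, ∀ x' y', IsWeightPair t₀ a x' y' →
      adSkew hL.1 x' = -(c • y') ∧ adSkew hL.1 y' = c • x' := by
  classical
  obtain ⟨u, hu⟩ : ∃ u, U2.op x u ≠ 0 := by
    by_contra! hc
    exact hx (U2.op_ext hc)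
  have hpos : 0 < ‖U2.op x u‖ ^ 2 := pow_pos (norm_pos_iff.2 hu) 2
  have happ : ∀ (z : t₀) (x' y' : U2 K H) (r : ℝ), ⁅(z : U2 K H), y'⁆ = r • x' → ∀ v,
      U2.op (z : U2 K H) (U2.op y' v) - U2.op y' (U2.op (z : U2 K H) v) = r • U2.op x' v := by
    intro z x' y' r e v
    rw [← U2.op_lie_apply, e]
    rfl
  set c := (‖U2.op x u‖ ^ 2)⁻¹ * ⟪L (U2.op y u) - U2.op y (L u), U2.op x u⟫_ℝ with hc
  have key : ∀ x' y', (∀ z : t₀, ⁅(z : U2 K H), y'⁆ = a z • x') → adSkew hL.1 y' = c • x' := by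
    intro x' y' h'
    refine U2.op_ext fun v => ?_
    obtain ⟨z, hz⟩ := hL.exists_seq {U2.op y u, u, U2.op y' v, v}
    -- The sequence in `t₀` approximates `L` at the four vectors occurring in both commutators. The
    -- fixed pair `x, y` at `u` shows that the scalars `a (z n)` converge to `c`, and the arbitrary
    -- pair then inherits the same scalar.
    have t1 : Filter.Tendsto (fun n => a (z n)) Filter.atTop (nhds c) := by
      have e : ∀ n, a (z n) = (‖U2.op x u‖ ^ 2)⁻¹ *
          ⟪U2.op (z n : U2 K H) (U2.op y u) - U2.op y (U2.op (z n : U2 K H) u), U2.op x u⟫_ℝ := by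
        intro n
        rw [happ (z n) x y _ (h (z n)).2, real_inner_smul_left, real_inner_self_eq_norm_sq]
        field_simp
      simp_rw [e]
      refine Filter.Tendsto.const_mul _ (Filter.Tendsto.inner (Filter.Tendsto.sub ?_ ?_)
        tendsto_const_nhds)
      · exact hz _ (by simp)
      · exact ((U2.op y).continuous.tendsto _).comp (hz _ (by simp))
    have t2 : Filter.Tendsto (fun n => a (z n) • U2.op x' v) Filter.atTop
        (nhds (U2.op (adSkew hL.1 y') v)) := by
      simp_rw [← happ _ x' y' _ (h' _)]
      rw [op_adSkew]
      refine Filter.Tendsto.sub (hz _ (by simp)) ?_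
      exact ((U2.op y').continuous.tendsto _).comp (hz _ (by simp))
    exact tendsto_nhds_unique t2 (t1.smul_const _)
  refine ⟨c, fun x' y' h' => ⟨?_, key x' y' fun z => (h' z).2⟩⟩
  rw [key (-y') x' fun z => by rw [(h' z).1, smul_neg], smul_neg]

/-- `ad Λ_μ` is a scalar on each weight space. Pairing `Λ_μ` with the finite rank element `[x₀, y₀]
∈ t₀` gives `-c ‖x₀‖²` by invariance and `μ([x₀, y₀]) = -‖x₀‖² μ(α^♯)` by hypothesis. -/
theorem isSlanting_adSkew (d : ScalarData K) (hφ : FiniteOrder φ) (hL : IsSharpOp t₀ μ L)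
    (hm : IsMaxAbelianIn t₀ (fixedPoints φ)) : IsSlanting t₀ μ (adSkew hL.1) := by
  have ht : t₀ ≤ fixedPoints φ := hm.1.1
  rw [isSlanting_iff]
  intro a x y h
  by_cases ha : a = 0
  · have h0 : ∀ z, (∀ w : t₀, ⁅(w : U2 K H), z⁆ = 0) → adSkew hL.1 z = 0 := by
      intro z hz
      by_cases hz0 : z = 0
      · rw [hz0, map_zero]
      · have hp : IsWeightPair t₀ 0 z 0 := fun w => by simp [hz w]
        obtain ⟨c, hc⟩ := hL.exists_eigenvalue hp hz0
        rw [(hc z 0 hp).1, smul_zero, neg_zero]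
    subst ha
    rw [sharp_zero, map_zero, zero_smul, zero_smul, neg_zero]
    exact ⟨h0 x fun w => by rw [(h w).1]; simp, h0 y fun w => by rw [(h w).2]; simp⟩
  · by_cases hne : x ≠ 0 ∨ y ≠ 0
    · have haw : a ∈ weights t₀ := ⟨ha, fun hb => by
        have := cmk_mem_weightSpace.2 h
        rw [hb, Submodule.mem_bot, cmk_eq_zero] at this
        exact hne.elim (fun h => h this.1) (fun h => h this.2)⟩
      obtain ⟨n, hn⟩ := exists_mem_weightsAt hφ ht haw
      obtain ⟨-, x₀, y₀, hne₀, h₀⟩ := mem_weightsAt.1 hn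
      have hx₀ := h₀.pair.re_ne_zero ha hne₀
      obtain ⟨c, hc⟩ := hL.exists_eigenvalue h₀.pair hx₀
      have hpos : 0 < ‖x₀‖ ^ 2 := pow_pos (norm_pos_iff.2 hx₀) 2
      have hfr : HasFiniteRank ⁅x₀, y₀⁆ := (h₀.pair.hasFiniteRank d hφ hm ha).lie
        (h₀.pair.mul_I.hasFiniteRank d hφ hm ha)
      have e1 := hL.2.2 ⟨⁅x₀, y₀⁆, h₀.lie_mem hm⟩ hfr
      change trPair L (U2.op ⁅x₀, y₀⁆) = _ at e1
      rw [trPair_skew_lie hL.1, (hc x₀ y₀ h₀.pair).1, inner_neg_left, real_inner_smul_left,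
        real_inner_self_eq_norm_sq, ← h₀.pair.norm_eq ha] at e1
      have e2 : sharp t₀ a = -((‖x₀‖ ^ 2)⁻¹ • ⟨⁅x₀, y₀⁆, h₀.lie_mem hm⟩) := by
        refine sharp_eq fun z => ?_
        change ⟪-((‖x₀‖ ^ 2)⁻¹ • ⁅x₀, y₀⁆), (z : U2 K H)⟫_ℝ = a z
        rw [inner_neg_left, real_inner_smul_left, h₀.pair.inner_lie_eq]
        field_simp
      have e3 : μ (sharp t₀ a) = c := by
        rw [e2, map_neg, map_smul, ← e1, smul_eq_mul]
        field_simp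
      rw [e3]
      exact hc x y h
    · push Not at hne
      rw [hne.1, hne.2]
      simp

end SharpOp

/-! ### Isomorphisms of affinisations -/

section Untwisting

variable {k : Type*} [HilbertLieAlgebra k] {φ ψ : k ≃ₗ⁅ℝ⁆ k} {W : ℝ → k ≃ₗ⁅ℝ⁆ k} {A D D' : k →L[ℝ] k}

/-- `W` is a smooth curve of isometric automorphisms with `W' = -A W` that transforms `φ`-twisted
loops into `ψ`-twisted ones. -/
structure IsUntwisting (φ ψ : k ≃ₗ⁅ℝ⁆ k) (W : ℝ → k ≃ₗ⁅ℝ⁆ k) (A : k →L[ℝ] k) : Prop where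
  contDiff : ∀ ξ : ℝ → k, ContDiff ℝ ∞ ξ → ContDiff ℝ ∞ fun s => W s (ξ s)
  contDiff_symm : ∀ ξ : ℝ → k, ContDiff ℝ ∞ ξ → ContDiff ℝ ∞ fun s => (W s).symm (ξ s)
  period : ∀ s x, W (s + 2 * Real.pi) (φ.symm x) = ψ.symm (W s x)
  inner_map : ∀ s x y, ⟪W s x, W s y⟫_ℝ = ⟪x, y⟫_ℝ
  hasDerivAt : ∀ (ξ : ℝ → k) (ξ' : k) (s : ℝ), HasDerivAt ξ ξ' s →
    HasDerivAt (fun s => W s (ξ s)) (W s ξ' - A (W s (ξ s))) s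

namespace IsUntwisting

/-- The induced isomorphism of loop algebras. -/
def loopEquiv (hW : IsUntwisting φ ψ W A) : Loop φ ≃ₗ[ℝ] Loop ψ where
  toFun ξ := ⟨fun s => W s (ξ.1 s), hW.contDiff _ ξ.2.1, fun s => by
    change W (s + 2 * Real.pi) (ξ.1 (s + 2 * Real.pi)) = ψ.symm (W s (ξ.1 s))
    rw [ξ.2.2, hW.period]⟩
  invFun ξ := ⟨fun s => (W s).symm (ξ.1 s), hW.contDiff_symm _ ξ.2.1, fun s => by
    have e := hW.period s ((W s).symm (ξ.1 s))
    rw [LieEquiv.apply_symm_apply] at e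
    change (W (s + 2 * Real.pi)).symm (ξ.1 (s + 2 * Real.pi)) = φ.symm ((W s).symm (ξ.1 s))
    rw [ξ.2.2, ← e, LieEquiv.symm_apply_apply]⟩
  map_add' ξ η := Subtype.ext (funext fun s => map_add (W s) (ξ.1 s) (η.1 s))
  map_smul' c ξ := Subtype.ext (funext fun s => map_smul (W s) c (ξ.1 s))
  left_inv ξ := Subtype.ext (funext fun s => (W s).symm_apply_apply (ξ.1 s))
  right_inv ξ := Subtype.ext (funext fun s => (W s).apply_symm_apply (ξ.1 s))

theorem loopEquiv_apply (hW : IsUntwisting φ ψ W A) (ξ : Loop φ) (s : ℝ) :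
    (hW.loopEquiv ξ).1 s = W s (ξ.1 s) := rfl

theorem loopEquiv_lie (hW : IsUntwisting φ ψ W A) (ξ η : Loop φ) :
    hW.loopEquiv ⁅ξ, η⁆ = ⁅hW.loopEquiv ξ, hW.loopEquiv η⁆ :=
  Subtype.ext (funext fun s => LieEquiv.map_lie (W s) (ξ.1 s) (η.1 s))

theorem form_loopEquiv (hW : IsUntwisting φ ψ W A) (ξ η : Loop φ) :
    Loop.form (hW.loopEquiv ξ) (hW.loopEquiv η) = Loop.form ξ η := by
  unfold Loop.form
  simp_rw [loopEquiv_apply, hW.inner_map]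

/-- The product rule contributes `-A (W ξ)`, which cancels the term by which `D'` exceeds `D`. -/
theorem loopEquiv_loopDer (hW : IsUntwisting φ ψ W A) (h : IsTwistDerivation φ D)
    (h' : IsTwistDerivation ψ D') (hD : ∀ s x, D' (W s x) = A (W s x) + W s (D x)) (ξ : Loop φ) :
    hW.loopEquiv (h.loopDer ξ) = h'.loopDer (hW.loopEquiv ξ) := by
  refine Subtype.ext (funext fun s => ?_)
  rw [loopEquiv_apply, IsTwistDerivation.loopDer_apply, IsTwistDerivation.loopDer_apply,
    loopEquiv_apply, hD, map_add]
  have e := (hW.hasDerivAt ξ.1 _ s (Loop.differentiable ξ s).hasDerivAt).deriv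
  change _ = deriv (fun s => W s (ξ.1 s)) s + _
  rw [e]
  abel

/-- The induced isomorphism of affinisations. -/
noncomputable def affinisationEquiv (hW : IsUntwisting φ ψ W A) (h : IsTwistDerivation φ D)
    (h' : IsTwistDerivation ψ D') (hD : ∀ s x, D' (W s x) = A (W s x) + W s (D x)) :
    Affinisation h ≃ₗ⁅ℝ⁆ Affinisation h' where
  toFun p := Affinisation.mk h' p.1 (hW.loopEquiv p.2.1) p.2.2
  invFun p := Affinisation.mk h p.1 (hW.loopEquiv.symm p.2.1) p.2.2
  map_add' p q := Affinisation.ext' rfl (map_add hW.loopEquiv p.2.1 q.2.1) rfl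
  map_smul' c p := Affinisation.ext' rfl (map_smul hW.loopEquiv c p.2.1) rfl
  map_lie' := by
    rintro ⟨z, ξ, r⟩ ⟨w, η, t⟩
    refine Affinisation.ext' ?_ ?_ rfl
    · change Loop.form (h.loopDer ξ) η = Loop.form (h'.loopDer (hW.loopEquiv ξ)) (hW.loopEquiv η)
      rw [← hW.loopEquiv_loopDer h h' hD, hW.form_loopEquiv]
    · change hW.loopEquiv (⁅ξ, η⁆ + r • h.loopDer η - t • h.loopDer ξ) =
        ⁅hW.loopEquiv ξ, hW.loopEquiv η⁆ + r • h'.loopDer (hW.loopEquiv η) -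
          t • h'.loopDer (hW.loopEquiv ξ)
      rw [← hW.loopEquiv_loopDer h h' hD, ← hW.loopEquiv_loopDer h h' hD, ← hW.loopEquiv_lie,
        map_sub, map_add, map_smul, map_smul]
  left_inv p := Affinisation.ext' rfl (hW.loopEquiv.symm_apply_apply p.2.1) rfl
  right_inv p := Affinisation.ext' rfl (hW.loopEquiv.apply_symm_apply p.2.1) rfl

theorem affinisationEquiv_cartan {t₀ : LieSubalgebra ℝ k} (hW : IsUntwisting φ ψ W A)
    (h : IsTwistDerivation φ D) (h' : IsTwistDerivation ψ D')
    (hD : ∀ s x, D' (W s x) = A (W s x) + W s (D x)) (ht : t₀ ≤ fixedPoints φ)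
    (ht' : t₀ ≤ fixedPoints ψ) (hfix : ∀ s, ∀ x : t₀, W s x = x) (p : ℝ × t₀ × ℝ) :
    hW.affinisationEquiv h h' hD (cartan t₀ h ht p) = cartan t₀ h' ht' p :=
  Affinisation.ext' rfl (Subtype.ext (funext fun s => hfix s p.2.1)) rfl

end IsUntwisting

end Untwisting

/-! ### The flow of a bounded operator -/

section Flow

variable {k : Type*} [HilbertLieAlgebra k]

/-- The flow `e^{s A}` of a bounded operator `A`. -/
noncomputable def flow (A : k →L[ℝ] k) (s : ℝ) : k →L[ℝ] k := NormedSpace.exp (s • A)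

theorem flow_zero (A : k →L[ℝ] k) (x : k) : flow A 0 x = x := by
  rw [flow, zero_smul, NormedSpace.exp_zero]
  rfl

theorem contDiff_flow (A : k →L[ℝ] k) {f : ℝ → ℝ} (hf : ContDiff ℝ ∞ f) {ξ : ℝ → k}
    (hξ : ContDiff ℝ ∞ ξ) : ContDiff ℝ ∞ fun s => flow A (f s) (ξ s) := by
  refine ContDiff.clm_apply ?_ hξ
  rw [contDiff_iff_contDiffAt]
  intro s
  exact (NormedSpace.exp_analytic (𝕂 := ℝ) (f s • A)).contDiffAt.comp s
    (hf.smul contDiff_const).contDiffAt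

theorem hasDerivAt_flow (A : k →L[ℝ] k) {ξ : ℝ → k} {ξ' : k} {s : ℝ} (hξ : HasDerivAt ξ ξ' s) :
    HasDerivAt (fun s => flow A s (ξ s)) (A (flow A s (ξ s)) + flow A s ξ') s :=
  (hasDerivAt_exp_smul_const' (𝕂 := ℝ) A s).clm_apply hξ

end Flow

/-! ### One-parameter groups of unitary operators -/

section OneParameter

variable {K H : Type*} [Ring K] [StarRing K] [Algebra ℝ K] [NormedAddCommGroup H]
  [InnerProductSpace ℝ H] [CompleteSpace H] [Module K H] [IsScalarTower ℝ K H]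
  [IsHilbertOver K H]

theorem norm_conjAut (u : unitaryGroup K H) (x : U2 K H) : ‖conjAut u x‖ = ‖x‖ := by
  have e := hs_adjoint (x := U2.op x) (y := -U2.op x) (hBasis H)
    (HilbertBasis.ofRepr (u.1.trans (hBasis H).repr)) (fun v w => by simp [(U2.op_skew x).2])
  have e1 : ∀ i, ‖(-U2.op x) (HilbertBasis.ofRepr (u.1.trans (hBasis H).repr) i)‖ =
      ‖U2.op (conjAut u x) (hBasis H i)‖ := by
    intro i
    rw [_root_.neg_apply, norm_neg, conjAut_apply, LinearIsometryEquiv.norm_map]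
    rfl
  simp_rw [e1] at e
  rw [← ENNReal.ofReal_tsum_of_nonneg (fun _ => by positivity) (U2.op_hs x),
    ← ENNReal.ofReal_tsum_of_nonneg (fun _ => by positivity) (U2.op_hs (conjAut u x)),
    ENNReal.ofReal_eq_ofReal_iff (tsum_nonneg fun _ => by positivity)
      (tsum_nonneg fun _ => by positivity), ← U2.norm_toLp_sq, ← U2.norm_toLp_sq, ← U2.norm_def,
    ← U2.norm_def] at e
  exact ((pow_left_inj₀ (norm_nonneg _) (norm_nonneg _) two_ne_zero).1 e).symm

theorem inner_conjAut (u : unitaryGroup K H) (x y : U2 K H) :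
    ⟪conjAut u x, conjAut u y⟫_ℝ = ⟪x, y⟫_ℝ :=
  (LinearIsometry.mk (conjAut u : U2 K H →ₗ[ℝ] U2 K H) (norm_conjAut u)).inner_map_map x y

variable (K H) in
/-- The embedding of `u₂(H)` into the bounded operators. -/
noncomputable def opCLM : U2 K H →L[ℝ] H →L[ℝ] H :=
  LinearMap.mkContinuous
    { toFun := U2.op
      map_add' := U2.op_add
      map_smul' := U2.op_smul } 1 fun x => by
    rw [one_mul, U2.norm_def]
    exact U2.norm_op_le x

/-- The unitary curve is only given as strongly differentiable on `H`. Identifying its conjugation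
action with an operator exponential on `u₂(H)` yields smoothness in the Hilbert-Schmidt norm. -/
theorem conjAut_eq_flow {V : ℝ → unitaryGroup K H} {L : H →L[ℝ] H} (hL : IsSkew K L)
    (h0 : V 0 = 1)
    (hV : ∀ (s : ℝ) (v : H), HasDerivAt (fun r => (V r).1 v) (-(L ((V s).1 v))) s) (s : ℝ)
    (x : U2 K H) : conjAut (V s) x = flow (-adSkew hL) s x := by
  set E : ℝ → U2 K H →L[ℝ] U2 K H := flow (-adSkew hL) with hE
  have hEd : ∀ r, HasDerivAt (fun r => E r x) (-adSkew hL (E r x)) r := by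
    intro r
    refine (hasDerivAt_flow (-adSkew hL) (hasDerivAt_const r x)).congr_deriv ?_
    rw [map_zero, add_zero]
    rfl
  -- The matrix coefficients of `V⁻¹ (E x) V` are constant: the derivatives of the two unitary
  -- factors cancel the commutator with `L`.
  have key : ∀ v w, ⟪U2.op (E s x) ((V s).1 v), (V s).1 w⟫_ℝ = ⟪U2.op x v, w⟫_ℝ := by
    intro v w
    have hd : ∀ r, HasDerivAt (fun r => ⟪U2.op (E r x) ((V r).1 v), (V r).1 w⟫_ℝ) 0 r := by
      intro r
      have h1 := (((opCLM K H).hasFDerivAt.comp_hasDerivAt r (hEd r)).clm_apply (hV r v)).inner ℝ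
        (hV r w)
      refine h1.congr_deriv ?_
      change ⟪U2.op (E r x) ((V r).1 v), -(L ((V r).1 w))⟫_ℝ +
        ⟪-(U2.op (adSkew hL (E r x)) ((V r).1 v)) + U2.op (E r x) (-(L ((V r).1 v))),
          (V r).1 w⟫_ℝ = 0
      rw [op_adSkew, map_neg, inner_neg_right, inner_add_left, inner_neg_left, inner_neg_left,
        inner_sub_left, hL.2]
      ring
    have hc := is_const_of_deriv_eq_zero (fun r => (hd r).differentiableAt)
      (fun r => (hd r).deriv) s 0
    refine hc.trans ?_
    rw [hE, flow_zero, h0]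
    rfl
  refine U2.op_ext fun v => ext_inner_right ℝ fun w => ?_
  have e := key ((V s).1.symm v) ((V s).1.symm w)
  rw [LinearIsometryEquiv.apply_symm_apply, LinearIsometryEquiv.apply_symm_apply] at e
  rw [conjAut_apply]
  refine Eq.trans ?_ e.symm
  rw [← (V s).1.inner_map_map (U2.op x _), LinearIsometryEquiv.apply_symm_apply]

theorem conjAut_mul (u v : unitaryGroup K H) (x : U2 K H) :
    conjAut (u * v) x = conjAut u (conjAut v x) := rfl

/-- The curve of automorphisms given by a one-parameter group of unitary operators. -/
theorem isUntwisting_conjAut {φ ψ : U2 K H ≃ₗ⁅ℝ⁆ U2 K H} {U : ℝ → unitaryGroup K H}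
    (hU : ∀ s r, U (s + r) = U s * U r)
    (hU_comm : ∀ s x, conjAut (U s) (ψ x) = ψ (conjAut (U s) x))
    (hφψ : ∀ x, conjAut (U 1) (ψ x) = φ x) {L : H →L[ℝ] H} (hL : IsSkew K L)
    (hU_deriv : ∀ (s : ℝ) (v : H), HasDerivAt (fun r => (U (r / (2 * Real.pi))).1 v)
      (-(L ((U (s / (2 * Real.pi))).1 v))) s) :
    IsUntwisting φ ψ (fun s => conjAut (U (s / (2 * Real.pi)))) (adSkew hL) := by
  have hU0 : U 0 = 1 := by
    have e := hU 0 0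
    rw [add_zero] at e
    exact (mul_eq_left.1 e.symm)
  have hinv : ∀ s, U (-s) = (U s)⁻¹ := fun s => by
    rw [eq_inv_iff_mul_eq_one, ← hU, neg_add_cancel, hU0]
  have hexp : ∀ s x, conjAut (U (s / (2 * Real.pi))) x =
      flow (-adSkew hL) s x :=
    conjAut_eq_flow (V := fun s => U (s / (2 * Real.pi))) hL (by rw [zero_div, hU0]) hU_deriv
  refine ⟨fun ξ hξ => ?_, fun ξ hξ => ?_, fun s x => ?_, fun s => inner_conjAut _,
    fun ξ ξ' s hξ => ?_⟩
  · simp_rw [hexp]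
    exact contDiff_flow _ contDiff_id hξ
  · have e : ∀ s x, (conjAut (U (s / (2 * Real.pi)))).symm x =
        flow (-adSkew hL) (-s) x := by
      intro s x
      rw [← hexp, neg_div, hinv]
      rfl
    simp_rw [e]
    exact contDiff_flow _ contDiff_neg hξ
  · have e1 : (s + 2 * Real.pi) / (2 * Real.pi) = s / (2 * Real.pi) + 1 := by
      field_simp
    rw [e1, hU, conjAut_mul]
    have e2 : ψ (conjAut (U (s / (2 * Real.pi))) (conjAut (U 1) (φ.symm x))) =
        conjAut (U (s / (2 * Real.pi))) x := by
      rw [← hU_comm, ← hU_comm, hφψ, LieEquiv.apply_symm_apply]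
    rw [← e2, LieEquiv.symm_apply_apply]
  · simp_rw [hexp]
    refine (hasDerivAt_flow (-adSkew hL) hξ).congr_deriv ?_
    change -adSkew hL (flow (-adSkew hL) s (ξ s)) + _ = _
    abel

end OneParameter

theorem IsSlanting.add {k : Type*} [HilbertLieAlgebra k] {t₀ : LieSubalgebra ℝ k}
    {μ ν : Module.Dual ℝ t₀} {D D' : k →L[ℝ] k} (h : IsSlanting t₀ μ D)
    (h' : IsSlanting t₀ ν D') : IsSlanting t₀ (μ + ν) (D + D') := by
  rw [isSlanting_iff] at h h' ⊢
  intro a x y hxy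
  change D x + D' x = -((μ (sharp t₀ a) + ν (sharp t₀ a)) • y) ∧
    D y + D' y = (μ (sharp t₀ a) + ν (sharp t₀ a)) • x
  rw [(h a x y hxy).1, (h a x y hxy).2, (h' a x y hxy).1, (h' a x y hxy).2, add_smul, add_smul,
    neg_add]
  exact ⟨rfl, rfl⟩

end TwistedLoop

/-! ### The main theorem. -/

theorem proposition4p2 {K H : Type*} [Ring K] [StarRing K] [Algebra ℝ K]
    (hK : Nonempty (K ≃⋆ₐ[ℝ] ℝ) ∨ Nonempty (K ≃⋆ₐ[ℝ] ℂ) ∨ Nonempty (K ≃⋆ₐ[ℝ] ℍ[ℝ]))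
    [NormedAddCommGroup H] [InnerProductSpace ℝ H] [CompleteSpace H] [Module K H]
    [IsScalarTower ℝ K H] [IsHilbertOver K H] (hH : ¬ FiniteDimensional ℝ H)
    (φ ψ : U2 K H ≃ₗ⁅ℝ⁆ U2 K H) (hφ : FiniteOrder φ) (hψ : FiniteOrder ψ)
    (U : ℝ → unitaryGroup K H) (hU : ∀ s r, U (s + r) = U s * U r)
    (hU_smooth : ∀ v : H, ContDiff ℝ ∞ fun s => (U s).1 v)
    (hU_comm : ∀ s x, conjAut (U s) (ψ x) = ψ (conjAut (U s) x))
    (hφψ : ∀ x, conjAut (U 1) (ψ x) = φ x)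
    (t t₀ : LieSubalgebra ℝ (U2 K H)) (ht : IsMaxAbelianIn t ⊤)
    (ht_φ : t ⊓ fixedPoints φ = t₀) (ht_ψ : t ⊓ fixedPoints ψ = t₀)
    (hmax_φ : IsMaxAbelianIn t₀ (fixedPoints φ)) (hmax_ψ : IsMaxAbelianIn t₀ (fixedPoints ψ))
    (hfix : ∀ s, t₀ ≤ t ⊓ fixedPoints (conjAut (U s)))
    (μ ν : Module.Dual ℝ t₀)
    (hν : ∃ C : ℝ, ∀ a ∈ weights t₀, |ν (sharp t₀ a)| ≤ C)
    (L : H →L[ℝ] H) (hL : IsSharpOp t₀ μ L)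
    (hU_deriv : ∀ (s : ℝ) (v : H), HasDerivAt (fun r => (U (r / (2 * Real.pi))).1 v)
      (-(L ((U (s / (2 * Real.pi))).1 v))) s)
    (hU_L : ∀ (s : ℝ) (v : H), L ((U (s / (2 * Real.pi))).1 v) = (U (s / (2 * Real.pi))).1 (L v)) :
    (∃! D, IsSlanting t₀ ν D) ∧ (∃! D, IsSlanting t₀ (μ + ν) D) ∧
    ∃ (h : IsTwistDerivation φ (slantOp t₀ ν)) (h' : IsTwistDerivation ψ (slantOp t₀ (μ + ν)))
      (hsub : t₀ ≤ fixedPoints φ) (hsub' : t₀ ≤ fixedPoints ψ)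
      (Φ : Affinisation h ≃ₗ⁅ℝ⁆ Affinisation h'),
      -- the isomorphism of double extensions
      (∀ (z : ℝ) (ξ : Loop φ) (r : ℝ), ∃ η : Loop ψ,
        (∀ s, η.1 s = conjAut (U (s / (2 * Real.pi))) (ξ.1 s)) ∧
        Φ (Affinisation.mk h z ξ r) = Affinisation.mk h' z η r) ∧
      (∀ p, Φ (cartan t₀ h hsub p) = cartan t₀ h' hsub' p) ∧
      -- the compact roots of both algebras, as pairs
      {α | IsCompactRoot (cartan t₀ h hsub) α} =
        affineWeight t₀ (autOrder φ) ν '' rootPairs t₀ φ ∧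
      Set.InjOn (affineWeight t₀ (autOrder φ) ν) (rootPairs t₀ φ) ∧
      {α | IsCompactRoot (cartan t₀ h' hsub') α} =
        affineWeight t₀ (autOrder ψ) (μ + ν) '' rootPairs t₀ ψ ∧
      Set.InjOn (affineWeight t₀ (autOrder ψ) (μ + ν)) (rootPairs t₀ ψ) ∧
      -- the induced isomorphism of root systems
      Set.BijOn (untwistRoot t₀ μ (autOrder φ) (autOrder ψ)) (rootPairs t₀ φ) (rootPairs t₀ ψ) ∧
      IsRootSystemIso t₀ (rootPairs t₀ φ) (rootPairs t₀ ψ)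
        (untwistRoot t₀ μ (autOrder φ) (autOrder ψ)) ∧
      (∀ p ∈ rootPairs t₀ φ,
        (rootSpace (cartan t₀ h hsub) (affineWeight t₀ (autOrder φ) ν p)).map
            ((Φ : Affinisation h →ₗ[ℝ] Affinisation h').baseChange ℂ) =
          rootSpace (cartan t₀ h' hsub') (affineWeight t₀ (autOrder ψ) (μ + ν)
            (untwistRoot t₀ μ (autOrder φ) (autOrder ψ) p))) ∧
      -- the Weyl groups in `GL(t₀^e)`
      weylGroup (cartan t₀ h hsub) = weylGroup (cartan t₀ h' hsub') := by
  obtain ⟨d⟩ := nonempty_scalarData hK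
  have hiφ : ∀ x, ‖φ x‖ = ‖x‖ := hφ.norm_map d hH
  have hiψ : ∀ x, ‖ψ x‖ = ‖x‖ := hψ.norm_map d hH
  have hd : HasDenseWeights t₀ := hasDenseWeights d hmax_φ.1.2
  have hc : IsClosed (t₀ : Set (U2 K H)) := hmax_φ.isClosed hiφ
  have hsub : t₀ ≤ fixedPoints φ := hmax_φ.1.1
  have hsub' : t₀ ≤ fixedPoints ψ := hmax_ψ.1.1
  have hA : IsSlanting t₀ μ (adSkew hL.1) := isSlanting_adSkew d hφ hL hmax_φ
  have hex : ∃ D, IsSlanting t₀ ν D := exists_isSlanting hd hν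
  have hD : IsSlanting t₀ ν (slantOp t₀ ν) := isSlanting_slantOp hex
  have hAD : IsSlanting t₀ (μ + ν) (adSkew hL.1 + slantOp t₀ ν) := hA.add hD
  -- Existence comes from the explicit operator `ad Λ_μ + D_ν`, not from a bound on the numbers
  -- `μ(α^♯)`.
  have hex' : ∃ D, IsSlanting t₀ (μ + ν) D := ⟨_, hAD⟩
  have hD' : IsSlanting t₀ (μ + ν) (slantOp t₀ (μ + ν)) := isSlanting_slantOp hex'
  have hfix' : ∀ s, ∀ x : t₀, conjAut (U (s / (2 * Real.pi))) (x : U2 K H) = x :=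
    fun s x => (hfix _ x.2).2
  have h : IsTwistDerivation φ (slantOp t₀ ν) :=
    isTwistDerivation_slantOp hd hc hex φ hiφ fun z => hsub z.2
  have h' : IsTwistDerivation ψ (slantOp t₀ (μ + ν)) :=
    isTwistDerivation_slantOp hd hc hex' ψ hiψ fun z => hsub' z.2
  have hW := isUntwisting_conjAut hU hU_comm hφψ hL.1 hU_deriv
  -- By uniqueness `D_{μ+ν} = ad Λ_μ + D_ν`, and `D_ν` commutes with the conjugations because they
  -- are isometric and fix `t₀`.
  have hDD' : ∀ s x, slantOp t₀ (μ + ν) (conjAut (U (s / (2 * Real.pi))) x) =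
      adSkew hL.1 (conjAut (U (s / (2 * Real.pi))) x) +
        conjAut (U (s / (2 * Real.pi))) (slantOp t₀ ν x) := by
    intro s x
    rw [hD'.unique hd hAD, _root_.add_apply,
      hD.comm hd _ (hfix' s) (norm_conjAut _)]
  let Φ := hW.affinisationEquiv h h' hDD'
  have hΦ : ∀ p, Φ (cartan t₀ h hsub p) = cartan t₀ h' hsub' p :=
    hW.affinisationEquiv_cartan h h' hDD' hsub hsub' hfix'
  have hr := setOf_isCompactRoot hmax_φ hφ hD (hD := h) (ht := hsub)
  have hr' := setOf_isCompactRoot hmax_ψ hψ hD' (hD := h') (ht := hsub')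
  have hNφ := autOrder_ne_zero hφ
  have hNψ := autOrder_ne_zero hψ
  -- The two algebras have the same compact roots as functionals on `t₀^e`; comparing their two
  -- labellings gives the bijection.
  have hb := bijOn_untwistRoot hNφ hNψ
    (hr.symm.trans ((setOf_isCompactRoot_eq Φ hΦ).trans hr'))
  have hrep : ∀ p ∈ rootPairs t₀ φ, IsRepresentable t₀ p.1 := by
    rintro p ⟨n, -, hn⟩
    obtain ⟨-, x, y, hne, hxy⟩ := mem_weightsAt.1 hn
    exact hxy.pair.isRepresentable hc hne
  refine ⟨⟨_, hD, fun D hD₁ => hD₁.unique hd hD⟩, ⟨_, hD', fun D hD₁ => hD₁.unique hd hD'⟩, h, h',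
    hsub, hsub', Φ, fun z ξ r => ⟨hW.loopEquiv ξ, fun s => rfl, rfl⟩, hΦ, hr,
    (affineWeight_injective hNφ ν).injOn, hr', (affineWeight_injective hNψ (μ + ν)).injOn, hb,
    isRootSystemIso_untwistRoot hNφ hNψ hrep hb, fun p _ => ?_, weylGroup_eq Φ hΦ⟩
  rw [map_rootSpace Φ hΦ, affineWeight_untwistRoot hNψ]
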